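/- Conventions. Let $M$ be a complex manifold with holomorphic tangent bundle $\Theta_M$, $\lambda$ the affine coordinate on $\mathbb P^1$, $p:\mathbb P^1\times M\to M$ the projection and $j(\lambda,t)=(-\lambda,t)$. For $k\in\mathbb Z$ let $\lambda^{k}\mathcal O$ be the sheaf of meromorphic functions on $\mathbb P^1\times M$ generated by $\lambda^{k}$. Filtrations by subbundles are indexed by $\mathbb Z$, increasing, exhaustive and separated. A *trTLE-structure* on $M$ is a holomorphic vector bundle $\mathcal H$ on $\mathbb P^1\times M$ for which $p^*p_*\mathcal H\to\mathcal H$ is an isomorphism, with a flat meromorphic connection $\nabla:\mathcal H\to\mathcal H\otimes\Omega^1(\log\{0,\infty\}\times M)\otimes\mathcal O(\{0\}\times M)$. A *mixed trTLEP-structure* $\mathcal T=(\mathcal H,\nabla,W,P)$ is a trTLE-structure with a filtration $W=(W_k)$ by $\nabla$-flat holomorphic subbundles such that every $\mathrm{Gr}^W_k\mathcal H=W_k/W_{k-1}$ is a trTLE-structure, and with $\nabla$-flat, $(-1)^k$-symmetric pairings $P_k:\mathrm{Gr}^W_k\mathcal H\otimes j^*\mathrm{Gr}^W_k\mathcal H\to\lambda^{-k}\mathcal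 O$ such that $\lambda^kP_k$ is non-degenerate at every point of $\mathbb P^1\times M$. An isomorphism of mixed trTLEP-structures is an isomorphism of holomorphic vector bundles compatible with the connections, the filtrations and the pairings. A *Frobenius type structure* on a holomorphic vector bundle $K$ on $M$ consists of a flat holomorphic connection $\nabla^{\rm r}$, a Higgs field $\mathcal C$ and $\mathcal U,\mathcal V\in\mathrm{End}(K)$ with $\nabla^{\rm r}(\mathcal C)=\nabla^{\rm r}(\mathcal V)=[\mathcal C,\mathcal U]=0$ and $\nabla^{\rm r}(\mathcal U)-[\mathcal C,\mathcal V]+\mathcal C=0$. One on $\mathcal H|_{\lambda=0}$ is *associated* to the trTLE-structure $(\mathcal H,\nabla)$ if, under the natural isomorphism $\mathcal H\simeq p^*(\mathcal H|_{\lambda=0})$, $$\nabla=p^*\nabla^{\rm r}+\tfrac1\lambda p^*\mathcal C+\bigl(\tfrac1\lambda p^*\mathcal U-p^*\mathcal V\bigr)\tfrac{d\lambda}{\lambda}.$$ A *Saito structure* $(\theta,\boldsymbol\nabla,e,E)$ on $M$ consists of a symmetric Higgs field $\theta$ on $\Theta_M$ ($\theta_ab=\theta_ba$), a torsion free flat holomorphic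 connection $\boldsymbol\nabla$ on $\Theta_M$, and global holomorphic vector fields $e,E$ with $\boldsymbol\nabla e=0$ and $\theta_ea=-a$ for all $a$, such that the connection $$\hat\nabla=p^*\boldsymbol\nabla+\tfrac1\lambda p^*\theta-\bigl(\tfrac1\lambda p^*\theta_E+p^*\boldsymbol\nabla_\bullet E\bigr)\tfrac{d\lambda}{\lambda}$$ on $p^*\Theta_M$ is flat. For $d\in\mathbb C$, a *mixed Frobenius structure (MFS) of charge $d$* on $M$ is a Saito structure with a filtration $\mathcal I=(\mathcal I_k)$ of $\Theta_M$ by holomorphic subbundles which are $\theta$-invariant, $\boldsymbol\nabla$-flat and closed under $[E,\cdot]$, and with holomorphic, $\boldsymbol\nabla$-flat, symmetric, non-degenerate pairings $g_k$ on $\mathrm{Gr}^{\mathcal I}_k\Theta_M$ such that $g_k(\theta_xy,z)=g_k(y,\theta_xz)$ and $\mathrm{Lie}_E(g_k)=(2-d+k)g_k$. An MFS $\mathscr F$ of charge $d$ induces the mixed trTLEP-structure $\mathcal T(\mathscr F)=\bigl(p^*\Theta_M,\ \hat\nabla+\tfrac{2-d}{2}\,\mathrm{id}\,\tfrac{d\lambda}{\lambda},\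 p^*\mathcal I,\ (\lambda^{-k}\,p^*g_k)_k\bigr)$. **Proposition.** Let $\mathcal T=(\mathcal H,\nabla,W,P)$ be a mixed trTLEP-structure on a complex manifold $M$. There is a unique Frobenius type structure $(\nabla^{\rm r},\mathcal C,\mathcal U,\mathcal V)$ on $\mathcal H|_{\lambda=0}$ associated to $(\mathcal H,\nabla)$. Let $d\in\mathbb C$ and let $\zeta$ be a $\nabla^{\rm r}$-flat global holomorphic section of $\mathcal H|_{\lambda=0}$ such that * (IdC) $\mathcal C_\bullet\zeta:\Theta_M\to\mathcal H|_{\lambda=0}$, $a\mapsto\mathcal C_a\zeta$, is an isomorphism; * $(\mathrm{EC})_d$ $\mathcal V\zeta=\frac d2\zeta$. Then there is a unique MFS $\mathscr F$ of charge $d$ on $M$ such that its unit field $e$ satisfies $-\mathcal C_e\zeta=\zeta$ and the morphism $$-p^*(\mathcal C_\bullet\zeta):p^*\Theta_M\to p^*(\mathcal H|_{\lambda=0})\simeq\mathcal H$$ is an isomorphism of mixed trTLEP-structures from $\mathcal T(\mathscr F)$ to $\mathcal T$. -/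

import Mathlib

open Bundle Filter Set
open scoped Manifold Topology ContDiff

namespace MixedFrobenius
noncomputable section

/-- Inversion `λ ↦ 1/λ` of the Riemann sphere. -/
def sphereInv (p : OnePoint ℂ) : OnePoint ℂ :=
  open Classical in p.elim ((0 : ℂ) : OnePoint ℂ) fun z => if z = 0 then OnePoint.infty else ((z⁻¹ : ℂ) : OnePoint ℂ)

theorem sphereInv_infty : sphereInv OnePoint.infty = ((0 : ℂ) : OnePoint ℂ) := rfl

theorem sphereInv_zero : sphereInv ((0 : ℂ) : OnePoint ℂ) = OnePoint.infty := by simp [sphereInv]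

theorem sphereInv_coe {z : ℂ} (hz : z ≠ 0) : sphereInv (z : OnePoint ℂ) = ((z⁻¹ : ℂ) : OnePoint ℂ) := by
  simp [sphereInv, hz]

theorem sphereInv_sphereInv (p : OnePoint ℂ) : sphereInv (sphereInv p) = p := by
  induction p using OnePoint.rec with
  | infty => rw [sphereInv_infty, sphereInv_zero]
  | coe z =>
    by_cases hz : z = 0
    · rw [hz, sphereInv_zero, sphereInv_infty]
    · rw [sphereInv_coe hz, sphereInv_coe (inv_ne_zero hz), inv_inv]

theorem continuous_sphereInv : Continuous sphereInv := by
  rw [continuous_iff_continuousAt]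
  intro p
  induction p using OnePoint.rec with
  | infty =>
    rw [OnePoint.continuousAt_infty', sphereInv_infty]
    have h : Tendsto (fun z : ℂ => ((z⁻¹ : ℂ) : OnePoint ℂ)) (coclosedCompact ℂ)
        (𝓝 ((0 : ℂ) : OnePoint ℂ)) := by
      refine (OnePoint.continuous_coe.tendsto 0).comp ?_
      rw [coclosedCompact_eq_cocompact, ← Metric.cobounded_eq_cocompact]
      exact tendsto_inv₀_cobounded
    refine h.congr' ?_
    have : ∀ᶠ z : ℂ in coclosedCompact ℂ, z ≠ 0 := by
      rw [coclosedCompact_eq_cocompact]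
      exact (isCompact_singleton (x := (0 : ℂ))).compl_mem_cocompact
    filter_upwards [this] with z hz
    simp [sphereInv_coe hz]
  | coe z =>
    rw [OnePoint.continuousAt_coe]
    by_cases hz : z = 0
    · subst hz
      rw [ContinuousAt, Function.comp_apply, sphereInv_zero, ← nhdsNE_sup_pure, tendsto_sup]
      constructor
      · have h : Tendsto (fun z : ℂ => ((z⁻¹ : ℂ) : OnePoint ℂ)) (𝓝[≠] (0 : ℂ)) (𝓝 OnePoint.infty) := by
          refine OnePoint.tendsto_coe_infty.comp ?_
          rw [coclosedCompact_eq_cocompact, ← Metric.cobounded_eq_cocompact]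
          exact tendsto_inv₀_nhdsNE_zero
        refine h.congr' ?_
        filter_upwards [self_mem_nhdsWithin] with z hz
        simp [sphereInv_coe hz]
      · rw [tendsto_pure_left]
        intro s hs
        simpa [sphereInv_zero] using mem_of_mem_nhds hs
    · have h : ContinuousAt (fun z : ℂ => ((z⁻¹ : ℂ) : OnePoint ℂ)) z :=
        OnePoint.continuous_coe.continuousAt.comp (continuousAt_inv₀ hz)
      refine h.congr ?_
      filter_upwards [isOpen_ne.mem_nhds hz] with w hw
      simp [sphereInv_coe hw]

/-- Inversion as a self-homeomorphism. -/
def sphereInvHomeo : OnePoint ℂ ≃ₜ OnePoint ℂ where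
  toFun := sphereInv
  invFun := sphereInv
  left_inv := sphereInv_sphereInv
  right_inv := sphereInv_sphereInv
  continuous_toFun := continuous_sphereInv
  continuous_invFun := continuous_sphereInv

/-- The affine chart `λ` on `ℙ¹ ∖ {∞}`. -/
def chartFin : OpenPartialHomeomorph (OnePoint ℂ) ℂ :=
  (OnePoint.isOpenEmbedding_coe.toOpenPartialHomeomorph (fun z : ℂ => (z : OnePoint ℂ))).symm

/-- The affine chart `1/λ` on `ℙ¹ ∖ {0}`. -/
def chartInf : OpenPartialHomeomorph (OnePoint ℂ) ℂ :=
  sphereInvHomeo.toOpenPartialHomeomorph.trans chartFin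

theorem chartFin_symm_apply (z : ℂ) : chartFin.symm z = (z : OnePoint ℂ) := rfl

theorem chartFin_source : chartFin.source = range ((↑) : ℂ → OnePoint ℂ) := by
  simp [chartFin]

theorem chartFin_target : chartFin.target = univ := by
  simp [chartFin]

theorem chartFin_coe (z : ℂ) : chartFin (z : OnePoint ℂ) = z := by
  rw [← chartFin_symm_apply]
  exact chartFin.right_inv (by simp [chartFin_target])

theorem chartInf_apply (p : OnePoint ℂ) : chartInf p = chartFin (sphereInv p) := rfl

theorem chartInf_symm_apply (z : ℂ) : chartInf.symm z = sphereInv (z : OnePoint ℂ) := rfl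

theorem chartInf_source : chartInf.source = sphereInv ⁻¹' range ((↑) : ℂ → OnePoint ℂ) := by
  simp [chartInf, chartFin_source, sphereInvHomeo]

/-- The Riemann sphere `ℙ¹`, with its two affine charts `λ` and `1/λ`. The preferred chart at
every finite point is `λ`. -/
instance : ChartedSpace ℂ (OnePoint ℂ) where
  atlas := {chartFin, chartInf}
  chartAt p := open Classical in if p = OnePoint.infty then chartInf else chartFin
  mem_chart_source p := by
    by_cases hp : p = OnePoint.infty
    · simp only [hp, if_true, chartInf_source, mem_preimage, sphereInv_infty]
      exact mem_range_self _
    · simp only [hp, if_false, chartFin_source]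
      obtain ⟨z, rfl⟩ := OnePoint.ne_infty_iff_exists.1 hp
      exact mem_range_self _
  chart_mem_atlas p := by
    by_cases hp : p = OnePoint.infty <;> simp [hp]

instance : IsManifold 𝓘(ℂ, ℂ) ω (OnePoint ℂ) := by
  apply isManifold_of_contDiffOn
  have key : ∀ s : Set ℂ, (∀ z ∈ s, z ≠ 0) → ∀ f : ℂ → ℂ, (∀ z : ℂ, z ≠ 0 → f z = z⁻¹) →
      ContDiffOn ℂ ω f s := by
    intro s hs f hf
    have : ContDiffOn ℂ ω (fun z : ℂ => z⁻¹) s := fun z hz =>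
      (contDiffAt_inv ℂ (hs z hz)).contDiffWithinAt
    exact this.congr fun z hz => hf z (hs z hz)
  have key2 : ∀ s : Set ℂ, ∀ f : ℂ → ℂ, (∀ z : ℂ, f z = z) → ContDiffOn ℂ ω f s := by
    intro s f hf
    obtain rfl : f = id := funext hf
    exact contDiffOn_id
  have hsrc : ∀ z : ℂ, sphereInv (z : OnePoint ℂ) ∈ range ((↑) : ℂ → OnePoint ℂ) → z ≠ 0 := by
    rintro z hz rfl
    rw [sphereInv_zero] at hz
    exact OnePoint.infty_notMem_range_coe hz
  rintro e e' (rfl | rfl) (rfl | rfl)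
  · refine key2 _ _ fun z => ?_
    simp [chartFin_symm_apply, chartFin_coe]
  · refine key _ ?_ _ ?_
    · intro z hz
      have h := hz.1
      simp only [mfld_simps, chartInf_source] at h
      exact hsrc z h.2
    · intro z hz
      simp [chartFin_symm_apply, chartInf_apply, sphereInv_coe hz, chartFin_coe]
  · refine key _ ?_ _ ?_
    · intro z hz
      have h := hz.1
      simp only [mfld_simps, chartFin_source] at h
      exact hsrc z h.2
    · intro z hz
      simp [chartInf_symm_apply, sphereInv_coe hz, chartFin_coe]
  · refine key2 _ _ fun z => ?_
    simp [chartInf_symm_apply, chartInf_apply, sphereInv_sphereInv, chartFin_coe]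


/-! ### Holomorphic sections, connections and filtrations -/

section Pullback

variable {B B' : Type*} {V : B → Type*} (f : B' → B) [∀ x, AddCommGroup (V x)]

instance (x : B') : AddCommGroup ((f *ᵖ V) x) :=
  inferInstanceAs (AddCommGroup (V (f x)))

instance [∀ x, TopologicalSpace (V x)] [∀ x, IsTopologicalAddGroup (V x)] (x : B') :
    IsTopologicalAddGroup ((f *ᵖ V) x) :=
  inferInstanceAs (IsTopologicalAddGroup (V (f x)))

instance [∀ x, Module ℂ (V x)] [∀ x, TopologicalSpace (V x)] [∀ x, ContinuousSMul ℂ (V x)]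
    (x : B') : ContinuousSMul ℂ ((f *ᵖ V) x) :=
  inferInstanceAs (ContinuousSMul ℂ (V (f x)))

end Pullback

section Generic

variable {EB HB : Type*} [NormedAddCommGroup EB] [NormedSpace ℂ EB] [TopologicalSpace HB]
  (I : ModelWithCorners ℂ EB HB) {B : Type*} [TopologicalSpace B] [ChartedSpace HB B]
  (F : Type*) [NormedAddCommGroup F] [NormedSpace ℂ F]
  {V : B → Type*} [TopologicalSpace (TotalSpace F V)]
  [∀ x, AddCommGroup (V x)] [∀ x, Module ℂ (V x)] [∀ x, TopologicalSpace (V x)]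
  [FiberBundle F V]

/-- The (not necessarily continuous) section `σ` is holomorphic on a neighbourhood of `x`. -/
def HolAt (σ : Π x, V x) (x : B) : Prop :=
  ContMDiffAt I (I.prod 𝓘(ℂ, F)) ω (fun y => TotalSpace.mk' F y (σ y)) x

/-- A holomorphic connection on the restriction of `V` to the open set `S`. It is an operator on
all set-theoretic sections, governed by the usual rules at the points where a section is
differentiable; the last field fixes the irrelevant values, so that two operators
which define the same connection are equal. -/
structure IsHolConnection [IsManifold I 1 B]
    [∀ x, IsTopologicalAddGroup (V x)] [∀ x, ContinuousSMul ℂ (V x)] (S : Set B)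
    (D : (Π x : B, V x) → Π x : B, TangentSpace I x →L[ℂ] V x) : Prop where
  covariant : IsCovariantDerivativeOn F D S
  holomorphic : ∀ (σ : Π x : B, V x) (X : Π x : B, TangentSpace I x), ∀ x ∈ S,
    HolAt I F σ x → HolAt I EB X x → HolAt I F (fun y => D σ y (X y)) x
  normalized : ∀ (σ : Π x : B, V x) (x : B),
    ¬ (x ∈ S ∧ MDifferentiableAt I (I.prod 𝓘(ℂ, F)) (fun y => TotalSpace.mk' F y (σ y)) x) →
      D σ x = 0

/-- Vanishing of the curvature over `S`. -/
def IsFlat [IsManifold I 1 B] (S : Set B)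
    (D : (Π x : B, V x) → Π x : B, TangentSpace I x →L[ℂ] V x) : Prop :=
  ∀ (σ : Π x : B, V x) (X Y : Π x : B, TangentSpace I x), ∀ x ∈ S,
    HolAt I F σ x → HolAt I EB X x → HolAt I EB Y x →
      D (fun y => D σ y (Y y)) x (X x) - D (fun y => D σ y (X y)) x (Y x)
        - D σ x (VectorField.mlieBracket I X Y x) = 0

/-- `W` is a holomorphic subbundle of `V`: locally it has a holomorphic frame. -/
def IsHolSubbundle (W : Π x : B, Submodule ℂ (V x)) : Prop :=
  ∀ x : B, ∃ (r : ℕ) (s : Fin r → Π y : B, V y), ∀ᶠ y in 𝓝 x,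
    (∀ i, HolAt I F (s i) y) ∧ LinearIndependent ℂ (fun i => s i y) ∧
      Submodule.span ℂ (range fun i => s i y) = W y

/-- An increasing, exhaustive and separated filtration of `V` by holomorphic subbundles. -/
structure IsSubbundleFiltration (W : ℤ → Π x : B, Submodule ℂ (V x)) : Prop where
  mono : ∀ k x, W (k - 1) x ≤ W k x
  exhaustive : ∀ x, ∃ k, W k x = ⊤
  separated : ∀ x, ∃ k, W k x = ⊥
  subbundle : ∀ k, IsHolSubbundle I F (W k)

/-- `s` is, near `x`, a holomorphic section of the subbundle `W`. -/
def HolSectionAt (W : Π x : B, Submodule ℂ (V x)) (s : Π x, V x) (x : B) : Prop :=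
  HolAt I F s x ∧ ∀ᶠ y in 𝓝 x, s y ∈ W y

/-- A Higgs field: an `End V`-valued holomorphic one-form `C` with `C ∧ C = 0`. -/
structure IsHiggsField [IsManifold I 1 B]
    (C : Π x : B, TangentSpace I x →ₗ[ℂ] V x →ₗ[ℂ] V x) : Prop where
  holomorphic : ∀ (s : Π x : B, V x) (X : Π x : B, TangentSpace I x) (x : B),
    HolAt I F s x → HolAt I EB X x → HolAt I F (fun y => C y (X y) (s y)) x
  comm : ∀ (x : B) (a b : TangentSpace I x) (v : V x), C x a (C x b v) = C x b (C x a v)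

/-- A Frobenius type structure `(∇ʳ, 𝒞, 𝒰, 𝒱)` on the holomorphic vector bundle `V`
(without pairing). -/
structure FrobeniusTypeStructure (V : B → Type*) [TopologicalSpace (TotalSpace F V)]
    [∀ x, AddCommGroup (V x)] [∀ x, Module ℂ (V x)] [∀ x, TopologicalSpace (V x)]
    [FiberBundle F V] [IsManifold I 1 B]
    [∀ x, IsTopologicalAddGroup (V x)] [∀ x, ContinuousSMul ℂ (V x)] where
  conn : (Π x : B, V x) → Π x : B, TangentSpace I x →L[ℂ] V x
  higgs : Π x : B, TangentSpace I x →ₗ[ℂ] V x →ₗ[ℂ] V x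
  endU : Π x : B, V x →ₗ[ℂ] V x
  endV : Π x : B, V x →ₗ[ℂ] V x
  isHolConnection : IsHolConnection I F univ conn
  isFlat : IsFlat I F univ conn
  isHiggsField : IsHiggsField I F higgs
  holomorphic_endU : ∀ (s : Π x : B, V x) (x : B), HolAt I F s x →
    HolAt I F (fun y => endU y (s y)) x
  holomorphic_endV : ∀ (s : Π x : B, V x) (x : B), HolAt I F s x →
    HolAt I F (fun y => endV y (s y)) x
  /-- `∇ʳ(𝒞) = 0`, where `∇ʳ(𝒞)` is the covariant exterior derivative of the one-form `𝒞` -/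
  conn_higgs : ∀ (s : Π x : B, V x) (X Y : Π x : B, TangentSpace I x) (x : B),
    HolAt I F s x → HolAt I EB X x → HolAt I EB Y x →
      (conn (fun y => higgs y (Y y) (s y)) x (X x) - higgs x (Y x) (conn s x (X x)))
        - (conn (fun y => higgs y (X y) (s y)) x (Y x) - higgs x (X x) (conn s x (Y x)))
        - higgs x (VectorField.mlieBracket I X Y x) (s x) = 0
  /-- `∇ʳ(𝒱) = 0` -/
  conn_endV : ∀ (s : Π x : B, V x) (x : B) (a : TangentSpace I x), HolAt I F s x →
    conn (fun y => endV y (s y)) x a - endV x (conn s x a) = 0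
  /-- `[𝒞, 𝒰] = 0` -/
  higgs_endU : ∀ (x : B) (a : TangentSpace I x) (v : V x),
    higgs x a (endU x v) - endU x (higgs x a v) = 0
  /-- `∇ʳ(𝒰) - [𝒞, 𝒱] + 𝒞 = 0` -/
  conn_endU : ∀ (s : Π x : B, V x) (x : B) (a : TangentSpace I x), HolAt I F s x →
    (conn (fun y => endU y (s y)) x a - endU x (conn s x a))
      - (higgs x a (endV x (s x)) - endV x (higgs x a (s x))) + higgs x a (s x) = 0

end Generic

section Graded

variable {B : Type*} {V : B → Type*} [∀ x, AddCommGroup (V x)] [∀ x, Module ℂ (V x)]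

/-- The fibre of `Gr_k = W_k / W_{k-1}` at `x`. -/
abbrev Gr (W : ℤ → Π x : B, Submodule ℂ (V x)) (k : ℤ) (x : B) : Type _ :=
  (W k x) ⧸ (W (k - 1) x).submoduleOf (W k x)

/-- The class of a vector `v ∈ W_k` in `Gr_k` (zero, if `v` is not in `W_k`). -/
def toGr (W : ℤ → Π x : B, Submodule ℂ (V x)) (k : ℤ) (x : B) (v : V x) : Gr W k x :=
  open Classical in if h : v ∈ W k x then Submodule.Quotient.mk ⟨v, h⟩ else 0

end Graded

/-! ### trTLE-structures on `ℙ¹ × M` -/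

/-- The model of `ℙ¹ × M` for a complex manifold `M` modelled on `E`. -/
abbrev modelP (E : Type*) [NormedAddCommGroup E] [NormedSpace ℂ E] :
    ModelWithCorners ℂ (ℂ × E) (ModelProd ℂ E) :=
  𝓘(ℂ, ℂ).prod 𝓘(ℂ, E)

/-- The coordinate `λ` on `ℙ¹ ∖ {∞}` (with the irrelevant value `0` at `∞`). -/
def lam (p : OnePoint ℂ) : ℂ := p.elim 0 id

/-- The complement `ℂ^* × M` of the polar divisor `{0, ∞} × M` in `ℙ¹ × M`. -/
def regularLocus (M : Type*) : Set (OnePoint ℂ × M) :=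
  {z | z.1 ≠ ((0 : ℂ) : OnePoint ℂ) ∧ z.1 ≠ OnePoint.infty}

/-- The involution `j(λ, t) = (-λ, t)`. -/
def jmap {M : Type*} (z : OnePoint ℂ × M) : OnePoint ℂ × M :=
  (OnePoint.map (fun μ : ℂ => -μ) z.1, z.2)

section TrTLE

variable {E : Type*} [NormedAddCommGroup E] [NormedSpace ℂ E]
  {M : Type*} [TopologicalSpace M] [ChartedSpace E M]

/-- The tangent vector `a ∂_λ + v` at a point `z = (λ, t)`, `λ ≠ ∞`, where `v` is a tangent vector
of `M` at `t`. -/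
def tangentVec (z : OnePoint ℂ × M) (a : ℂ) (v : TangentSpace 𝓘(ℂ, E) z.2) :
    TangentSpace (modelP E) z :=
  ((a, v) : ℂ × E)

/-- A family of vector spaces on `ℙ¹ × M` with a sheaf of holomorphic sections is
trivial along `ℙ¹`: over `ℙ¹ × U`, for small open `U` in `M`, it has a
frame of holomorphic sections. For a holomorphic vector bundle `ℋ`, this says that `p^* p_* ℋ → ℋ`
is an isomorphism. -/
def IsTrivialAlong {V : OnePoint ℂ × M → Type*} [∀ z, AddCommGroup (V z)]
    [∀ z, Module ℂ (V z)] (hol : (Π z, V z) → OnePoint ℂ × M → Prop) : Prop :=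
  ∀ x : M, ∃ (r : ℕ) (s : Fin r → Π z, V z), ∀ᶠ y in 𝓝 x, ∀ p : OnePoint ℂ,
    (∀ i, hol (s i) (p, y)) ∧ LinearIndependent ℂ (fun i => s i (p, y)) ∧
      Submodule.span ℂ (range fun i => s i (p, y)) = ⊤

variable (F : Type*) [NormedAddCommGroup F] [NormedSpace ℂ F]
  {H : OnePoint ℂ × M → Type*} [TopologicalSpace (TotalSpace F H)]
  [∀ z, AddCommGroup (H z)] [∀ z, Module ℂ (H z)] [∀ z, TopologicalSpace (H z)]
  [FiberBundle F H]

variable (E) in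
/-- A section `τ` of `H` over `ℂ^* × M` extends holomorphically to a neighbourhood of `z`. -/
def ExtendsAt (τ : Π z, H z) (z : OnePoint ℂ × M) : Prop :=
  ∃ τ' : Π z, H z, HolAt (modelP E) F τ' z ∧ ∀ᶠ w in 𝓝 z, w ∈ regularLocus M → τ w = τ' w

variable [IsManifold 𝓘(ℂ, E) ω M]
  [∀ z, IsTopologicalAddGroup (H z)] [∀ z, ContinuousSMul ℂ (H z)]

/-- `(H, D)` is a trTLE-structure on `M`. The meromorphic connection is given as a holomorphic
connection on `ℂ^* × M`; the pole conditions are tested on the local generators of the logarithmic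
vector fields, namely on lifts of holomorphic vector fields of `M` and on `λ ∂_λ`. -/
structure IsTrTLE (D : (Π z, H z) → Π z, TangentSpace (modelP E) z →L[ℂ] H z) : Prop where
  isTrivialAlong : IsTrivialAlong (HolAt (modelP E) F (V := H))
  isHolConnection : IsHolConnection (modelP E) F (regularLocus M) D
  isFlat : IsFlat (modelP E) F (regularLocus M) D
  pole_zero : ∀ (σ : Π z, H z) (X : Π x : M, TangentSpace 𝓘(ℂ, E) x) (x : M),
    HolAt (modelP E) F σ (((0 : ℂ) : OnePoint ℂ), x) → HolAt 𝓘(ℂ, E) E X x →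
      ExtendsAt E F (fun z : OnePoint ℂ × M => lam z.1 • D σ z (tangentVec z 0 (X z.2)))
        (((0 : ℂ) : OnePoint ℂ), x) ∧
      ExtendsAt E F (fun z : OnePoint ℂ × M => lam z.1 • D σ z (tangentVec z (lam z.1) 0))
        (((0 : ℂ) : OnePoint ℂ), x)
  pole_infty : ∀ (σ : Π z, H z) (X : Π x : M, TangentSpace 𝓘(ℂ, E) x) (x : M),
    HolAt (modelP E) F σ ((OnePoint.infty : OnePoint ℂ), x) → HolAt 𝓘(ℂ, E) E X x →
      ExtendsAt E F (fun z : OnePoint ℂ × M => D σ z (tangentVec z 0 (X z.2))) (OnePoint.infty, x) ∧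
      ExtendsAt E F (fun z : OnePoint ℂ × M => D σ z (tangentVec z (lam z.1) 0)) (OnePoint.infty, x)

/-- The embedding `M = {0} × M → ℙ¹ × M`. -/
def zeroEmb (E M : Type*) [NormedAddCommGroup E] [NormedSpace ℂ E] [TopologicalSpace M]
    [ChartedSpace E M] : C^ω⟮𝓘(ℂ, E), M; modelP E, OnePoint ℂ × M⟯ :=
  ⟨fun x => (((0 : ℂ) : OnePoint ℂ), x), contMDiff_const.prodMk contMDiff_id⟩

/-- The restriction `H|_{λ = 0}`, a vector bundle on `M`. -/
abbrev AtZero (E : Type*) {M : Type*} [NormedAddCommGroup E] [NormedSpace ℂ E]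
    [TopologicalSpace M] [ChartedSpace E M] (H : OnePoint ℂ × M → Type*) : M → Type _ :=
  zeroEmb E M *ᵖ H

/-- The restriction of a section to `λ = 0`. -/
def restrictZero (E : Type*) {M : Type*} [NormedAddCommGroup E] [NormedSpace ℂ E]
    [TopologicalSpace M] [ChartedSpace E M] {H : OnePoint ℂ × M → Type*} (σ : Π z, H z) :
    Π x, AtZero E H x :=
  fun x => σ (((0 : ℂ) : OnePoint ℂ), x)

/-- `σ` is a holomorphic section of `H` over `ℙ¹ × U` for a neighbourhood `U` of `x`, that is,
a section of `p_* H` near `x`. -/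
def HolAlongAt (E : Type*) {M : Type*} [NormedAddCommGroup E] [NormedSpace ℂ E]
    [TopologicalSpace M] [ChartedSpace E M] (F : Type*) [NormedAddCommGroup F] [NormedSpace ℂ F]
    {H : OnePoint ℂ × M → Type*} [TopologicalSpace (TotalSpace F H)]
    [∀ z, TopologicalSpace (H z)] [∀ z, AddCommGroup (H z)] [∀ z, Module ℂ (H z)]
    [FiberBundle F H] (σ : Π z, H z) (x : M) : Prop :=
  ∀ᶠ y in 𝓝 x, ∀ p : OnePoint ℂ, HolAt (modelP E) F σ (p, y)

/-- The natural map `p^*(H|_{λ = 0}) → H` at the point `z = (λ, t)`, for `H` trivial along `ℙ¹`: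
a vector `v` of the fibre at `(0, t)` is extended to a holomorphic section of `H` over `ℙ¹ × U`,
which is evaluated at `z`. -/
def constExt (E : Type*) {M : Type*} [NormedAddCommGroup E] [NormedSpace ℂ E]
    [TopologicalSpace M] [ChartedSpace E M] (F : Type*) [NormedAddCommGroup F] [NormedSpace ℂ F]
    {H : OnePoint ℂ × M → Type*} [TopologicalSpace (TotalSpace F H)]
    [∀ z, TopologicalSpace (H z)] [∀ z, AddCommGroup (H z)] [∀ z, Module ℂ (H z)]
    [FiberBundle F H] (z : OnePoint ℂ × M) (v : AtZero E H z.2) : H z :=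
  open Classical in
  if h : ∃ σ : Π z, H z, HolAlongAt E F σ z.2 ∧ restrictZero E σ z.2 = v then h.choose z else 0

/-- The Frobenius type structure `Φ` on `H|_{λ = 0}` is associated to the trTLE-structure `(H, D)`:
`D = p^*∇ʳ + λ⁻¹ p^*𝒞 + (λ⁻¹ p^*𝒰 - p^*𝒱) dλ/λ` under the natural isomorphism
`H ≃ p^*(H|_{λ = 0})`. It is enough to evaluate both sides on pulled back sections, that is on
the sections of `H` over `ℙ¹ × U`. -/
def IsAssociated [VectorBundle ℂ F H]
    (D : (Π z, H z) → Π z, TangentSpace (modelP E) z →L[ℂ] H z)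
    (Φ : FrobeniusTypeStructure 𝓘(ℂ, E) F (AtZero E H)) : Prop :=
  ∀ (σ : Π z, H z) (x : M), HolAlongAt E F σ x → ∀ μ : ℂ, μ ≠ 0 →
    (∀ v : TangentSpace 𝓘(ℂ, E) x,
      D σ ((μ : OnePoint ℂ), x) (tangentVec ((μ : OnePoint ℂ), x) 0 v) =
        constExt E F ((μ : OnePoint ℂ), x)
          (Φ.conn (restrictZero E σ) x v + μ⁻¹ • Φ.higgs x v (restrictZero E σ x))) ∧
    D σ ((μ : OnePoint ℂ), x) (tangentVec ((μ : OnePoint ℂ), x) μ 0) =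
      constExt E F ((μ : OnePoint ℂ), x)
        (μ⁻¹ • Φ.endU x (restrictZero E σ x) - Φ.endV x (restrictZero E σ x))

/-! ### Mixed trTLEP-structures -/

/-- The data of a mixed trTLEP-structure on the bundle `H`: the connection, the filtration and the
graded pairings. The line bundle `λ^{-k} 𝒪`, in which `P_k` takes its values, is generated by
`λ^{-k}` over all of `ℙ¹ × M`; `pairing k` is the coefficient of `P_k` with respect to
this generator. -/
structure MixedTrTLEPData (E : Type*) {M : Type*} [NormedAddCommGroup E] [NormedSpace ℂ E]
    [TopologicalSpace M] [ChartedSpace E M] (H : OnePoint ℂ × M → Type*)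
    [∀ z, AddCommGroup (H z)] [∀ z, Module ℂ (H z)] [∀ z, TopologicalSpace (H z)] where
  conn : (Π z, H z) → Π z, TangentSpace (modelP E) z →L[ℂ] H z
  W : ℤ → Π z, Submodule ℂ (H z)
  pairing : Π (k : ℤ) (z : OnePoint ℂ × M), Gr W k z →ₗ[ℂ] Gr W k (jmap z) →ₗ[ℂ] ℂ

/-- The pairing `P_k = λ^{-k} · pairing k` over `ℂ^* × M`. -/
def MixedTrTLEPData.P {H : OnePoint ℂ × M → Type*} [∀ z, AddCommGroup (H z)]
    [∀ z, Module ℂ (H z)] [∀ z, TopologicalSpace (H z)] (T : MixedTrTLEPData E H) (k : ℤ)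
    (z : OnePoint ℂ × M) (a : Gr T.W k z) (b : Gr T.W k (jmap z)) : ℂ :=
  lam z.1 ^ (-k) * T.pairing k z a b

/-- The axioms of a mixed trTLEP-structure. -/
structure IsMixedTrTLEP (T : MixedTrTLEPData E H) : Prop where
  isTrTLE : IsTrTLE F T.conn
  isFiltration : IsSubbundleFiltration (modelP E) F T.W
  /-- the subbundles `W_k` are `∇`-flat -/
  flat_W : ∀ (k : ℤ) (s : Π z, H z), ∀ z ∈ regularLocus M, HolSectionAt (modelP E) F (T.W k) s z →
    ∀ v : TangentSpace (modelP E) z, T.conn s z v ∈ T.W k z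
  /-- `Gr_k` is a trTLE-structure: it is trivial along `ℙ¹`. The holomorphic sections of
  the quotient `Gr_k` are those which locally lift to `W_k`. The connection induced on `Gr_k` is
  flat and has the required poles, as `∇` has and `W_k`, `W_{k-1}` are `∇`-flat. -/
  trivial_Gr : ∀ k : ℤ, IsTrivialAlong (V := Gr T.W k) fun τ z =>
    ∃ s : Π z, H z, HolSectionAt (modelP E) F (T.W k) s z ∧
      ∀ᶠ w in 𝓝 z, toGr T.W k w (s w) = τ w
  /-- `P_k` is a morphism `Gr_k ⊗ j^* Gr_k → λ^{-k} 𝒪` -/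
  pairing_holomorphic : ∀ (k : ℤ) (s t : Π z, H z) (z : OnePoint ℂ × M),
    HolSectionAt (modelP E) F (T.W k) s z → HolSectionAt (modelP E) F (T.W k) t (jmap z) →
      ContMDiffAt (modelP E) 𝓘(ℂ, ℂ) ω
        (fun w => T.pairing k w (toGr T.W k w (s w)) (toGr T.W k (jmap w) (t (jmap w)))) z
  pairing_nondegenerate : ∀ (k : ℤ) (z : OnePoint ℂ × M), (T.pairing k z).Nondegenerate
  /-- `P_k` is `(-1)^k`-symmetric -/
  P_symm : ∀ (k : ℤ) (s t : Π z, H z), ∀ z ∈ regularLocus M,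
    T.P k (jmap z) (toGr T.W k (jmap z) (t (jmap z)))
        (toGr T.W k (jmap (jmap z)) (s (jmap (jmap z)))) =
      (-1) ^ k * T.P k z (toGr T.W k z (s z)) (toGr T.W k (jmap z) (t (jmap z)))
  /-- `P_k` is `∇`-flat; note that `j` maps `a ∂_λ + v` to `-a ∂_λ + v` -/
  P_flat : ∀ (k : ℤ) (s t : Π z, H z), ∀ z ∈ regularLocus M,
    HolSectionAt (modelP E) F (T.W k) s z → HolSectionAt (modelP E) F (T.W k) t (jmap z) →
    ∀ (a : ℂ) (v : TangentSpace 𝓘(ℂ, E) z.2),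
      mvfderiv (modelP E)
          (fun w => T.P k w (toGr T.W k w (s w)) (toGr T.W k (jmap w) (t (jmap w)))) z
          (tangentVec z a v) =
        T.P k z (toGr T.W k z (T.conn s z (tangentVec z a v)))
            (toGr T.W k (jmap z) (t (jmap z))) +
          T.P k z (toGr T.W k z (s z))
            (toGr T.W k (jmap z) (T.conn t (jmap z) (tangentVec (jmap z) (-a) v)))

/-- `T` and `T'` are mixed trTLEP-structures on the bundles `H` and `H'`, and `φ : H → H'` is an
isomorphism of mixed trTLEP-structures: an isomorphism of
holomorphic vector bundles which is compatible with the connections and preserves the filtrations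
and the graded pairings. -/
structure IsMixedTrTLEPIso (F F' : Type*) [NormedAddCommGroup F] [NormedSpace ℂ F]
    [NormedAddCommGroup F'] [NormedSpace ℂ F']
    {H H' : OnePoint ℂ × M → Type*}
    [TopologicalSpace (TotalSpace F H)] [∀ z, AddCommGroup (H z)] [∀ z, Module ℂ (H z)]
    [∀ z, TopologicalSpace (H z)] [FiberBundle F H]
    [∀ z, IsTopologicalAddGroup (H z)] [∀ z, ContinuousSMul ℂ (H z)]
    [TopologicalSpace (TotalSpace F' H')] [∀ z, AddCommGroup (H' z)] [∀ z, Module ℂ (H' z)]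
    [∀ z, TopologicalSpace (H' z)] [FiberBundle F' H']
    [∀ z, IsTopologicalAddGroup (H' z)] [∀ z, ContinuousSMul ℂ (H' z)]
    (T : MixedTrTLEPData E H) (T' : MixedTrTLEPData E H') (φ : Π z, H z → H' z) : Prop where
  source : IsMixedTrTLEP F T
  target : IsMixedTrTLEP F' T'
  linear : ∀ z, IsLinearMap ℂ (φ z)
  bijective : ∀ z, Function.Bijective (φ z)
  holomorphic : ∀ (σ : Π z, H z) (z : OnePoint ℂ × M),
    HolAt (modelP E) F σ z ↔ HolAt (modelP E) F' (fun w => φ w (σ w)) z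
  conn : ∀ (σ : Π z, H z), ∀ z ∈ regularLocus M, HolAt (modelP E) F σ z →
    ∀ v : TangentSpace (modelP E) z, φ z (T.conn σ z v) = T'.conn (fun w => φ w (σ w)) z v
  mem_W : ∀ (k : ℤ) (z : OnePoint ℂ × M) (a : H z), a ∈ T.W k z ↔ φ z a ∈ T'.W k z
  pairing : ∀ (k : ℤ) (z : OnePoint ℂ × M), ∀ a ∈ T.W k z, ∀ b ∈ T.W k (jmap z),
    T.pairing k z (toGr T.W k z a) (toGr T.W k (jmap z) b) =
      T'.pairing k z (toGr T'.W k z (φ z a)) (toGr T'.W k (jmap z) (φ (jmap z) b))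

end TrTLE

/-! ### Mixed Frobenius structures -/

section MFS

variable (E : Type*) [NormedAddCommGroup E] [NormedSpace ℂ E]
  (M : Type*) [TopologicalSpace M] [ChartedSpace E M]

/-- The bundle `p^* Θ_M` on `ℙ¹ × M`. -/
abbrev PTangent [IsManifold 𝓘(ℂ, E) ω M] : OnePoint ℂ × M → Type _ :=
  (ContMDiffMap.snd : C^ω⟮modelP E, OnePoint ℂ × M; 𝓘(ℂ, E), M⟯) *ᵖ
    (TangentSpace 𝓘(ℂ, E) : M → Type _)

variable {E M} [IsManifold 𝓘(ℂ, E) ω M] [FiniteDimensional ℂ E]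

/-- The meromorphic connection
`p^*∇ + λ⁻¹ p^*θ - (λ⁻¹ p^*θ_E + p^*∇_• E) dλ/λ + c dλ/λ` on `p^* Θ_M` (here `eul` is the vector
field `E`): its value on a section `σ`, at `z = (λ, t)`, in the direction `a ∂_λ + v`. -/
def hatConn (c : ℂ)
    (conn : (Π x : M, TangentSpace 𝓘(ℂ, E) x) →
      Π x : M, TangentSpace 𝓘(ℂ, E) x →L[ℂ] TangentSpace 𝓘(ℂ, E) x)
    (θ : Π x : M, TangentSpace 𝓘(ℂ, E) x →ₗ[ℂ] TangentSpace 𝓘(ℂ, E) x →ₗ[ℂ]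
      TangentSpace 𝓘(ℂ, E) x)
    (eul : Π x : M, TangentSpace 𝓘(ℂ, E) x)
    (σ : Π z, PTangent E M z) (z : OnePoint ℂ × M) :
    TangentSpace (modelP E) z →L[ℂ] PTangent E M z :=
  open Classical in
  if z ∈ regularLocus M ∧ MDifferentiableAt (modelP E) ((modelP E).prod 𝓘(ℂ, E))
      (fun w => TotalSpace.mk' E w (σ w)) z then
    -- the derivative of the vector-valued function `μ ↦ σ (μ, t)` at `λ`
    let dσ : E := deriv (fun μ : ℂ => (σ ((μ : OnePoint ℂ), z.2) : E)) (lam z.1)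
    let along : E →ₗ[ℂ] E :=
      (conn (fun y => σ (z.1, y)) z.2).toLinearMap + (lam z.1)⁻¹ • (θ z.2).flip (σ z)
    let θE : E := θ z.2 (eul z.2) (σ z)
    let connE : E := conn eul z.2 (σ z)
    let s : E := σ z
    let transversal : E := dσ - (lam z.1)⁻¹ • ((lam z.1)⁻¹ • θE + connE) + (lam z.1)⁻¹ • c • s
    (LinearMap.toContinuousLinearMap
      (along ∘ₗ LinearMap.snd ℂ ℂ E + (LinearMap.fst ℂ ℂ E).smulRight transversal) :
        ℂ × E →L[ℂ] E)
  else 0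

variable (E M) in
/-- A Saito structure (without metric) `(θ, ∇, e, E)` on `M`. -/
structure SaitoStructure where
  conn : (Π x : M, TangentSpace 𝓘(ℂ, E) x) →
    Π x : M, TangentSpace 𝓘(ℂ, E) x →L[ℂ] TangentSpace 𝓘(ℂ, E) x
  θ : Π x : M, TangentSpace 𝓘(ℂ, E) x →ₗ[ℂ] TangentSpace 𝓘(ℂ, E) x →ₗ[ℂ] TangentSpace 𝓘(ℂ, E) x
  /-- the unit vector field `e` -/
  unit : Π x : M, TangentSpace 𝓘(ℂ, E) x
  /-- the Euler vector field `E` -/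
  euler : Π x : M, TangentSpace 𝓘(ℂ, E) x
  isHolConnection : IsHolConnection 𝓘(ℂ, E) E univ conn
  isFlat : IsFlat 𝓘(ℂ, E) E univ conn
  torsionFree : ∀ (X Y : Π x : M, TangentSpace 𝓘(ℂ, E) x) (x : M),
    HolAt 𝓘(ℂ, E) E X x → HolAt 𝓘(ℂ, E) E Y x →
      conn Y x (X x) - conn X x (Y x) = VectorField.mlieBracket 𝓘(ℂ, E) X Y x
  isHiggsField : IsHiggsField 𝓘(ℂ, E) E θ
  θ_symm : ∀ (x : M) (a b : TangentSpace 𝓘(ℂ, E) x), θ x a b = θ x b a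
  holomorphic_unit : ∀ x, HolAt 𝓘(ℂ, E) E unit x
  holomorphic_euler : ∀ x, HolAt 𝓘(ℂ, E) E euler x
  conn_unit : ∀ x, conn unit x = 0
  θ_unit : ∀ (x : M) (a : TangentSpace 𝓘(ℂ, E) x), θ x (unit x) a = -a
  isFlat_hat : IsFlat (modelP E) E (regularLocus M) (hatConn 0 conn θ euler)

variable (E M) in
/-- A mixed Frobenius structure of charge `d` on `M`: a Saito structure with a filtration `ℐ` of
`Θ_M` and metrics `g_k` on its graded pieces. -/
structure MixedFrobeniusStructure (d : ℂ) extends SaitoStructure E M where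
  filt : ℤ → Π x : M, Submodule ℂ (TangentSpace 𝓘(ℂ, E) x)
  g : Π (k : ℤ) (x : M), Gr filt k x →ₗ[ℂ] Gr filt k x →ₗ[ℂ] ℂ
  isFiltration : IsSubbundleFiltration 𝓘(ℂ, E) E filt
  θ_invariant : ∀ (k : ℤ) (x : M) (a : TangentSpace 𝓘(ℂ, E) x), ∀ b ∈ filt k x,
    θ x a b ∈ filt k x
  flat_filt : ∀ (k : ℤ) (s : Π x : M, TangentSpace 𝓘(ℂ, E) x) (x : M),
    HolSectionAt 𝓘(ℂ, E) E (filt k) s x → ∀ a : TangentSpace 𝓘(ℂ, E) x, conn s x a ∈ filt k x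
  euler_closed : ∀ (k : ℤ) (s : Π x : M, TangentSpace 𝓘(ℂ, E) x) (x : M),
    HolSectionAt 𝓘(ℂ, E) E (filt k) s x →
      VectorField.mlieBracket 𝓘(ℂ, E) euler s x ∈ filt k x
  g_holomorphic : ∀ (k : ℤ) (s t : Π x : M, TangentSpace 𝓘(ℂ, E) x) (x : M),
    HolSectionAt 𝓘(ℂ, E) E (filt k) s x → HolSectionAt 𝓘(ℂ, E) E (filt k) t x →
      ContMDiffAt 𝓘(ℂ, E) 𝓘(ℂ, ℂ) ω
        (fun y => g k y (toGr filt k y (s y)) (toGr filt k y (t y))) x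
  g_symm : ∀ (k : ℤ) (x : M) (a b : Gr filt k x), g k x a b = g k x b a
  g_nondegenerate : ∀ (k : ℤ) (x : M), (g k x).Nondegenerate
  /-- `g_k` is `∇`-flat -/
  g_flat : ∀ (k : ℤ) (s t : Π x : M, TangentSpace 𝓘(ℂ, E) x) (x : M),
    HolSectionAt 𝓘(ℂ, E) E (filt k) s x → HolSectionAt 𝓘(ℂ, E) E (filt k) t x →
      ∀ a : TangentSpace 𝓘(ℂ, E) x,
        mvfderiv 𝓘(ℂ, E) (fun y => g k y (toGr filt k y (s y)) (toGr filt k y (t y))) x a =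
          g k x (toGr filt k x (conn s x a)) (toGr filt k x (t x)) +
            g k x (toGr filt k x (s x)) (toGr filt k x (conn t x a))
  g_θ : ∀ (k : ℤ) (x : M) (a : TangentSpace 𝓘(ℂ, E) x), ∀ b ∈ filt k x, ∀ c ∈ filt k x,
    g k x (toGr filt k x (θ x a b)) (toGr filt k x c) =
      g k x (toGr filt k x b) (toGr filt k x (θ x a c))
  /-- `Lie_E(g_k) = (2 - d + k) g_k` -/
  lie_g : ∀ (k : ℤ) (s t : Π x : M, TangentSpace 𝓘(ℂ, E) x) (x : M),
    HolSectionAt 𝓘(ℂ, E) E (filt k) s x → HolSectionAt 𝓘(ℂ, E) E (filt k) t x →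
      mvfderiv 𝓘(ℂ, E) (fun y => g k y (toGr filt k y (s y)) (toGr filt k y (t y))) x (euler x)
          - g k x (toGr filt k x (VectorField.mlieBracket 𝓘(ℂ, E) euler s x))
              (toGr filt k x (t x))
          - g k x (toGr filt k x (s x))
              (toGr filt k x (VectorField.mlieBracket 𝓘(ℂ, E) euler t x)) =
        (2 - d + k) * g k x (toGr filt k x (s x)) (toGr filt k x (t x))

/-- The mixed trTLEP-structure `𝒯(ℱ)` on `p^* Θ_M` induced by a mixed Frobenius structure `ℱ` of
charge `d`: the connection `∇̂ + ((2 - d) / 2) dλ/λ`, the filtration `p^* ℐ` and the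
pairings `λ^{-k} p^* g_k`. -/
def MixedFrobeniusStructure.toTrTLEP {d : ℂ} (𝓕 : MixedFrobeniusStructure E M d) :
    MixedTrTLEPData E (PTangent E M) where
  conn := hatConn ((2 - d) / 2) 𝓕.conn 𝓕.θ 𝓕.euler
  W k z := 𝓕.filt k z.2
  pairing k z := 𝓕.g k z.2

/-- The morphism `-p^*(𝒞_• ζ) : p^* Θ_M → p^*(H|_{λ = 0}) ≃ H`. -/
def periodMap {F : Type*} [NormedAddCommGroup F] [NormedSpace ℂ F]
    {H : OnePoint ℂ × M → Type*} [TopologicalSpace (TotalSpace F H)]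
    [∀ z, AddCommGroup (H z)] [∀ z, Module ℂ (H z)] [∀ z, TopologicalSpace (H z)]
    [FiberBundle F H] [VectorBundle ℂ F H]
    [∀ z, IsTopologicalAddGroup (H z)] [∀ z, ContinuousSMul ℂ (H z)]
    (Φ : FrobeniusTypeStructure 𝓘(ℂ, E) F (AtZero E H)) (ζ : Π x, AtZero E H x)
    (z : OnePoint ℂ × M) (a : PTangent E M z) : H z :=
  constExt E F z (-(Φ.higgs z.2 a (ζ z.2)))

end MFS
end
end MixedFrobenius

/-! Triviality along `ℙ¹` gives frames over `ℙ¹ × U`, and by Liouville the coefficients of a section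
over `ℙ¹ × U` are functions on `U` alone. The covariant derivative of such a section along a field
of `M`, or along `λ ∂_λ`, has at most a simple pole at `0` and none at `∞`, hence is of the form `a
+ λ⁻¹ b` (`exists_eq_add_inv_smul`). The coefficients `a`, `b` are `∇ʳ`, `𝒞` in the first case and
`-𝒱`, `𝒰` in the second; they are unique because the values at `λ = ±1` determine them. Flatness is
then the vanishing of a quadratic polynomial in `λ⁻¹`, and its coefficients are exactly the
equations of a Frobenius type structure (`flat_tangential`, `flat_transversal`).

Filtration and pairings are constant along `ℙ¹` as well. For `W` this is a descending induction: a
constant section of `W_k` has constant coefficients in a frame of the trivial bundle `Gr_k`, so it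
lies in `W_{k-1}` everywhere on `ℙ¹` or nowhere (`IsMixedTrTLEP.constEquiv_mem_iff`). The
coefficient of `P_k` is a holomorphic function on the sphere. Flatness of `λ^{-k} g_k`, where `j`
turns `λ` into `-λ` in the second argument, says that `g_k` is `∇ʳ`-flat, `𝒞` is self-adjoint and `𝒱
+ 𝒱^* = k` (`IsAssociated.metricZero_identities`).

Everything is moved to `Θ_M` by `ψ = -𝒞_• ζ`, with `e = ψ⁻¹ ζ` and `E = ψ⁻¹ 𝒰 ζ`. Evaluated on the
flat section `ζ`, the equation `∇ʳ(𝒞) = 0` is torsion-freeness, `𝒞 ∧ 𝒞 = 0` is symmetry of `θ`, `[𝒞,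
𝒰] = 0` gives `θ_E = -𝒰`, and the last equation with `𝒱 ζ = (d/2) ζ` gives `∇_• E = (1 - d/2) + 𝒱`.
Therefore `-(λ⁻¹ θ_E + ∇_• E) + (2 - d)/2 = λ⁻¹ 𝒰 - 𝒱`, and the period map identifies the twisted
connection on `p^* Θ_M` with `∇` (`hatConn_eq_pullConn`). Flatness of `∇̂` itself follows on
multiplying by a local branch of `λ^{(2 - d)/2}`. As `g` is flat and the connection torsion free,
`Lie_E g` is `g(∇_• E, ·) + g(·, ∇_• E) = (2 - d + k) g`.

For uniqueness, the isomorphism prescribes the connection on pulled-back fields, whose coefficients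
in `λ⁻¹` are `∇` and `θ`; (IdC) fixes `e`; then `E = -θ_E e` is read off from the derivative of `e`
along `λ ∂_λ`, and the filtration and the metrics are read off at one value of `λ`. -/

namespace MixedFrobenius
noncomputable section

set_option linter.unusedSectionVars false

/-! ### Holomorphic frames, coefficients, and covariant derivatives on a vector bundle -/

section BundleTools

variable {EB HB : Type*} [NormedAddCommGroup EB] [NormedSpace ℂ EB] [TopologicalSpace HB]
  {I : ModelWithCorners ℂ EB HB} {B : Type*} [TopologicalSpace B] [ChartedSpace HB B]
  {F : Type*} [NormedAddCommGroup F] [NormedSpace ℂ F]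
  {V : B → Type*} [TopologicalSpace (TotalSpace F V)]
  [∀ x, AddCommGroup (V x)] [∀ x, Module ℂ (V x)] [∀ x, TopologicalSpace (V x)]
  [FiberBundle F V]

/-- The section `σ` is complex differentiable at `x`. -/
abbrev DiffAt (I : ModelWithCorners ℂ EB HB) (F : Type*) [NormedAddCommGroup F] [NormedSpace ℂ F]
    {V : B → Type*} [TopologicalSpace (TotalSpace F V)] [∀ x, TopologicalSpace (V x)]
    [FiberBundle F V] (σ : Π x, V x) (x : B) : Prop :=
  MDifferentiableAt I (I.prod 𝓘(ℂ, F)) (fun y => TotalSpace.mk' F y (σ y)) x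

theorem HolAt.diffAt {σ : Π x, V x} {x : B} (h : HolAt I F σ x) : DiffAt I F σ x :=
  ContMDiffAt.mdifferentiableAt h (by simp)

theorem HolAt.congr {σ τ : Π x, V x} {x : B} (h : HolAt I F σ x) (e : ∀ᶠ y in 𝓝 x, σ y = τ y) :
    HolAt I F τ x :=
  ContMDiffAt.congr_of_eventuallyEq h (e.mono fun y hy => by simp [hy])

theorem DiffAt.congr {σ τ : Π x, V x} {x : B} (h : DiffAt I F σ x) (e : ∀ᶠ y in 𝓝 x, σ y = τ y) :
    DiffAt I F τ x :=
  MDifferentiableAt.congr_of_eventuallyEq h (e.mono fun y hy => by simp [hy])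

theorem HolAt.eventually [IsManifold I ω B] [VectorBundle ℂ F V] [ContMDiffVectorBundle ω F V I]
    {σ : Π x, V x} {x : B} (h : HolAt I F σ x) :
    ∀ᶠ y in 𝓝 x, HolAt I F σ y :=
  (contMDiffAt_iff_contMDiffAt_nhds (by simp)).1 h

theorem HolAt.add [VectorBundle ℂ F V] {σ τ : Π x, V x} {x : B}
    (h : HolAt I F σ x) (h' : HolAt I F τ x) :
    HolAt I F (fun y => σ y + τ y) x :=
  ContMDiffAt.add_section h h'

theorem HolAt.sub [VectorBundle ℂ F V] {σ τ : Π x, V x} {x : B}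
    (h : HolAt I F σ x) (h' : HolAt I F τ x) :
    HolAt I F (fun y => σ y - τ y) x :=
  ContMDiffAt.sub_section h h'

theorem HolAt.neg [VectorBundle ℂ F V] {σ : Π x, V x} {x : B} (h : HolAt I F σ x) :
    HolAt I F (fun y => -σ y) x :=
  ContMDiffAt.neg_section h

theorem HolAt.smul [VectorBundle ℂ F V] {f : B → ℂ} {σ : Π x, V x} {x : B}
    (hf : ContMDiffAt I 𝓘(ℂ, ℂ) ω f x) (h : HolAt I F σ x) :
    HolAt I F (fun y => f y • σ y) x :=
  ContMDiffAt.smul_section hf h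

theorem HolAt.const_smul [VectorBundle ℂ F V] (c : ℂ) {σ : Π x, V x} {x : B} (h : HolAt I F σ x) :
    HolAt I F (fun y => c • σ y) x :=
  ContMDiffAt.const_smul_section h

theorem HolAt.sum [VectorBundle ℂ F V] {ι : Type*} {s : Finset ι} {σ : ι → Π x, V x} {x : B}
    (h : ∀ i, HolAt I F (σ i) x) :
    HolAt I F (fun y => ∑ i ∈ s, σ i y) x :=
  ContMDiffAt.sum_section fun i _ => h i

theorem holAt_iff {σ : Π x, V x} {x : B} : HolAt I F σ x ↔
    ContMDiffAt I 𝓘(ℂ, F) ω (fun y => (trivializationAt F V x ⟨y, σ y⟩).2) x :=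
  contMDiffAt_section x

theorem diffAt_iff {σ : Π x, V x} {x : B} : DiffAt I F σ x ↔
    MDifferentiableAt I 𝓘(ℂ, F) (fun y => (trivializationAt F V x ⟨y, σ y⟩).2) x :=
  mdifferentiableAt_section ..

theorem holAt_extend [VectorBundle ℂ F V] [ContMDiffVectorBundle ω F V I] {x : B} (v : V x) :
    HolAt I F (FiberBundle.extend F v) x :=
  FiberBundle.contMDiffAt_extend (k := ω) ..

/-- Linearly independent holomorphic sections have holomorphic coefficient functionals. -/
theorem exists_dual [VectorBundle ℂ F V] [FiniteDimensional ℂ F] {ι : Type*} [Finite ι]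
    {s : ι → Π y, V y} {x : B} (hs : ∀ i, HolAt I F (s i) x)
    (hli : LinearIndependent ℂ fun i => s i x) :
    ∃ γ : ι → Π y, V y →ₗ[ℂ] ℂ,
      (∀ᶠ y in 𝓝 x, ∀ (c : ι → ℂ) (t : Finset ι), (∀ j, j ∉ t → c j = 0) →
        ∀ i, γ i y (∑ j ∈ t, c j • s j y) = c i) ∧
      (∀ σ, HolAt I F σ x → ∀ i, ContMDiffAt I 𝓘(ℂ, ℂ) ω (fun y => γ i y (σ y)) x) ∧
      (∀ σ, DiffAt I F σ x → ∀ i, MDifferentiableAt I 𝓘(ℂ, ℂ) (fun y => γ i y (σ y)) x) := by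
  classical
  have := Fintype.ofFinite ι
  set e := trivializationAt F V x with he
  have hx : x ∈ e.baseSet := mem_baseSet_trivializationAt F V x
  have hbase : ∀ᶠ y in 𝓝 x, y ∈ e.baseSet := e.open_baseSet.mem_nhds hx
  obtain ⟨ev, hval⟩ : ∃ ev : Π y, V y →ₗ[ℂ] F, ∀ y ∈ e.baseSet, ∀ v, ev y v = (e ⟨y, v⟩).2 :=
    ⟨fun y => e.linearMapAt ℂ y, fun y hy v => by rw [Trivialization.coe_linearMapAt_of_mem _ hy]⟩
  have hli' : LinearIndependent ℂ fun i => ev x (s i x) := by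
    refine hli.map' (ev x) (LinearMap.ker_eq_bot.2 ?_)
    intro v w hvw
    exact (e.continuousLinearEquivAt ℂ x hx).injective (by simpa [hval x hx] using hvw)
  -- `L` is a left inverse of the sections at `x` in the trivialisation. At nearby `y` it maps them
  -- to the columns of a matrix `A y` with `A x = 1`, so the functionals sought are the components
  -- of `(A y)⁻¹ L`; inversion is analytic at the unit.
  obtain ⟨L₀, hL₀⟩ := LinearMap.exists_leftInverse_of_injective
    (Fintype.linearCombination ℂ fun i => ev x (s i x))
    (LinearMap.ker_eq_bot.2 hli'.fintypeLinearCombination_injective)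
  let L : F →L[ℂ] (ι → ℂ) := LinearMap.toContinuousLinearMap L₀
  have hL : ∀ i, L (ev x (s i x)) = Pi.single i 1 := by
    intro i
    have := LinearMap.congr_fun hL₀ (Pi.single i 1)
    simpa [L, Fintype.linearCombination_apply_single] using this
  let A : B → (ι → ℂ) →L[ℂ] (ι → ℂ) := fun y =>
    ∑ i, (ContinuousLinearMap.proj (R := ℂ) (φ := fun _ : ι => ℂ) i).smulRight
      (L (e ⟨y, s i y⟩).2)
  have hA : ContMDiffAt I 𝓘(ℂ, (ι → ℂ) →L[ℂ] (ι → ℂ)) ω A x := by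
    refine contMDiffAt_finsetSum fun i _ => ?_
    have h1 : ContMDiffAt I 𝓘(ℂ, ι → ℂ) ω (fun y => L (e ⟨y, s i y⟩).2) x :=
      L.contMDiff.contMDiffAt.comp x (holAt_iff.1 (hs i))
    exact (ContinuousLinearMap.smulRightL ℂ (ι → ℂ) (ι → ℂ)
      (ContinuousLinearMap.proj i)).contMDiff.contMDiffAt.comp x h1
  have hAx : A x = 1 := by
    ext c j
    simp only [A, ← hval x hx, hL]
    simp [Pi.single_apply]
  have hinv : ContMDiffAt I 𝓘(ℂ, (ι → ℂ) →L[ℂ] (ι → ℂ)) ω (fun y => Ring.inverse (A y)) x := by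
    have h := contDiffAt_ringInverse ℂ (n := ω) (1 : ((ι → ℂ) →L[ℂ] (ι → ℂ))ˣ)
    rw [Units.val_one, ← hAx] at h
    exact h.contMDiffAt.comp x hA
  have hunit : ∀ᶠ y in 𝓝 x, IsUnit (A y) :=
    hA.continuousAt.eventually (by
      rw [hAx]; exact Units.isOpen.mem_nhds isUnit_one)
  refine ⟨fun i y => LinearMap.proj i ∘ₗ (Ring.inverse (A y)).toLinearMap ∘ₗ L.toLinearMap ∘ₗ
    (ev y), ?_, ?_, ?_⟩
  · filter_upwards [hunit, hbase] with y hy hyb c t hc i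
    have h1 : L (ev y (∑ j ∈ t, c j • s j y)) = A y c := by
      rw [Finset.sum_subset (Finset.subset_univ t) fun j _ hj => by simp [hc j hj]]
      simp [A, map_sum, ← hval y hyb]
    simp only [LinearMap.comp_apply, ContinuousLinearMap.coe_coe, h1, LinearMap.proj_apply]
    rw [← mul_apply_eq_comp, Ring.inverse_mul_cancel _ hy]
    rfl
  · intro σ hσ i
    have h1 : ContMDiffAt I 𝓘(ℂ, ι → ℂ) ω (fun y => L (e ⟨y, σ y⟩).2) x :=
      L.contMDiff.contMDiffAt.comp x (holAt_iff.1 hσ)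
    refine ((ContinuousLinearMap.proj (R := ℂ) (φ := fun _ : ι => ℂ) i).contMDiff.contMDiffAt.comp x
      (hinv.clm_apply h1)).congr_of_eventuallyEq ?_
    filter_upwards [hbase] with y hy
    simp [hval y hy]
  · intro σ hσ i
    have h1 : MDifferentiableAt I 𝓘(ℂ, ι → ℂ) (fun y => L (e ⟨y, σ y⟩).2) x :=
      L.contMDiff.contMDiffAt.mdifferentiableAt (n := 1) one_ne_zero |>.comp x (diffAt_iff.1 hσ)
    refine ((ContinuousLinearMap.proj (R := ℂ) (φ := fun _ : ι => ℂ)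
      i).contMDiff.contMDiffAt.mdifferentiableAt (n := 1) one_ne_zero |>.comp x
      ((hinv.mdifferentiableAt (by simp)).clm_apply h1)).congr_of_eventuallyEq ?_
    filter_upwards [hbase] with y hy
    simp [hval y hy]

/-- Near `x` the coefficients are the values of the dual functionals of `exists_dual`. No spanning
is assumed, so this also applies to the image of a frame under an injective morphism. -/
theorem coeff_contMDiffAt [VectorBundle ℂ F V] [FiniteDimensional ℂ F] {ι : Type*} [Fintype ι]
    {s : ι → Π y, V y} {x : B} (hs : ∀ i, HolAt I F (s i) x)
    (hli : LinearIndependent ℂ fun i => s i x) {σ : Π y, V y} (hσ : HolAt I F σ x)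
    {c : ι → B → ℂ} (hc : ∀ᶠ y in 𝓝 x, σ y = ∑ i, c i y • s i y) (i : ι) :
    ContMDiffAt I 𝓘(ℂ, ℂ) ω (c i) x := by
  obtain ⟨γ, h1, h2, -⟩ := exists_dual hs hli
  refine (h2 σ hσ i).congr_of_eventuallyEq ?_
  filter_upwards [hc, h1] with y hy h
  rw [hy, h (fun i => c i y) Finset.univ (by simp)]

theorem coeff_mdifferentiableAt [VectorBundle ℂ F V] [FiniteDimensional ℂ F] {ι : Type*}
    [Fintype ι] {s : ι → Π y, V y} {x : B} (hs : ∀ i, HolAt I F (s i) x)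
    (hli : LinearIndependent ℂ fun i => s i x) {σ : Π y, V y} (hσ : DiffAt I F σ x)
    {c : ι → B → ℂ} (hc : ∀ᶠ y in 𝓝 x, σ y = ∑ i, c i y • s i y) (i : ι) :
    MDifferentiableAt I 𝓘(ℂ, ℂ) (c i) x := by
  obtain ⟨γ, h1, -, h2⟩ := exists_dual hs hli
  refine (h2 σ hσ i).congr_of_eventuallyEq ?_
  filter_upwards [hc, h1] with y hy h
  rw [hy, h (fun i => c i y) Finset.univ (by simp)]

/-- `s` is a holomorphic frame of `V` near `x`. -/
def IsFrameAt (I : ModelWithCorners ℂ EB HB) (F : Type*) [NormedAddCommGroup F] [NormedSpace ℂ F]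
    {V : B → Type*} [TopologicalSpace (TotalSpace F V)] [∀ x, AddCommGroup (V x)]
    [∀ x, Module ℂ (V x)] [∀ x, TopologicalSpace (V x)] [FiberBundle F V] {ι : Type*}
    (s : ι → Π y, V y) (x : B) : Prop :=
  ∀ᶠ y in 𝓝 x, (∀ i, HolAt I F (s i) y) ∧ LinearIndependent ℂ (fun i => s i y) ∧
    Submodule.span ℂ (range fun i => s i y) = ⊤

theorem exists_isFrameAt (I : ModelWithCorners ℂ EB HB) [VectorBundle ℂ F V]
    [FiniteDimensional ℂ F] [ContMDiffVectorBundle ω F V I] (x : B) :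
    ∃ (r : ℕ) (s : Fin r → Π y, V y), IsFrameAt I F s x := by
  let b := Module.finBasis ℂ F
  let e := trivializationAt F V x
  refine ⟨_, e.localFrame b, ?_⟩
  have h := e.isLocalFrameOn_localFrame_baseSet I ω b
  filter_upwards [e.open_baseSet.mem_nhds (mem_baseSet_trivializationAt F V x)] with y hy
  exact ⟨fun i => h.contMDiffAt e.open_baseSet hy i, h.linearIndependent hy,
    top_le_iff.1 (h.generating hy)⟩

/-- The coefficients are chosen point by point; their regularity comes afterwards from linear
independence, in `IsFrameAt.holAt_coeff` and `IsFrameAt.diffAt_coeff`. -/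
theorem IsFrameAt.exists_coeff {ι : Type*} [Fintype ι] {s : ι → Π y, V y} {x : B}
    (hs : IsFrameAt I F s x) (σ : Π y, V y) :
    ∃ c : ι → B → ℂ, ∀ᶠ y in 𝓝 x, σ y = ∑ i, c i y • s i y := by
  have : ∀ y, ∃ c : ι → ℂ, (σ y ∈ Submodule.span ℂ (range fun i => s i y) →
      σ y = ∑ i, c i • s i y) := by
    intro y
    by_cases h : σ y ∈ Submodule.span ℂ (range fun i => s i y)
    · obtain ⟨c, hc⟩ := (Submodule.mem_span_range_iff_exists_fun ℂ).1 h
      exact ⟨c, fun _ => hc.symm⟩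
    · exact ⟨0, fun h' => absurd h' h⟩
  choose c hc using this
  refine ⟨fun i y => c y i, ?_⟩
  filter_upwards [hs] with y hy
  exact hc y (by rw [hy.2.2]; trivial)

theorem IsFrameAt.holAt_coeff [VectorBundle ℂ F V] [FiniteDimensional ℂ F] {ι : Type*} [Fintype ι]
    {s : ι → Π y, V y} {x : B}
    (hs : IsFrameAt I F s x) {σ : Π y, V y} (hσ : HolAt I F σ x) {c : ι → B → ℂ}
    (hc : ∀ᶠ y in 𝓝 x, σ y = ∑ i, c i y • s i y) (i : ι) :
    ContMDiffAt I 𝓘(ℂ, ℂ) ω (c i) x :=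
  coeff_contMDiffAt hs.self_of_nhds.1 hs.self_of_nhds.2.1 hσ hc i

theorem IsFrameAt.diffAt_coeff [VectorBundle ℂ F V] [FiniteDimensional ℂ F] {ι : Type*} [Fintype ι]
    {s : ι → Π y, V y} {x : B}
    (hs : IsFrameAt I F s x) {σ : Π y, V y} (hσ : DiffAt I F σ x) {c : ι → B → ℂ}
    (hc : ∀ᶠ y in 𝓝 x, σ y = ∑ i, c i y • s i y) (i : ι) :
    MDifferentiableAt I 𝓘(ℂ, ℂ) (c i) x :=
  coeff_mdifferentiableAt hs.self_of_nhds.1 hs.self_of_nhds.2.1 hσ hc i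

theorem DiffAt.sum_smul [VectorBundle ℂ F V] {ι : Type*} {t : Finset ι} {σ : ι → Π x, V x} {x : B}
    {c : ι → B → ℂ} (hc : ∀ i, MDifferentiableAt I 𝓘(ℂ, ℂ) (c i) x) (h : ∀ i, DiffAt I F (σ i) x) :
    DiffAt I F (fun y => ∑ i ∈ t, c i y • σ i y) x :=
  MDifferentiableAt.sum_section (t := fun i y => c i y • σ i y)
    fun i _ => (hc i).smul_section (h i)

theorem HolAt.sum_smul [VectorBundle ℂ F V] {ι : Type*} {t : Finset ι} {σ : ι → Π x, V x} {x : B}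
    {c : ι → B → ℂ} (hc : ∀ i, ContMDiffAt I 𝓘(ℂ, ℂ) ω (c i) x) (h : ∀ i, HolAt I F (σ i) x) :
    HolAt I F (fun y => ∑ i ∈ t, c i y • σ i y) x :=
  HolAt.sum fun i => (h i).smul (hc i)

section Covariant

variable [∀ x, IsTopologicalAddGroup (V x)] [∀ x, ContinuousSMul ℂ (V x)]

theorem cov_sum_smul [VectorBundle ℂ F V]
    {S : Set B} {D : (Π x : B, V x) → Π x : B, TangentSpace I x →L[ℂ] V x}
    (hD : IsCovariantDerivativeOn F D S) {x : B} (hx : x ∈ S) {ι : Type*} (t : Finset ι)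
    {σ : ι → Π x, V x} {c : ι → B → ℂ} (hc : ∀ i, MDifferentiableAt I 𝓘(ℂ, ℂ) (c i) x)
    (h : ∀ i, DiffAt I F (σ i) x) :
    D (fun y => ∑ i ∈ t, c i y • σ i y) x =
      ∑ i ∈ t, (c i x • D (σ i) x + (mvfderiv I (c i) x).smulRight (σ i x)) := by
  classical
  induction t using Finset.induction_on with
  | empty =>
    simpa [Pi.zero_def] using hD.zero hx
  | insert i t hi ih =>
    have h1 : (fun y => ∑ i ∈ insert i t, c i y • σ i y) =
        (c i • σ i) + fun y => ∑ i ∈ t, c i y • σ i y := by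
      funext y
      simp [Finset.sum_insert hi]
    rw [h1, hD.add ((hc i).smul_section (h i)) (DiffAt.sum_smul hc h) hx,
      hD.leibniz (h i) (hc i) hx, ih, Finset.sum_insert hi]

/-- Two covariant derivatives which agree on a holomorphic frame agree. -/
theorem cov_eq_of_frame [VectorBundle ℂ F V] [FiniteDimensional ℂ F]
    {S : Set B} {D D' : (Π x : B, V x) → Π x : B, TangentSpace I x →L[ℂ] V x}
    (hD : IsCovariantDerivativeOn F D S) (hD' : IsCovariantDerivativeOn F D' S) {x : B}
    (hS : S ∈ 𝓝 x) {ι : Type*} [Fintype ι] {s : ι → Π y, V y} (hs : IsFrameAt I F s x)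
    (h : ∀ i, D (s i) x = D' (s i) x) {σ : Π y, V y} (hσ : DiffAt I F σ x) :
    D σ x = D' σ x := by
  obtain ⟨c, hc⟩ := hs.exists_coeff σ
  have hcd := hs.diffAt_coeff hσ hc
  have hsd := fun i => (hs.self_of_nhds.1 i).diffAt
  have hx := mem_of_mem_nhds hS
  rw [hD.congr_of_eventuallyEq hσ (DiffAt.sum_smul (t := Finset.univ) hcd hsd) hS hc,
    hD'.congr_of_eventuallyEq hσ (DiffAt.sum_smul (t := Finset.univ) hcd hsd) hS hc,
    cov_sum_smul hD hx _ hcd hsd, cov_sum_smul hD' hx _ hcd hsd]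
  simp [h]

theorem cov_eq_of_hol [VectorBundle ℂ F V] [FiniteDimensional ℂ F] [ContMDiffVectorBundle ω F V I]
    {S : Set B} {D D' : (Π x : B, V x) → Π x : B, TangentSpace I x →L[ℂ] V x}
    (hD : IsCovariantDerivativeOn F D S) (hD' : IsCovariantDerivativeOn F D' S) {x : B}
    (hS : S ∈ 𝓝 x) (h : ∀ σ, HolAt I F σ x → D σ x = D' σ x) {σ : Π y, V y}
    (hσ : DiffAt I F σ x) : D σ x = D' σ x := by
  obtain ⟨r, s, hs⟩ := exists_isFrameAt (F := F) (V := V) I x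
  exact cov_eq_of_frame hD hD' hS hs (fun i => h _ (hs.self_of_nhds.1 i)) hσ

/-- Holomorphic connections are determined by their values on holomorphic sections. -/
theorem IsHolConnection.ext [VectorBundle ℂ F V] [FiniteDimensional ℂ F]
    [ContMDiffVectorBundle ω F V I] [IsManifold I 1 B] {S : Set B} (hS : IsOpen S)
    {D D' : (Π x : B, V x) → Π x : B, TangentSpace I x →L[ℂ] V x}
    (hD : IsHolConnection I F S D) (hD' : IsHolConnection I F S D')
    (h : ∀ σ, ∀ x ∈ S, HolAt I F σ x → D σ x = D' σ x) : D = D' := by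
  funext σ x
  by_cases hx : x ∈ S ∧ DiffAt I F σ x
  · exact cov_eq_of_hol hD.covariant hD'.covariant (hS.mem_nhds hx.1) (fun σ => h σ x hx.1) hx.2
  -- Outside `S` and at non-differentiable sections both operators take the default value zero.
  · rw [hD.normalized σ x hx, hD'.normalized σ x hx]

end Covariant

section Morphism

variable {F' : Type*} [NormedAddCommGroup F'] [NormedSpace ℂ F']
  {V' : B → Type*} [TopologicalSpace (TotalSpace F' V')]
  [∀ x, AddCommGroup (V' x)] [∀ x, Module ℂ (V' x)] [∀ x, TopologicalSpace (V' x)]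
  [FiberBundle F' V'] [VectorBundle ℂ F V] [FiniteDimensional ℂ F] [ContMDiffVectorBundle ω F V I]
  [VectorBundle ℂ F' V']

/-- A morphism is known to be holomorphic only through its effect on holomorphic sections; expansion
in a frame extends this to differentiable ones. -/
theorem DiffAt.map {φ : Π x, V x →ₗ[ℂ] V' x} {x : B}
    (hφ : ∀ σ, HolAt I F σ x → HolAt I F' (fun y => φ y (σ y)) x) {σ : Π x, V x}
    (hσ : DiffAt I F σ x) : DiffAt I F' (fun y => φ y (σ y)) x := by
  obtain ⟨r, s, hs⟩ := exists_isFrameAt (F := F) (V := V) I x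
  obtain ⟨c, hc⟩ := hs.exists_coeff σ
  refine (DiffAt.sum_smul (t := Finset.univ) (hs.diffAt_coeff hσ hc)
    (fun i => (hφ _ (hs.self_of_nhds.1 i)).diffAt)).congr ?_
  filter_upwards [hc] with y hy
  simp [hy]

/-- The images of a frame are independent at `x`, and `φ σ` has the same coefficients in them as `σ`
in the frame; so these coefficients are holomorphic. -/
theorem HolAt.of_map [FiniteDimensional ℂ F'] {φ : Π x, V x →ₗ[ℂ] V' x} {x : B}
    (hφ : ∀ σ, HolAt I F σ x → HolAt I F' (fun y => φ y (σ y)) x)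
    (hinj : Function.Injective (φ x)) {σ : Π x, V x}
    (hσ : HolAt I F' (fun y => φ y (σ y)) x) : HolAt I F σ x := by
  obtain ⟨r, s, hs⟩ := exists_isFrameAt (F := F) (V := V) I x
  obtain ⟨c, hc⟩ := hs.exists_coeff σ
  have hsx := hs.self_of_nhds
  refine (HolAt.sum_smul (t := Finset.univ) (coeff_contMDiffAt (fun i => hφ _ (hsx.1 i))
    (hsx.2.1.map' (φ x) (LinearMap.ker_eq_bot.2 hinj)) hσ ?_) hsx.1).congr
    (hc.mono fun y hy => hy.symm)
  filter_upwards [hc] with y hy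
  simp [hy]

theorem DiffAt.of_map [FiniteDimensional ℂ F'] {φ : Π x, V x →ₗ[ℂ] V' x} {x : B}
    (hφ : ∀ σ, HolAt I F σ x → HolAt I F' (fun y => φ y (σ y)) x)
    (hinj : Function.Injective (φ x)) {σ : Π x, V x}
    (hσ : DiffAt I F' (fun y => φ y (σ y)) x) : DiffAt I F σ x := by
  obtain ⟨r, s, hs⟩ := exists_isFrameAt (F := F) (V := V) I x
  obtain ⟨c, hc⟩ := hs.exists_coeff σ
  have hsx := hs.self_of_nhds
  refine (DiffAt.sum_smul (t := Finset.univ) (coeff_mdifferentiableAt (fun i => hφ _ (hsx.1 i))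
    (hsx.2.1.map' (φ x) (LinearMap.ker_eq_bot.2 hinj)) hσ ?_) fun i => (hsx.1 i).diffAt).congr
    (hc.mono fun y hy => hy.symm)
  filter_upwards [hc] with y hy
  simp [hy]

end Morphism

section Subbundle

variable [VectorBundle ℂ F V]

/-- A combination of a local frame with constant coefficients does it. This turns statements about
sections of `W` into statements about single vectors. -/
theorem IsHolSubbundle.exists_section {W : Π x : B, Submodule ℂ (V x)}
    (hW : IsHolSubbundle I F W) {x : B} {v : V x} (hv : v ∈ W x) :
    ∃ s, HolSectionAt I F W s x ∧ s x = v := by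
  obtain ⟨r, s, hs⟩ := hW x
  have hx := hs.self_of_nhds
  rw [← hx.2.2] at hv
  obtain ⟨c, hc⟩ := (Submodule.mem_span_range_iff_exists_fun ℂ).1 hv
  refine ⟨fun y => ∑ i, c i • s i y, ⟨HolAt.sum fun i => (hx.1 i).const_smul _, ?_⟩, hc⟩
  filter_upwards [hs] with y hy
  rw [← hy.2.2]
  exact Submodule.sum_mem _ fun i _ => Submodule.smul_mem _ _ (Submodule.subset_span ⟨i, rfl⟩)

end Subbundle

end BundleTools

/-! ### The Lie bracket as a commutator of derivations -/

section Bracket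

variable {EB HB : Type*} [NormedAddCommGroup EB] [NormedSpace ℂ EB] [CompleteSpace EB]
  [TopologicalSpace HB]
  {I : ModelWithCorners ℂ EB HB} [I.Boundaryless] {B : Type*} [TopologicalSpace B]
  [ChartedSpace HB B] [IsManifold I ω B]
  {G : Type*} [NormedAddCommGroup G] [NormedSpace ℂ G]

/-- `mlieBracket` is defined by pulling fields back along the inverse chart; here the pulled-back
field is expressed by the derivative of the chart, at every point of its domain. -/
theorem mpullback_extChartAt_symm_apply (V : Π x : B, TangentSpace I x) {x y : B}
    (hy : y ∈ (extChartAt I x).source) :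
    VectorField.mpullbackWithin 𝓘(ℂ, EB) I (extChartAt I x).symm V (range I) (extChartAt I x y) =
      mfderiv I 𝓘(ℂ, EB) (extChartAt I x) y (V y) := by
  have h1 := mfderivWithin_extChartAt_symm_comp_mfderiv_extChartAt' (I := I) hy
  have h2 := mfderiv_extChartAt_comp_mfderivWithin_extChartAt_symm' (I := I) hy
  rw [VectorField.mpullbackWithin_apply]
  have h3 := ContinuousLinearMap.inverse_eq h1 h2
  exact (DFunLike.congr_fun h3 _).trans (congrArg
    (fun w => (mfderiv I 𝓘(ℂ, EB) (extChartAt I x) y : EB →L[ℂ] EB) (V w : EB))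
    ((extChartAt I x).left_inv hy))

/-- A vector field acts on functions as a derivation, and the Lie bracket is the commutator. -/
theorem mvfderiv_mlieBracket {f : B → G} {x : B} (hf : ContMDiffAt I 𝓘(ℂ, G) ω f x)
    {V W : Π x : B, TangentSpace I x} (hV : HolAt I EB V x) (hW : HolAt I EB W x) :
    mvfderiv I f x (VectorField.mlieBracket I V W x) =
      mvfderiv I (fun y => mvfderiv I f y (W y)) x (V x) -
        mvfderiv I (fun y => mvfderiv I f y (V y)) x (W x) := by
  have : IsManifold I 2 B := .of_le (n := ω) (by simp)
  set φ := extChartAt I x with hφ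
  set f' : EB → G := f ∘ φ.symm with hf'
  have hx : x ∈ φ.source := mem_extChartAt_source x
  have hsrc : ∀ᶠ y in 𝓝 x, y ∈ φ.source := extChartAt_source_mem_nhds x
  have hfd : ContDiffAt ℂ ω f' (φ x) := by
    have := (contMDiffAt_iff.1 hf).2
    rw [ModelWithCorners.Boundaryless.range_eq_univ, contDiffWithinAt_univ] at this
    exact this
  have hφd : ∀ y ∈ φ.source, MDifferentiableAt I 𝓘(ℂ, EB) φ y := fun y hy =>
    (contMDiffAt_extChartAt' (n := ω) (by simpa [hφ] using hy)).mdifferentiableAt (by simp)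
  have hcomp : ∀ (g : EB → G) (h : B → G) (y : B), y ∈ φ.source →
      DifferentiableAt ℂ g (φ y) → (∀ᶠ w in 𝓝 y, h w = g (φ w)) → ∀ v,
      mvfderiv I h y v = fderiv ℂ g (φ y) (mfderiv I 𝓘(ℂ, EB) φ y v) := by
    intro g h y hy hg hh v
    have h1 : mfderiv I 𝓘(ℂ, G) h y = mfderiv I 𝓘(ℂ, G) (g ∘ φ) y :=
      Filter.EventuallyEq.mfderiv_eq hh
    rw [mvfderiv, h1, mfderiv_comp y hg.mdifferentiableAt (hφd y hy), mfderiv_eq_fderiv]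
    rfl
  have hd : ∀ X : Π x : B, TangentSpace I x, HolAt I EB X x → DifferentiableAt ℂ
      (VectorField.mpullbackWithin 𝓘(ℂ, EB) I φ.symm X (range I)) (φ x) := by
    intro X hX
    have := MDifferentiableWithinAt.differentiableWithinAt_mpullbackWithin_vectorField
      (hX.diffAt.mdifferentiableWithinAt (s := univ))
    rw [preimage_univ, univ_inter, ModelWithCorners.Boundaryless.range_eq_univ] at this
    rw [ModelWithCorners.Boundaryless.range_eq_univ]
    exact differentiableWithinAt_univ.1 this
  have hf1 : ∀ᶠ y in 𝓝 x, DifferentiableAt ℂ f' (φ y) := by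
    have h1 : ∀ᶠ e in 𝓝 (φ x), DifferentiableAt ℂ f' e :=
      (hfd.eventually (by simp)).mono fun e he => he.differentiableAt (by simp)
    exact (continuousAt_extChartAt x).eventually h1
  have hff : ∀ᶠ y in 𝓝 x, f y = f' (φ y) := by
    filter_upwards [hsrc] with y hy
    simp [hf', φ.left_inv hy]
  -- In the chart, differentiating `Df(X)` gives a Hessian term and a term with the derivative of
  -- `X`.
  have key : ∀ X : Π x : B, TangentSpace I x, HolAt I EB X x → ∀ v,
      mvfderiv I (fun y => mvfderiv I f y (X y)) x v =
        fderiv ℂ (fderiv ℂ f') (φ x) (mfderiv I 𝓘(ℂ, EB) φ x v)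
            (mfderiv I 𝓘(ℂ, EB) φ x (X x)) +
          fderiv ℂ f' (φ x) (fderiv ℂ (VectorField.mpullbackWithin 𝓘(ℂ, EB) I φ.symm X (range I))
            (φ x) (mfderiv I 𝓘(ℂ, EB) φ x v)) := by
    intro X hX v
    have hfd' : DifferentiableAt ℂ (fderiv ℂ f') (φ x) :=
      (hfd.fderiv_right (m := 1) (by simp)).differentiableAt one_ne_zero
    rw [hcomp (fun e => fderiv ℂ f' e
      (VectorField.mpullbackWithin 𝓘(ℂ, EB) I φ.symm X (range I) e)) _ x hx
      (hfd'.clm_apply (hd X hX)) _ v]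
    · rw [fderiv_clm_apply hfd' (hd X hX)]
      rw [← mpullback_extChartAt_symm_apply X hx]
      simp [add_comm]
      rfl
    · filter_upwards [hsrc, hf1, hff.eventually_nhds] with y hy hy1 hy2
      rw [hcomp f' f y hy hy1 hy2, ← mpullback_extChartAt_symm_apply X hy]
  have hbr : (mfderiv I 𝓘(ℂ, EB) φ x (VectorField.mlieBracket I V W x) : EB) =
      fderiv ℂ (VectorField.mpullbackWithin 𝓘(ℂ, EB) I φ.symm W (range I))
          (φ x) (mfderiv I 𝓘(ℂ, EB) φ x (V x)) -
        fderiv ℂ (VectorField.mpullbackWithin 𝓘(ℂ, EB) I φ.symm V (range I))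
          (φ x) (mfderiv I 𝓘(ℂ, EB) φ x (W x)) := by
    have hinv := isInvertible_mfderiv_extChartAt (I := I) hx
    rw [← VectorField.mlieBracketWithin_univ, VectorField.mlieBracketWithin_apply]
    refine (DFunLike.congr_fun hinv.self_comp_inverse _).trans ?_
    rw [preimage_univ, univ_inter, ← mpullback_extChartAt_symm_apply V hx,
      ← mpullback_extChartAt_symm_apply W hx]
    have h : ∀ s : Set EB, s = univ → ∀ X Y : EB → EB, VectorField.lieBracketWithin ℂ X Y s (φ x) =
        fderiv ℂ Y (φ x) (X (φ x)) - fderiv ℂ X (φ x) (Y (φ x)) := by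
      rintro s rfl X Y
      rw [VectorField.lieBracketWithin_univ, VectorField.lieBracket_eq]
    exact h _ ModelWithCorners.Boundaryless.range_eq_univ _ _
  -- The two Hessian terms cancel by symmetry, leaving `Df` applied to the bracket in the chart.
  have hsymm : IsSymmSndFDerivAt ℂ f' (φ x) := hfd.isSymmSndFDerivAt (by simp)
  have halg : ∀ a b c d : G, c = d → a - b = (c + a) - (d + b) := by
    rintro a b c _ rfl
    abel
  rw [key V hV, key W hW, hcomp f' f x hx hf1.self_of_nhds hff, hbr]
  exact (map_sub (fderiv ℂ f' (φ x)) _ _).trans (halg _ _ _ _ (hsymm.eq _ _))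

end Bracket

/-! ### Holomorphic functions on the Riemann sphere and on `ℂ^*` -/

section Sphere

theorem lam_coe (z : ℂ) : lam (z : OnePoint ℂ) = z := rfl

theorem chartAt_coe (z : ℂ) : chartAt ℂ (z : OnePoint ℂ) = chartFin :=
  if_neg (OnePoint.coe_ne_infty z)

theorem contMDiff_coe : ContMDiff 𝓘(ℂ, ℂ) 𝓘(ℂ, ℂ) ω (fun z : ℂ => (z : OnePoint ℂ)) := by
  have h : chartFin ∈ IsManifold.maximalAtlas 𝓘(ℂ, ℂ) ω (OnePoint ℂ) :=
    IsManifold.subset_maximalAtlas (Or.inl rfl)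
  have h2 := contMDiffOn_symm_of_mem_maximalAtlas h
  rw [chartFin_target, contMDiffOn_univ] at h2
  exact h2

theorem lam_eq_chartFin {p : OnePoint ℂ} (hp : p ≠ OnePoint.infty) : lam p = chartFin p := by
  obtain ⟨z, rfl⟩ := OnePoint.ne_infty_iff_exists.1 hp
  rw [chartFin_coe, lam_coe]

theorem contMDiffAt_lam {p : OnePoint ℂ} (hp : p ≠ OnePoint.infty) :
    ContMDiffAt 𝓘(ℂ, ℂ) 𝓘(ℂ, ℂ) ω lam p := by
  have h : chartFin ∈ IsManifold.maximalAtlas 𝓘(ℂ, ℂ) ω (OnePoint ℂ) :=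
    IsManifold.subset_maximalAtlas (Or.inl rfl)
  have hs : p ∈ chartFin.source := by
    rw [chartFin_source]
    exact OnePoint.ne_infty_iff_exists.1 hp
  refine (contMDiffAt_of_mem_maximalAtlas h hs).congr_of_eventuallyEq ?_
  filter_upwards [isOpen_ne.mem_nhds hp] with q hq
  exact lam_eq_chartFin hq

/-- At a finite point the preferred chart, through which the tangent space is `ℂ`, is `λ` itself. -/
theorem mfderiv_lam {p : OnePoint ℂ} (hp : p ≠ OnePoint.infty) (a : ℂ) :
    mvfderiv 𝓘(ℂ, ℂ) lam p a = a := by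
  obtain ⟨z, rfl⟩ := OnePoint.ne_infty_iff_exists.1 hp
  have h1 : (lam : OnePoint ℂ → ℂ) =ᶠ[𝓝 (z : OnePoint ℂ)] extChartAt 𝓘(ℂ, ℂ) (z : OnePoint ℂ) := by
    filter_upwards [isOpen_ne.mem_nhds hp] with q hq
    simp [chartAt_coe, lam_eq_chartFin hq]
  rw [mvfderiv, h1.mfderiv_eq, mfderiv_extChartAt_self]
  rfl

theorem tendsto_coe_cocompact : Tendsto (fun z : ℂ => (z : OnePoint ℂ)) (cocompact ℂ)
    (𝓝 OnePoint.infty) := by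
  rw [← coclosedCompact_eq_cocompact]
  exact OnePoint.tendsto_coe_infty

/-- Holomorphic functions on the Riemann sphere are constant. -/
theorem eq_of_contMDiff_sphere {f : OnePoint ℂ → ℂ}
    (hf : ∀ p, ContMDiffAt 𝓘(ℂ, ℂ) 𝓘(ℂ, ℂ) ω f p) (p q : OnePoint ℂ) : f p = f q :=
  MDifferentiable.apply_eq_of_compactSpace (I := 𝓘(ℂ, ℂ))
    (fun p => (hf p).mdifferentiableAt (by simp)) p q

/-- A holomorphic function on `ℂ^*` with at most a simple pole at `0` and without pole
at `∞` is of the form `l + b / μ`. -/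
theorem eq_add_inv_mul_of_tendsto {f : ℂ → ℂ} (hf : ∀ μ : ℂ, μ ≠ 0 → DifferentiableAt ℂ f μ)
    {b l : ℂ} (h0 : Tendsto (fun μ => μ * f μ) (𝓝[≠] 0) (𝓝 b))
    (h1 : Tendsto f (cocompact ℂ) (𝓝 l)) {μ : ℂ} (hμ : μ ≠ 0) : f μ = l + μ⁻¹ * b := by
  -- `μ f(μ)` has a removable singularity at `0` with value `b`. The difference quotient of the
  -- entire function `h` at `0` is again entire, equals `f(μ) - μ⁻¹ b` away from `0`, and tends to
  -- `l` at infinity; so it is constant.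
  set h : ℂ → ℂ := Function.update (fun μ => μ * f μ) 0 b with hh
  have hne : ∀ z : ℂ, z ≠ 0 → h z = z * f z := fun z hz => by simp [hh, hz]
  have hd : ∀ z : ℂ, z ≠ 0 → DifferentiableAt ℂ h z := by
    intro z hz
    refine (differentiableAt_id.mul (hf z hz)).congr_of_eventuallyEq ?_
    filter_upwards [isOpen_ne.mem_nhds hz] with w hw
    exact hne w hw
  have hdiff : Differentiable ℂ h := by
    intro z
    rcases eq_or_ne z 0 with rfl | hz
    · refine (Complex.analyticAt_of_differentiable_on_punctured_nhds_of_continuousAt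
        ?_ ?_).differentiableAt
      · filter_upwards [self_mem_nhdsWithin] with w hw using hd w hw
      · rwa [hh, continuousAt_update_same]
    · exact hd z hz
  have hsl : Differentiable ℂ (dslope h 0) := by
    rw [← differentiableOn_univ, Complex.differentiableOn_dslope univ_mem]
    exact hdiff.differentiableOn
  have hval : ∀ z : ℂ, z ≠ 0 → dslope h 0 z = f z - z⁻¹ * b := by
    intro z hz
    rw [dslope_of_ne _ hz, slope_def_field, hne z hz]
    simp only [hh, Function.update_self, sub_zero]
    field_simp
  have hz : ∀ᶠ z : ℂ in cocompact ℂ, z ≠ 0 :=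
    (isCompact_singleton (x := (0 : ℂ))).compl_mem_cocompact
  have hlim : Tendsto (dslope h 0) (cocompact ℂ) (𝓝 l) := by
    have h2 : Tendsto (fun z : ℂ => f z - z⁻¹ * b) (cocompact ℂ) (𝓝 (l - 0 * b)) :=
      h1.sub ((by rw [← Metric.cobounded_eq_cocompact]; exact tendsto_inv₀_cobounded :
        Tendsto (fun z : ℂ => z⁻¹) (cocompact ℂ) (𝓝 0)).mul_const b)
    rw [zero_mul, sub_zero] at h2
    exact h2.congr' (hz.mono fun z hz => (hval z hz).symm)
  have := congrFun (hsl.eq_const_of_tendsto_cocompact hlim) μ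
  rw [hval μ hμ] at this
  simp only [Function.const_apply] at this
  rw [← this]
  ring

end Sphere

/-! ### Vector fields on `ℙ¹ × M` and their brackets -/

section Product

variable {E : Type*} [NormedAddCommGroup E] [NormedSpace ℂ E]
  {M : Type*} [TopologicalSpace M] [ChartedSpace E M]
  {G : Type*} [NormedAddCommGroup G] [NormedSpace ℂ G]

theorem mvfderiv_comp_fst {g : OnePoint ℂ → G} {z : OnePoint ℂ × M}
    (hg : MDifferentiableAt 𝓘(ℂ, ℂ) 𝓘(ℂ, G) g z.1) (v : TangentSpace (modelP E) z) :
    mvfderiv (modelP E) (fun w : OnePoint ℂ × M => g w.1) z v = mvfderiv 𝓘(ℂ, ℂ) g z.1 v.1 := by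
  have h := mfderiv_comp_apply (I := modelP E) z hg mdifferentiableAt_fst v
  rw [mfderiv_fst] at h
  exact h

theorem mvfderiv_comp_snd {g : M → G} {z : OnePoint ℂ × M}
    (hg : MDifferentiableAt 𝓘(ℂ, E) 𝓘(ℂ, G) g z.2) (v : TangentSpace (modelP E) z) :
    mvfderiv (modelP E) (fun w : OnePoint ℂ × M => g w.2) z v = mvfderiv 𝓘(ℂ, E) g z.2 v.2 := by
  have h := mfderiv_comp_apply (I := modelP E) z hg mdifferentiableAt_snd v
  rw [mfderiv_snd] at h
  exact h

theorem contMDiffAt_lam_fst {z : OnePoint ℂ × M} (hz : z.1 ≠ OnePoint.infty) :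
    ContMDiffAt (modelP E) 𝓘(ℂ, ℂ) ω (fun w : OnePoint ℂ × M => lam w.1) z :=
  (contMDiffAt_lam hz).comp z contMDiffAt_fst

theorem mvfderiv_lam_fst {z : OnePoint ℂ × M} (hz : z.1 ≠ OnePoint.infty)
    (v : TangentSpace (modelP E) z) :
    mvfderiv (modelP E) (fun w : OnePoint ℂ × M => lam w.1) z v = v.1 := by
  rw [mvfderiv_comp_fst ((contMDiffAt_lam hz).mdifferentiableAt (by simp)), mfderiv_lam hz]

theorem isOpen_regularLocus : IsOpen (regularLocus M) :=
  (isOpen_ne.preimage continuous_fst).inter (isOpen_ne.preimage continuous_fst)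

theorem coe_mem_regularLocus {μ : ℂ} (hμ : μ ≠ 0) (x : M) :
    ((μ : OnePoint ℂ), x) ∈ regularLocus M :=
  ⟨by simpa using hμ, by simp⟩

theorem lam_ne_zero {z : OnePoint ℂ × M} (hz : z ∈ regularLocus M) : lam z.1 ≠ 0 := by
  obtain ⟨p, x⟩ := z
  obtain ⟨c, rfl⟩ := OnePoint.ne_infty_iff_exists.1 hz.2
  intro h
  rw [lam_coe] at h
  exact hz.1 (by simp [h])

variable [IsManifold 𝓘(ℂ, E) ω M]

/-- The lift to `ℙ¹ × M` of a vector field on `M`. -/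
def liftField (X : Π x : M, TangentSpace 𝓘(ℂ, E) x) (z : OnePoint ℂ × M) :
    TangentSpace (modelP E) z :=
  tangentVec z 0 (X z.2)

variable (E M) in
/-- The vector field `λ ∂_λ`. -/
def lamField (z : OnePoint ℂ × M) : TangentSpace (modelP E) z :=
  tangentVec z (lam z.1) 0

/-- The tangent bundle of a product is the product of the tangent bundles, holomorphically. -/
theorem holAt_prod {a : Π p : OnePoint ℂ, TangentSpace 𝓘(ℂ, ℂ) p}
    {X : Π x : M, TangentSpace 𝓘(ℂ, E) x}
    {z : OnePoint ℂ × M} (ha : HolAt 𝓘(ℂ, ℂ) ℂ a z.1) (hX : HolAt 𝓘(ℂ, E) E X z.2) :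
    HolAt (modelP E) (ℂ × E) (fun w => tangentVec (E := E) w (a w.1) (X w.2)) z := by
  have h1 : ContMDiffAt (modelP E) (𝓘(ℂ, ℂ).prod 𝓘(ℂ, ℂ)) ω
      (fun w : OnePoint ℂ × M => (⟨w.1, a w.1⟩ : TangentBundle 𝓘(ℂ, ℂ) (OnePoint ℂ))) z :=
    ContMDiffAt.comp z ha contMDiffAt_fst
  have h2 : ContMDiffAt (modelP E) (𝓘(ℂ, E).prod 𝓘(ℂ, E)) ω
      (fun w : OnePoint ℂ × M => (⟨w.2, X w.2⟩ : TangentBundle 𝓘(ℂ, E) M)) z :=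
    ContMDiffAt.comp z hX contMDiffAt_snd
  exact (contMDiff_equivTangentBundleProd_symm (n := ω) (I := 𝓘(ℂ, ℂ)) (M := OnePoint ℂ)
    (I' := 𝓘(ℂ, E)) (M' := M)).contMDiffAt.comp z (h1.prodMk h2)

theorem holAt_liftField {X : Π x : M, TangentSpace 𝓘(ℂ, E) x} {z : OnePoint ℂ × M}
    (hX : HolAt 𝓘(ℂ, E) E X z.2) : HolAt (modelP E) (ℂ × E) (liftField X) z :=
  holAt_prod (a := fun _ => 0) (Bundle.contMDiff_zeroSection ℂ _ z.1) hX

theorem holAt_lamField {z : OnePoint ℂ × M} (hz : z.1 ≠ OnePoint.infty) :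
    HolAt (modelP E) (ℂ × E) (lamField E M) z := by
  let a : Π p : OnePoint ℂ, TangentSpace 𝓘(ℂ, ℂ) p := fun p => lam p
  refine holAt_prod (a := a) (X := fun _ => 0) ?_ (Bundle.contMDiff_zeroSection ℂ _ z.2)
  refine (holAt_iff (σ := a)).2 ?_
  refine (contMDiffAt_lam hz).congr_of_eventuallyEq ?_
  filter_upwards [isOpen_ne.mem_nhds hz] with p hp
  obtain ⟨c, hc⟩ := OnePoint.ne_infty_iff_exists.1 hz
  obtain ⟨d, rfl⟩ := OnePoint.ne_infty_iff_exists.1 hp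
  rw [TangentBundle.trivializationAt_apply, ← hc, chartAt_coe, chartAt_coe]
  -- All finite points share the chart `λ`, so the tangent coordinate change between them is the
  -- identity and the field is represented by `lam`.
  have h2 : (chartFin.extend 𝓘(ℂ, ℂ) ∘ (chartFin.extend 𝓘(ℂ, ℂ)).symm) = id := by
    funext z
    simp [chartFin_symm_apply, chartFin_coe]
  rw [h2]
  simp only [ModelWithCorners.range_eq_univ, fderivWithin_univ, fderiv_id]
  rfl

variable [CompleteSpace E]

/-- Two tangent vectors are equal if they act in the same way on coordinate functions. -/
theorem tangent_ext {z : OnePoint ℂ × M} (hz : z.1 ≠ OnePoint.infty)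
    {v w : TangentSpace (modelP E) z}
    (h1 : mvfderiv (modelP E) (fun y : OnePoint ℂ × M => lam y.1) z v =
      mvfderiv (modelP E) (fun y : OnePoint ℂ × M => lam y.1) z w)
    (h2 : mvfderiv (modelP E) (fun y : OnePoint ℂ × M => extChartAt 𝓘(ℂ, E) z.2 y.2) z v =
      mvfderiv (modelP E) (fun y : OnePoint ℂ × M => extChartAt 𝓘(ℂ, E) z.2 y.2) z w) : v = w := by
  have hd : MDifferentiableAt 𝓘(ℂ, E) 𝓘(ℂ, E) (extChartAt 𝓘(ℂ, E) z.2) z.2 :=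
    (contMDiffAt_extChartAt (n := ω)).mdifferentiableAt (by simp)
  rw [mvfderiv_lam_fst hz, mvfderiv_lam_fst hz] at h1
  rw [mvfderiv_comp_snd hd, mvfderiv_comp_snd hd, mvfderiv, mfderiv_extChartAt_self] at h2
  exact Prod.ext h1 h2

theorem contMDiffAt_extChartAt_snd (z : OnePoint ℂ × M) : ContMDiffAt (modelP E) 𝓘(ℂ, E) ω
    (fun y : OnePoint ℂ × M => extChartAt 𝓘(ℂ, E) z.2 y.2) z :=
  (contMDiffAt_extChartAt (n := ω)).comp z contMDiffAt_snd

theorem eventually_mvfderiv_chart_snd (z : OnePoint ℂ × M) :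
    ∀ᶠ y in 𝓝 z, ∀ v : TangentSpace (modelP E) y,
      mvfderiv (modelP E) (fun y : OnePoint ℂ × M => extChartAt 𝓘(ℂ, E) z.2 y.2) y v =
        mvfderiv 𝓘(ℂ, E) (extChartAt 𝓘(ℂ, E) z.2) y.2 v.2 := by
  have h : ∀ᶠ y in 𝓝 z, y.2 ∈ (extChartAt 𝓘(ℂ, E) z.2).source :=
    continuous_snd.continuousAt.eventually (extChartAt_source_mem_nhds z.2)
  filter_upwards [h] with y hy v
  exact mvfderiv_comp_snd ((contMDiffAt_extChartAt' (n := ω) (by simpa using hy)).mdifferentiableAt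
    (by simp)) v

theorem eventually_mvfderiv_lam {z : OnePoint ℂ × M} (hz : z.1 ≠ OnePoint.infty) :
    ∀ᶠ y in 𝓝 z, ∀ v : TangentSpace (modelP E) y,
      mvfderiv (modelP E) (fun y : OnePoint ℂ × M => lam y.1) y v = v.1 := by
  filter_upwards [continuous_fst.continuousAt.eventually (isOpen_ne.mem_nhds hz)] with y hy v
  exact mvfderiv_lam_fst hy v

theorem mvfderiv_congr {EB HB : Type*} [NormedAddCommGroup EB] [NormedSpace ℂ EB]
    [TopologicalSpace HB] {I : ModelWithCorners ℂ EB HB} {B : Type*} [TopologicalSpace B]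
    [ChartedSpace HB B] {f g : B → G} {x : B} (h : f =ᶠ[𝓝 x] g) :
    mvfderiv I f x = mvfderiv I g x := by
  ext v
  rw [mvfderiv, mvfderiv, h.mfderiv_eq]
  rfl

/-- The derivative of the chart along `Z` is the fibre coordinate of `Z` in the tangent
trivialisation. -/
theorem mdifferentiableAt_mvfderiv_chart {Z : Π x : M, TangentSpace 𝓘(ℂ, E) x} {x : M}
    (hZ : HolAt 𝓘(ℂ, E) E Z x) : MDifferentiableAt 𝓘(ℂ, E) 𝓘(ℂ, E)
      (fun y => mvfderiv 𝓘(ℂ, E) (extChartAt 𝓘(ℂ, E) x) y (Z y)) x := by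
  refine (diffAt_iff.1 hZ.diffAt).congr_of_eventuallyEq ?_
  filter_upwards [(chartAt E x).open_source.mem_nhds (mem_chart_source E x)] with y hy
  have h := TangentBundle.continuousLinearMapAt_trivializationAt (I := 𝓘(ℂ, E)) hy
  have h2 := DFunLike.congr_fun h (Z y)
  rw [Trivialization.continuousLinearMapAt_apply, Trivialization.coe_linearMapAt_of_mem _
    (by simpa using hy)] at h2
  exact h2.symm

/-- By `tangent_ext` it suffices to let both sides act on `λ`, which the lifts annihilate, and on a
chart of `M`, where the action of the lifts is that of `X` and `Y`. -/
theorem mlieBracket_liftField {X Y : Π x : M, TangentSpace 𝓘(ℂ, E) x} {z : OnePoint ℂ × M}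
    (hz : z.1 ≠ OnePoint.infty) (hX : HolAt 𝓘(ℂ, E) E X z.2) (hY : HolAt 𝓘(ℂ, E) E Y z.2) :
    VectorField.mlieBracket (modelP E) (liftField X) (liftField Y) z =
      tangentVec z 0 (VectorField.mlieBracket 𝓘(ℂ, E) X Y z.2) := by
  have hX' := holAt_liftField (z := z) hX
  have hY' := holAt_liftField (z := z) hY
  apply tangent_ext hz
  · rw [mvfderiv_mlieBracket (contMDiffAt_lam_fst hz) hX' hY']
    have h : ∀ Z : Π x : M, TangentSpace 𝓘(ℂ, E) x,
        (fun y => mvfderiv (modelP E) (fun y : OnePoint ℂ × M => lam y.1) y (liftField Z y))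
          =ᶠ[𝓝 z] fun _ => 0 := by
      intro Z
      filter_upwards [eventually_mvfderiv_lam (E := E) hz] with y hy using hy _
    rw [mvfderiv_congr (h X), mvfderiv_congr (h Y), mvfderiv_const, mvfderiv_lam_fst hz]
    simp [tangentVec]
  · rw [mvfderiv_mlieBracket (contMDiffAt_extChartAt_snd (E := E) z) hX' hY']
    have h : ∀ Z : Π x : M, TangentSpace 𝓘(ℂ, E) x,
        (fun y => mvfderiv (modelP E) (fun y : OnePoint ℂ × M => extChartAt 𝓘(ℂ, E) z.2 y.2) y
            (liftField Z y)) =ᶠ[𝓝 z]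
          fun y => mvfderiv 𝓘(ℂ, E) (extChartAt 𝓘(ℂ, E) z.2) y.2 (Z y.2) := by
      intro Z
      filter_upwards [eventually_mvfderiv_chart_snd (E := E) z] with y hy using hy _
    have hd := fun (Z : Π x : M, TangentSpace 𝓘(ℂ, E) x) (hZ : HolAt 𝓘(ℂ, E) E Z z.2) =>
      mdifferentiableAt_mvfderiv_chart hZ
    rw [mvfderiv_congr (h X), mvfderiv_congr (h Y),
      mvfderiv_comp_snd (g := fun y => mvfderiv 𝓘(ℂ, E) (extChartAt 𝓘(ℂ, E) z.2) y (X y)) (hd X hX),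
      mvfderiv_comp_snd (g := fun y => mvfderiv 𝓘(ℂ, E) (extChartAt 𝓘(ℂ, E) z.2) y (Y y)) (hd Y hY),
      (eventually_mvfderiv_chart_snd (E := E) z).self_of_nhds]
    exact (mvfderiv_mlieBracket (contMDiffAt_extChartAt (n := ω)) hX hY).symm

/-- Tested on coordinates: a lift kills `λ`, while `λ ∂_λ` kills every function pulled back from
`M`. -/
theorem mlieBracket_lamField_liftField {X : Π x : M, TangentSpace 𝓘(ℂ, E) x} {z : OnePoint ℂ × M}
    (hz : z.1 ≠ OnePoint.infty) (hX : HolAt 𝓘(ℂ, E) E X z.2) :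
    VectorField.mlieBracket (modelP E) (lamField E M) (liftField X) z = 0 := by
  have hX' := holAt_liftField (z := z) hX
  have hL := holAt_lamField (E := E) (z := z) hz
  apply tangent_ext hz
  · rw [mvfderiv_mlieBracket (contMDiffAt_lam_fst hz) hL hX']
    have h : (fun y => mvfderiv (modelP E) (fun y : OnePoint ℂ × M => lam y.1) y (liftField X y))
          =ᶠ[𝓝 z] fun _ => 0 := by
      filter_upwards [eventually_mvfderiv_lam (E := E) hz] with y hy using hy _
    have h' : (fun y => mvfderiv (modelP E) (fun y : OnePoint ℂ × M => lam y.1) y (lamField E M y))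
          =ᶠ[𝓝 z] fun y => lam y.1 := by
      filter_upwards [eventually_mvfderiv_lam (E := E) hz] with y hy using hy _
    rw [mvfderiv_congr h, mvfderiv_congr h', mvfderiv_const, mvfderiv_lam_fst hz]
    simp [liftField, tangentVec]
  · rw [mvfderiv_mlieBracket (contMDiffAt_extChartAt_snd (E := E) z) hL hX']
    have h : (fun y => mvfderiv (modelP E) (fun y : OnePoint ℂ × M => extChartAt 𝓘(ℂ, E) z.2 y.2) y
            (liftField X y)) =ᶠ[𝓝 z]
          fun y => mvfderiv 𝓘(ℂ, E) (extChartAt 𝓘(ℂ, E) z.2) y.2 (X y.2) := by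
      filter_upwards [eventually_mvfderiv_chart_snd (E := E) z] with y hy using hy _
    have h' : (fun y => mvfderiv (modelP E) (fun y : OnePoint ℂ × M => extChartAt 𝓘(ℂ, E) z.2 y.2) y
            (lamField E M y)) =ᶠ[𝓝 z] fun y => 0 := by
      filter_upwards [eventually_mvfderiv_chart_snd (E := E) z] with y hy
      exact (hy _).trans (map_zero _)
    rw [mvfderiv_congr h, mvfderiv_congr h', mvfderiv_const, mvfderiv_comp_snd
      (g := fun y => mvfderiv 𝓘(ℂ, E) (extChartAt 𝓘(ℂ, E) z.2) y (X y))
      (mdifferentiableAt_mvfderiv_chart hX), map_zero]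
    exact (sub_zero _).trans (map_zero _)

end Product

/-! ### Sections of pulled-back bundles -/

section PullbackBundle

variable {EB HB : Type*} [NormedAddCommGroup EB] [NormedSpace ℂ EB] [TopologicalSpace HB]
  {I : ModelWithCorners ℂ EB HB} {B : Type*} [TopologicalSpace B] [ChartedSpace HB B]
  {EB' HB' : Type*} [NormedAddCommGroup EB'] [NormedSpace ℂ EB'] [TopologicalSpace HB']
  {I' : ModelWithCorners ℂ EB' HB'} {B' : Type*} [TopologicalSpace B'] [ChartedSpace HB' B']
  {F : Type*} [NormedAddCommGroup F] [NormedSpace ℂ F]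
  {V : B → Type*} [TopologicalSpace (TotalSpace F V)]
  [∀ x, AddCommGroup (V x)] [∀ x, Module ℂ (V x)] [∀ x, TopologicalSpace (V x)]
  [FiberBundle F V] (f : C^ω⟮I', B'; I, B⟯)

theorem holAt_pullback_iff {σ : Π y, (f *ᵖ V) y} {y : B'} :
    HolAt I' F σ y ↔ ContMDiffAt I' 𝓘(ℂ, F) ω
      (fun w => (trivializationAt F V (f y) ⟨f w, σ w⟩).2) y :=
  holAt_iff

theorem diffAt_pullback_iff {σ : Π y, (f *ᵖ V) y} {y : B'} :
    DiffAt I' F σ y ↔ MDifferentiableAt I' 𝓘(ℂ, F)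
      (fun w => (trivializationAt F V (f y) ⟨f w, σ w⟩).2) y :=
  diffAt_iff

theorem HolAt.pullback {σ : Π x, V x} {y : B'} (h : HolAt I F σ (f y)) :
    HolAt I' F (V := f *ᵖ V) (fun w => σ (f w)) y :=
  (holAt_pullback_iff f).2 ((holAt_iff.1 h).comp y f.contMDiff.contMDiffAt)

end PullbackBundle

/-! ### Bundles trivial along `ℙ¹` and the isomorphism with `p^*(H|_{λ = 0})` -/

section AlongSphere

variable {E : Type*} [NormedAddCommGroup E] [NormedSpace ℂ E]
  {M : Type*} [TopologicalSpace M] [ChartedSpace E M] [IsManifold 𝓘(ℂ, E) ω M]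
  {F : Type*} [NormedAddCommGroup F] [NormedSpace ℂ F] [FiniteDimensional ℂ F]
  {H : OnePoint ℂ × M → Type*} [TopologicalSpace (TotalSpace F H)]
  [∀ z, AddCommGroup (H z)] [∀ z, Module ℂ (H z)] [∀ z, TopologicalSpace (H z)]
  [FiberBundle F H] [VectorBundle ℂ F H] [ContMDiffVectorBundle ω F H (modelP E)]

variable (E F) in
/-- `s` is a holomorphic frame of `H` over `ℙ¹ × U` for some neighbourhood `U` of `x`. -/
def IsAlongFrameAt {r : ℕ} (s : Fin r → Π z, H z) (x : M) : Prop :=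
  ∀ᶠ y in 𝓝 x, ∀ p : OnePoint ℂ,
    (∀ i, HolAt (modelP E) F (s i) (p, y)) ∧ LinearIndependent ℂ (fun i => s i (p, y)) ∧
      Submodule.span ℂ (range fun i => s i (p, y)) = ⊤

theorem IsAlongFrameAt.eventually {r : ℕ} {s : Fin r → Π z, H z} {x : M}
    (hs : IsAlongFrameAt E F s x) : ∀ᶠ y in 𝓝 x, IsAlongFrameAt E F s y :=
  eventually_eventually_nhds.2 hs

theorem IsAlongFrameAt.isFrameAt {r : ℕ} {s : Fin r → Π z, H z} {x : M}
    (hs : IsAlongFrameAt E F s x) (p : OnePoint ℂ) : IsFrameAt (modelP E) F s (p, x) := by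
  have h : ∀ᶠ z : OnePoint ℂ × M in 𝓝 (p, x), ∀ q : OnePoint ℂ,
      (∀ i, HolAt (modelP E) F (s i) (q, z.2)) ∧ LinearIndependent ℂ (fun i => s i (q, z.2)) ∧
        Submodule.span ℂ (range fun i => s i (q, z.2)) = ⊤ :=
    (continuous_snd.tendsto (p, x)).eventually hs
  filter_upwards [h] with z hz using hz z.1

omit [VectorBundle ℂ F H] [FiniteDimensional ℂ F] [ContMDiffVectorBundle ω F H (modelP E)] in
theorem holAt_restrictZero {σ : Π z, H z} {x : M}
    (h : HolAt (modelP E) F σ (((0 : ℂ) : OnePoint ℂ), x)) :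
    HolAt 𝓘(ℂ, E) F (restrictZero E σ) x :=
  HolAt.pullback (zeroEmb E M) (y := x) h

theorem IsAlongFrameAt.isFrameAt_restrictZero {r : ℕ} {s : Fin r → Π z, H z} {x : M}
    (hs : IsAlongFrameAt E F s x) :
    IsFrameAt 𝓘(ℂ, E) F (V := AtZero E H) (fun i => restrictZero E (s i)) x := by
  filter_upwards [hs] with y hy
  have h0 := hy ((0 : ℂ) : OnePoint ℂ)
  exact ⟨fun i => holAt_restrictZero (h0.1 i), h0.2⟩

theorem contMDiff_slice (p : OnePoint ℂ) :
    ContMDiff 𝓘(ℂ, E) (modelP E) ω fun y : M => (p, y) :=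
  contMDiff_const.prodMk contMDiff_id

theorem contMDiff_slice_snd (x : M) :
    ContMDiff 𝓘(ℂ, ℂ) (modelP E) ω fun p : OnePoint ℂ => (p, x) :=
  contMDiff_id.prodMk contMDiff_const

-- In contrast to `IsFrameAt.exists_coeff`, a single choice of coefficients serves at all points
-- where `s` spans, so that their values can be compared along `ℙ¹`.
omit [IsManifold 𝓘(ℂ, E) ω M] in
theorem exists_coeff_of_span {r : ℕ} (s : Fin r → Π z, H z) (σ : Π z, H z) :
    ∃ c : Fin r → OnePoint ℂ × M → ℂ, ∀ z, Submodule.span ℂ (range fun i => s i z) = ⊤ →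
      σ z = ∑ i, c i z • s i z := by
  have : ∀ z, ∃ c : Fin r → ℂ, (Submodule.span ℂ (range fun i => s i z) = ⊤ →
      σ z = ∑ i, c i • s i z) := by
    intro z
    by_cases h : Submodule.span ℂ (range fun i => s i z) = ⊤
    · have h1 : σ z ∈ Submodule.span ℂ (range fun i => s i z) := by rw [h]; trivial
      obtain ⟨c, hc⟩ := (Submodule.mem_span_range_iff_exists_fun ℂ).1 h1
      exact ⟨c, fun _ => hc.symm⟩
    · exact ⟨0, fun h' => absurd h' h⟩
  choose c hc using this
  exact ⟨fun i z => c z i, hc⟩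

/-- Along `ℙ¹`, the coefficients of a holomorphic section in a frame are constant. -/
theorem IsAlongFrameAt.exists_coeff {r : ℕ} {s : Fin r → Π z, H z} {x : M}
    (hs : IsAlongFrameAt E F s x) {σ : Π z, H z} (hσ : HolAlongAt E F σ x) :
    ∃ c : Fin r → M → ℂ, (∀ i, ContMDiffAt 𝓘(ℂ, E) 𝓘(ℂ, ℂ) ω (c i) x) ∧
      ∀ᶠ y in 𝓝 x, ∀ p : OnePoint ℂ, σ (p, y) = ∑ i, c i y • s i (p, y) := by
  obtain ⟨c, hc⟩ := exists_coeff_of_span s σ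
  have hol : ∀ᶠ y in 𝓝 x, ∀ p i, ContMDiffAt (modelP E) 𝓘(ℂ, ℂ) ω (c i) (p, y) := by
    filter_upwards [hs.eventually, hσ] with y hy hσy p i
    refine (hy.isFrameAt p).holAt_coeff (hσy p) ?_ i
    filter_upwards [hy.isFrameAt p] with z hz using hc z hz.2.2
  refine ⟨fun i y => c i (((0 : ℂ) : OnePoint ℂ), y), fun i => ?_, ?_⟩
  · exact (hol.self_of_nhds _ i).comp x ((contMDiff_slice _).contMDiffAt)
  · filter_upwards [hol, hs] with y hy hsy p
    rw [hc (p, y) (hsy p).2.2]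
    refine Finset.sum_congr rfl fun i _ => ?_
    rw [eq_of_contMDiff_sphere (f := fun q => c i (q, y))
      (fun q => (hy q i).comp q (contMDiff_slice_snd y).contMDiffAt) p]

omit [IsManifold 𝓘(ℂ, E) ω M] in
theorem IsAlongFrameAt.holAlongAt_sum {r : ℕ} {s : Fin r → Π z, H z} {x : M}
    (hs : IsAlongFrameAt E F s x) (c : Fin r → ℂ) :
    HolAlongAt E F (fun z => ∑ i, c i • s i z) x := by
  filter_upwards [hs] with y hy p
  exact HolAt.sum fun i => ((hy p).1 i).const_smul _

variable (hH : IsTrivialAlong (HolAt (modelP E) F (V := H)))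

include hH

theorem exists_isAlongFrameAt (x : M) : ∃ (r : ℕ) (s : Fin r → Π z, H z), IsAlongFrameAt E F s x :=
  hH x

/-- The section chosen in `constExt` is immaterial. Any two holomorphic sections over `ℙ¹ × U` have
coefficients independent of `λ`; if they agree at `(0, t)`, their coefficients over `t` agree there
and hence for all `λ`. -/
theorem constExt_restrictZero {σ : Π z, H z} {z : OnePoint ℂ × M} (hσ : HolAlongAt E F σ z.2) :
    constExt E F z (restrictZero E σ z.2) = σ z := by
  have h : ∃ τ : Π z, H z, HolAlongAt E F τ z.2 ∧
      restrictZero E τ z.2 = restrictZero E σ z.2 := ⟨σ, hσ, rfl⟩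
  rw [constExt, dif_pos h]
  obtain ⟨r, s, hs⟩ := exists_isAlongFrameAt hH z.2
  obtain ⟨c, -, hc⟩ := hs.exists_coeff hσ
  obtain ⟨c', -, hc'⟩ := hs.exists_coeff h.choose_spec.1
  have h0 : h.choose (((0 : ℂ) : OnePoint ℂ), z.2) = σ (((0 : ℂ) : OnePoint ℂ), z.2) :=
    h.choose_spec.2
  rw [hc.self_of_nhds, hc'.self_of_nhds] at h0
  have hli := (hs.self_of_nhds ((0 : ℂ) : OnePoint ℂ)).2.1
  have heq : (fun i => c' i z.2) = fun i => c i z.2 :=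
    hli.fintypeLinearCombination_injective (by simpa [Fintype.linearCombination_apply] using h0)
  have h1 := hc.self_of_nhds z.1
  have h2 := hc'.self_of_nhds z.1
  refine h2.trans (Eq.trans ?_ h1.symm)
  exact Finset.sum_congr rfl fun i _ => by rw [congrFun heq i]

theorem constExt_sum {r : ℕ} {s : Fin r → Π z, H z} {z : OnePoint ℂ × M}
    (hs : IsAlongFrameAt E F s z.2) (c : Fin r → ℂ) :
    constExt E F z (∑ i, c i • restrictZero E (s i) z.2) = ∑ i, c i • s i z :=
  constExt_restrictZero hH (hs.holAlongAt_sum c)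

omit hH in
theorem IsAlongFrameAt.exists_eq_sum {r : ℕ} {s : Fin r → Π z, H z} {x : M}
    (hs : IsAlongFrameAt E F s x) (v : AtZero E H x) :
    ∃ c : Fin r → ℂ, v = ∑ i, c i • restrictZero E (s i) x := by
  have h := (hs.self_of_nhds ((0 : ℂ) : OnePoint ℂ)).2.2
  let w : H (((0 : ℂ) : OnePoint ℂ), x) := v
  have h1 : w ∈ Submodule.span ℂ (range fun i => s i (((0 : ℂ) : OnePoint ℂ), x)) := by
    rw [h]; trivial
  obtain ⟨c, hc⟩ := (Submodule.mem_span_range_iff_exists_fun ℂ).1 h1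
  exact ⟨c, hc.symm⟩

/-- The natural isomorphism `(p^*(H|_{λ = 0}))_z ≃ H_z`. -/
def constEquiv (z : OnePoint ℂ × M) : AtZero E H z.2 ≃ₗ[ℂ] H z :=
  LinearEquiv.ofBijective
    { toFun := constExt E F z
      map_add' := by
        intro v w
        obtain ⟨r, s, hs⟩ := exists_isAlongFrameAt hH z.2
        obtain ⟨c, rfl⟩ := hs.exists_eq_sum v
        obtain ⟨d, rfl⟩ := hs.exists_eq_sum w
        rw [← Finset.sum_add_distrib]
        simp_rw [← add_smul]
        rw [constExt_sum hH hs, constExt_sum hH hs, constExt_sum hH hs, ← Finset.sum_add_distrib]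
        simp_rw [add_smul]
      map_smul' := by
        intro a v
        obtain ⟨r, s, hs⟩ := exists_isAlongFrameAt hH z.2
        obtain ⟨c, rfl⟩ := hs.exists_eq_sum v
        rw [Finset.smul_sum]
        simp_rw [smul_smul]
        rw [constExt_sum hH hs, constExt_sum hH hs, RingHom.id_apply, Finset.smul_sum]
        simp_rw [smul_smul] }
    (by
      obtain ⟨r, s, hs⟩ := exists_isAlongFrameAt hH z.2
      constructor
      · intro v w hvw
        obtain ⟨c, rfl⟩ := hs.exists_eq_sum v
        obtain ⟨d, rfl⟩ := hs.exists_eq_sum w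
        replace hvw : constExt E F z _ = constExt E F z _ := hvw
        rw [constExt_sum hH hs, constExt_sum hH hs] at hvw
        have hcd : c = d := (hs.self_of_nhds z.1).2.1.fintypeLinearCombination_injective
          (by simpa [Fintype.linearCombination_apply] using hvw)
        rw [hcd]
      · intro w
        have h := (hs.self_of_nhds z.1).2.2
        have h1 : w ∈ Submodule.span ℂ (range fun i => s i z) := h ▸ Submodule.mem_top
        obtain ⟨c, hc⟩ := (Submodule.mem_span_range_iff_exists_fun ℂ).1 h1
        exact ⟨∑ i, c i • restrictZero E (s i) z.2, (constExt_sum hH hs c).trans hc⟩)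

@[simp]
theorem constEquiv_apply (z : OnePoint ℂ × M) (v : AtZero E H z.2) :
    constEquiv hH z v = constExt E F z v := rfl

omit hH in
/-- The section of `H` which is constant along `ℙ¹` and restricts to `s` on `λ = 0`. -/
def hat (hH : IsTrivialAlong (HolAt (modelP E) F (V := H))) (s : Π x, AtZero E H x)
    (z : OnePoint ℂ × M) : H z :=
  constEquiv hH z (s z.2)

theorem exists_holAlongAt {x : M} (v : AtZero E H x) :
    ∃ σ : Π z, H z, HolAlongAt E F σ x ∧ restrictZero E σ x = v := by
  obtain ⟨r, s, hs⟩ := exists_isAlongFrameAt hH x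
  obtain ⟨c, rfl⟩ := hs.exists_eq_sum v
  exact ⟨_, hs.holAlongAt_sum c, rfl⟩

theorem restrictZero_hat (s : Π x, AtZero E H x) : restrictZero E (hat hH s) = s := by
  funext x
  obtain ⟨σ, hσ, h⟩ := exists_holAlongAt hH (s x)
  rw [restrictZero, hat, constEquiv_apply]
  change constExt E F (((0 : ℂ) : OnePoint ℂ), x) (s x) = s x
  rw [← h]
  exact constExt_restrictZero hH (z := (((0 : ℂ) : OnePoint ℂ), x)) hσ

theorem hat_restrictZero {σ : Π z, H z} {x : M} (hσ : HolAlongAt E F σ x) :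
    ∀ᶠ y in 𝓝 x, ∀ p : OnePoint ℂ, hat hH (restrictZero E σ) (p, y) = σ (p, y) := by
  filter_upwards [eventually_eventually_nhds.2 hσ] with y hy p
  exact constExt_restrictZero hH (z := (p, y)) hy

/-- The coefficients of `s` at `λ = 0` serve for all `λ`; regularity of `hat` in `holAt_hat` and
`diffAt_hat` comes from this. -/
theorem hat_eq_sum {r : ℕ} {t : Fin r → Π z, H z} {x : M}
    (ht : IsAlongFrameAt E F t x) {s : Π x, AtZero E H x} {c : Fin r → M → ℂ}
    (hc : ∀ᶠ y in 𝓝 x, s y = ∑ i, c i y • restrictZero E (t i) y) :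
    ∀ᶠ y in 𝓝 x, ∀ p : OnePoint ℂ, hat hH s (p, y) = ∑ i, c i y • t i (p, y) := by
  filter_upwards [ht.eventually, hc] with y hy hcy p
  rw [hat]
  change constEquiv hH (p, y) (s y) = _
  rw [hcy]
  exact constExt_sum hH (z := (p, y)) hy _

theorem holAt_hat {s : Π x, AtZero E H x} {x : M} (hs : HolAt 𝓘(ℂ, E) F s x) (p : OnePoint ℂ) :
    HolAt (modelP E) F (hat hH s) (p, x) := by
  obtain ⟨r, t, ht⟩ := exists_isAlongFrameAt hH x
  obtain ⟨c, hc⟩ := ht.isFrameAt_restrictZero.exists_coeff s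
  have h := hat_eq_sum hH ht hc
  have hcd := ht.isFrameAt_restrictZero.holAt_coeff hs hc
  refine (HolAt.sum_smul (t := Finset.univ) (c := fun i z => c i z.2)
    (fun i => ContMDiffAt.comp (g := c i) (f := Prod.snd) (p, x) (hcd i) contMDiffAt_snd)
    (ht.self_of_nhds p).1).congr ?_
  filter_upwards [(continuous_snd.tendsto (p, x)).eventually h] with z hz using (hz z.1).symm

theorem diffAt_hat {s : Π x, AtZero E H x} {x : M} (hs : DiffAt 𝓘(ℂ, E) F s x) (p : OnePoint ℂ) :
    DiffAt (modelP E) F (hat hH s) (p, x) := by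
  obtain ⟨r, t, ht⟩ := exists_isAlongFrameAt hH x
  obtain ⟨c, hc⟩ := ht.isFrameAt_restrictZero.exists_coeff s
  have h := hat_eq_sum hH ht hc
  have hcd := ht.isFrameAt_restrictZero.diffAt_coeff hs hc
  refine (DiffAt.sum_smul (t := Finset.univ) (c := fun i z => c i z.2)
    (fun i => MDifferentiableAt.comp (g := c i) (f := Prod.snd) (p, x) (hcd i)
      mdifferentiableAt_snd)
    fun i => ((ht.self_of_nhds p).1 i).diffAt).congr ?_
  filter_upwards [(continuous_snd.tendsto (p, x)).eventually h] with z hz using (hz z.1).symm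

theorem holAlongAt_hat {s : Π x, AtZero E H x} {x : M} (hs : HolAt 𝓘(ℂ, E) F s x) :
    HolAlongAt E F (hat hH s) x := by
  filter_upwards [hs.eventually] with y hy p using holAt_hat hH hy p

omit hH in
/-- The restriction of a section of `H` to `{p} × M`, considered as a section of `H|_{λ = 0}`. -/
def slice (hH : IsTrivialAlong (HolAt (modelP E) F (V := H))) (p : OnePoint ℂ) (σ : Π z, H z)
    (x : M) : AtZero E H x :=
  (constEquiv hH (p, x)).symm (σ (p, x))

theorem slice_eq_sum {r : ℕ} {t : Fin r → Π z, H z} {p : OnePoint ℂ} {x : M}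
    (ht : IsAlongFrameAt E F t x) {σ : Π z, H z} {c : Fin r → OnePoint ℂ × M → ℂ}
    (hc : ∀ᶠ z in 𝓝 (p, x), σ z = ∑ i, c i z • t i z) :
    ∀ᶠ y in 𝓝 x, slice hH p σ y = ∑ i, c i (p, y) • restrictZero E (t i) y := by
  have h : ∀ᶠ y in 𝓝 x, σ (p, y) = ∑ i, c i (p, y) • t i (p, y) :=
    ((Continuous.prodMk_right p).tendsto x).eventually hc
  filter_upwards [ht.eventually, h] with y hy hcy
  rw [slice, LinearEquiv.symm_apply_eq, hcy]
  exact (constExt_sum hH (z := (p, y)) hy _).symm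

theorem holAt_slice {σ : Π z, H z} {p : OnePoint ℂ} {x : M} (hσ : HolAt (modelP E) F σ (p, x)) :
    HolAt 𝓘(ℂ, E) F (slice hH p σ) x := by
  obtain ⟨r, t, ht⟩ := exists_isAlongFrameAt hH x
  obtain ⟨c, hc⟩ := (ht.isFrameAt p).exists_coeff σ
  have hcd := (ht.isFrameAt p).holAt_coeff hσ hc
  refine (HolAt.sum_smul (t := Finset.univ) (c := fun i y => c i (p, y))
    (fun i => (hcd i).comp x (contMDiff_slice p).contMDiffAt)
    (ht.isFrameAt_restrictZero.self_of_nhds.1)).congr ?_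
  filter_upwards [slice_eq_sum hH ht hc] with y hy using hy.symm

theorem diffAt_slice {σ : Π z, H z} {p : OnePoint ℂ} {x : M} (hσ : DiffAt (modelP E) F σ (p, x)) :
    DiffAt 𝓘(ℂ, E) F (slice hH p σ) x := by
  obtain ⟨r, t, ht⟩ := exists_isAlongFrameAt hH x
  obtain ⟨c, hc⟩ := (ht.isFrameAt p).exists_coeff σ
  have hcd := (ht.isFrameAt p).diffAt_coeff hσ hc
  refine (DiffAt.sum_smul (t := Finset.univ) (c := fun i y => c i (p, y))
    (fun i => (hcd i).comp x ((contMDiff_slice (E := E) p).contMDiffAt.mdifferentiableAt (by simp)))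
    fun i => (ht.isFrameAt_restrictZero.self_of_nhds.1 i).diffAt).congr ?_
  filter_upwards [slice_eq_sum hH ht hc] with y hy using hy.symm

theorem slice_hat (p : OnePoint ℂ) (s : Π x, AtZero E H x) : slice hH p (hat hH s) = s := by
  funext x
  exact (constEquiv hH (p, x)).symm_apply_apply _

/-- A section of `H` over `ℂ^* × M` with at most a simple pole at `0` and without pole at `∞`
is of the form `a + λ⁻¹ b`. -/
theorem exists_eq_add_inv_smul {τ : Π z, H z} {x : M}
    (hτ : ∀ μ : ℂ, μ ≠ 0 → HolAt (modelP E) F τ ((μ : OnePoint ℂ), x))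
    (h0 : ExtendsAt E F (fun z => lam z.1 • τ z) (((0 : ℂ) : OnePoint ℂ), x))
    (h1 : ExtendsAt E F τ (OnePoint.infty, x)) :
    ∃ a b : AtZero E H x, ∀ μ : ℂ, μ ≠ 0 →
      τ ((μ : OnePoint ℂ), x) = constEquiv hH ((μ : OnePoint ℂ), x) (a + μ⁻¹ • b) := by
  obtain ⟨r, t, ht⟩ := exists_isAlongFrameAt hH x
  obtain ⟨c, hc⟩ := exists_coeff_of_span t τ
  have hspan : ∀ p, Submodule.span ℂ (range fun i => t i (p, x)) = ⊤ :=
    fun p => (ht.self_of_nhds p).2.2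
  have hcp : ∀ p : OnePoint ℂ, ∀ᶠ z in 𝓝 (p, x), τ z = ∑ i, c i z • t i z := by
    intro p
    filter_upwards [ht.isFrameAt p] with z hz using hc z hz.2.2
  have hli : ∀ z, LinearIndependent ℂ (fun i => t i z) → ∀ c d : Fin r → ℂ,
      ∑ i, c i • t i z = ∑ i, d i • t i z → c = d := by
    intro z hz c d hcd
    exact hz.fintypeLinearCombination_injective
      (by simpa [Fintype.linearCombination_apply] using hcd)
  have hdiff : ∀ i, ∀ μ : ℂ, μ ≠ 0 →
      DifferentiableAt ℂ (fun μ : ℂ => c i ((μ : OnePoint ℂ), x)) μ := by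
    intro i μ hμ
    have h := (ht.isFrameAt (μ : OnePoint ℂ)).holAt_coeff (hτ μ hμ) (hcp _) i
    have h2 := (h.comp (μ : OnePoint ℂ) (contMDiff_slice_snd x).contMDiffAt).comp μ
      contMDiff_coe.contMDiffAt
    exact (h2.mdifferentiableAt (by simp)).differentiableAt
  -- The extension across the polar divisor has continuous coefficients in the frame; their values
  -- at `λ = 0`, and below at `∞`, are the limits required by `eq_add_inv_mul_of_tendsto`.
  have hlim0 : ∃ b : Fin r → ℂ, ∀ i, Tendsto (fun μ : ℂ => μ * c i ((μ : OnePoint ℂ), x))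
      (𝓝[≠] 0) (𝓝 (b i)) := by
    obtain ⟨τ', hτ', he⟩ := h0
    obtain ⟨c', hc'⟩ := (ht.isFrameAt ((0 : ℂ) : OnePoint ℂ)).exists_coeff τ'
    have hcd := (ht.isFrameAt ((0 : ℂ) : OnePoint ℂ)).holAt_coeff hτ' hc'
    have hcont : Tendsto (fun μ : ℂ => ((μ : OnePoint ℂ), x)) (𝓝[≠] 0)
        (𝓝 (((0 : ℂ) : OnePoint ℂ), x)) :=
      ((OnePoint.continuous_coe.prodMk continuous_const).tendsto (0 : ℂ)).mono_left
        nhdsWithin_le_nhds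
    refine ⟨fun i => c' i (((0 : ℂ) : OnePoint ℂ), x), fun i =>
      ((hcd i).continuousAt.tendsto.comp hcont).congr' ?_⟩
    filter_upwards [hcont.eventually he, hcont.eventually hc', self_mem_nhdsWithin]
      with μ h2 h3 hμ
    have h4 := h2 (coe_mem_regularLocus hμ x)
    rw [h3, hc _ (hspan _), Finset.smul_sum] at h4
    simp_rw [smul_smul, lam_coe] at h4
    exact (congrFun (hli _ (ht.self_of_nhds _).2.1 _ _ h4) i).symm
  have hlim1 : ∃ l : Fin r → ℂ, ∀ i, Tendsto (fun μ : ℂ => c i ((μ : OnePoint ℂ), x))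
      (cocompact ℂ) (𝓝 (l i)) := by
    obtain ⟨τ', hτ', he⟩ := h1
    obtain ⟨c', hc'⟩ := (ht.isFrameAt OnePoint.infty).exists_coeff τ'
    have hcd := (ht.isFrameAt OnePoint.infty).holAt_coeff hτ' hc'
    have hcont : Tendsto (fun μ : ℂ => ((μ : OnePoint ℂ), x)) (cocompact ℂ)
        (𝓝 (OnePoint.infty, x)) := tendsto_coe_cocompact.prodMk_nhds tendsto_const_nhds
    have hz : ∀ᶠ z : ℂ in cocompact ℂ, z ≠ 0 :=
      (isCompact_singleton (x := (0 : ℂ))).compl_mem_cocompact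
    refine ⟨fun i => c' i (OnePoint.infty, x), fun i =>
      ((hcd i).continuousAt.tendsto.comp hcont).congr' ?_⟩
    filter_upwards [hcont.eventually he, hcont.eventually hc', hz] with μ h2 h3 hμ
    have h4 := h2 (coe_mem_regularLocus hμ x)
    rw [h3, hc _ (hspan _)] at h4
    exact (congrFun (hli _ (ht.self_of_nhds _).2.1 _ _ h4) i).symm
  obtain ⟨b, hb⟩ := hlim0
  obtain ⟨l, hl⟩ := hlim1
  refine ⟨∑ i, l i • restrictZero E (t i) x, ∑ i, b i • restrictZero E (t i) x, fun μ hμ => ?_⟩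
  rw [Finset.smul_sum, ← Finset.sum_add_distrib]
  simp_rw [smul_smul, ← add_smul]
  rw [hc _ (hspan _)]
  refine Eq.trans ?_ (constExt_sum hH (z := ((μ : OnePoint ℂ), x)) ht _).symm
  refine Finset.sum_congr rfl fun i _ => ?_
  rw [eq_add_inv_mul_of_tendsto (hdiff i) (hb i) (hl i) hμ]

end AlongSphere

/-! ### Instances on tangent spaces -/

section TangentSpace

variable {EB HB : Type*} [NormedAddCommGroup EB] [NormedSpace ℂ EB] [TopologicalSpace HB]
  {I : ModelWithCorners ℂ EB HB} {B : Type*} [TopologicalSpace B] [ChartedSpace HB B]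

instance finiteDimensional_tangentSpace [FiniteDimensional ℂ EB] (x : B) :
    FiniteDimensional ℂ (TangentSpace I x) :=
  inferInstanceAs (FiniteDimensional ℂ EB)

instance t2Space_tangentSpace (x : B) : T2Space (TangentSpace I x) :=
  inferInstanceAs (T2Space EB)

end TangentSpace

/-! ### Restriction of the connection to `λ = μ`; the coefficients `∇ʳ`, `𝒞`, `𝒰`, `𝒱` -/

section Slices

variable {E : Type*} [NormedAddCommGroup E] [NormedSpace ℂ E] [FiniteDimensional ℂ E]
  {M : Type*} [TopologicalSpace M] [ChartedSpace E M] [IsManifold 𝓘(ℂ, E) ω M]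
  {F : Type*} [NormedAddCommGroup F] [NormedSpace ℂ F] [FiniteDimensional ℂ F]
  {H : OnePoint ℂ × M → Type*} [TopologicalSpace (TotalSpace F H)]
  [∀ z, AddCommGroup (H z)] [∀ z, Module ℂ (H z)] [∀ z, TopologicalSpace (H z)]
  [∀ z, IsTopologicalAddGroup (H z)] [∀ z, ContinuousSMul ℂ (H z)]
  [FiberBundle F H] [VectorBundle ℂ F H] [ContMDiffVectorBundle ω F H (modelP E)]

omit [FiniteDimensional ℂ E] in
theorem tangentVec_add (z : OnePoint ℂ × M) (v w : TangentSpace 𝓘(ℂ, E) z.2) :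
    tangentVec z 0 (v + w) = tangentVec z 0 v + tangentVec z 0 w :=
  Prod.ext (add_zero (0 : ℂ)).symm rfl

omit [FiniteDimensional ℂ E] in
theorem tangentVec_smul (z : OnePoint ℂ × M) (c : ℂ) (v : TangentSpace 𝓘(ℂ, E) z.2) :
    tangentVec z 0 (c • v) = c • tangentVec z 0 v :=
  Prod.ext (mul_zero c).symm rfl

section

variable (hH : IsTrivialAlong (HolAt (modelP E) F (V := H)))

omit [FiniteDimensional ℂ E] in
theorem hat_add (s t : Π x, AtZero E H x) : hat hH (s + t) = hat hH s + hat hH t := by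
  funext z
  exact map_add (constEquiv hH z) _ _

omit [FiniteDimensional ℂ E] in
theorem hat_smul (g : M → ℂ) (s : Π x, AtZero E H x) :
    hat hH (g • s) = (fun z : OnePoint ℂ × M => g z.2) • hat hH s := by
  funext z
  exact map_smul (constEquiv hH z) _ _

omit [FiniteDimensional ℂ E] in
theorem diffAt_hat_iff {s : Π x, AtZero E H x} {x : M} (p : OnePoint ℂ) :
    DiffAt (modelP E) F (hat hH s) (p, x) ↔ DiffAt 𝓘(ℂ, E) F s x := by
  refine ⟨fun h => ?_, fun h => diffAt_hat hH h p⟩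
  have := diffAt_slice hH h
  rwa [slice_hat] at this

end

variable {D : (Π z, H z) → Π z, TangentSpace (modelP E) z →L[ℂ] H z}

/-- The connection on `H|_{λ = 0} ≃ H|_{λ = μ}` induced by `D`. -/
def sliceConn (hD : IsTrTLE F D) (μ : ℂ) (s : Π x, AtZero E H x) (x : M) :
    TangentSpace 𝓘(ℂ, E) x →L[ℂ] AtZero E H x :=
  LinearMap.toContinuousLinearMap
    { toFun := fun v => (constEquiv hD.isTrivialAlong ((μ : OnePoint ℂ), x)).symm
        (D (hat hD.isTrivialAlong s) ((μ : OnePoint ℂ), x) (tangentVec ((μ : OnePoint ℂ), x) 0 v))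
      map_add' := fun v w => by
        rw [tangentVec_add ((μ : OnePoint ℂ), x) v w, map_add, map_add]
      map_smul' := fun c v => by
        rw [tangentVec_smul ((μ : OnePoint ℂ), x) c v, map_smul, map_smul, RingHom.id_apply] }

/-- The operator on `H|_{λ = 0} ≃ H|_{λ = μ}` induced by the covariant derivative along `λ ∂_λ`. -/
def sliceEnd (hD : IsTrTLE F D) (μ : ℂ) (s : Π x, AtZero E H x) (x : M) : AtZero E H x :=
  (constEquiv hD.isTrivialAlong ((μ : OnePoint ℂ), x)).symm
    (D (hat hD.isTrivialAlong s) ((μ : OnePoint ℂ), x) (tangentVec ((μ : OnePoint ℂ), x) μ 0))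

variable (hD : IsTrTLE F D)

theorem constEquiv_sliceConn (μ : ℂ) (s : Π x, AtZero E H x) (x : M)
    (v : TangentSpace 𝓘(ℂ, E) x) :
    constEquiv hD.isTrivialAlong ((μ : OnePoint ℂ), x) (sliceConn hD μ s x v) =
      D (hat hD.isTrivialAlong s) ((μ : OnePoint ℂ), x) (tangentVec ((μ : OnePoint ℂ), x) 0 v) :=
  (constEquiv hD.isTrivialAlong ((μ : OnePoint ℂ), x)).apply_symm_apply _

theorem constEquiv_sliceEnd (μ : ℂ) (s : Π x, AtZero E H x) (x : M) :
    constEquiv hD.isTrivialAlong ((μ : OnePoint ℂ), x) (sliceEnd hD μ s x) =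
      D (hat hD.isTrivialAlong s) ((μ : OnePoint ℂ), x) (tangentVec ((μ : OnePoint ℂ), x) μ 0) :=
  (constEquiv hD.isTrivialAlong ((μ : OnePoint ℂ), x)).apply_symm_apply _

theorem sliceConn_covariant (hD : IsTrTLE F D) {μ : ℂ} (hμ : μ ≠ 0) :
    IsCovariantDerivativeOn (I := 𝓘(ℂ, E)) (V := AtZero E H) F (sliceConn hD μ) univ where
  add {s t x} hs ht _ := by
    ext v
    apply (constEquiv hD.isTrivialAlong ((μ : OnePoint ℂ), x)).injective
    rw [add_apply, map_add, constEquiv_sliceConn, constEquiv_sliceConn,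
      constEquiv_sliceConn, hat_add, hD.isHolConnection.covariant.add
        (diffAt_hat _ hs _) (diffAt_hat _ ht _) (coe_mem_regularLocus hμ x)]
    rfl
  leibniz {s g x} hs hg _ := by
    ext v
    apply (constEquiv hD.isTrivialAlong ((μ : OnePoint ℂ), x)).injective
    have hg' : MDifferentiableAt (modelP E) 𝓘(ℂ, ℂ) (fun z : OnePoint ℂ × M => g z.2)
        ((μ : OnePoint ℂ), x) :=
      MDifferentiableAt.comp (g := g) (f := Prod.snd) ((μ : OnePoint ℂ), x) hg
        mdifferentiableAt_snd
    have h1 : (g x • sliceConn hD μ s x + (mvfderiv 𝓘(ℂ, E) g x).smulRight (s x)) v =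
      g x • sliceConn hD μ s x v + mvfderiv 𝓘(ℂ, E) g x v • s x := rfl
    rw [h1, map_add, map_smul, map_smul, constEquiv_sliceConn, constEquiv_sliceConn,
      hat_smul, hD.isHolConnection.covariant.leibniz
        (diffAt_hat _ hs _) hg' (coe_mem_regularLocus hμ x)]
    have h2 := mvfderiv_comp_snd (z := ((μ : OnePoint ℂ), x)) hg
      (tangentVec ((μ : OnePoint ℂ), x) 0 v)
    exact congrArg (fun c => g x • D (hat hD.isTrivialAlong s) ((μ : OnePoint ℂ), x)
      (tangentVec ((μ : OnePoint ℂ), x) 0 v) + c • hat hD.isTrivialAlong s ((μ : OnePoint ℂ), x)) h2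

theorem sliceConn_holomorphic {μ : ℂ} (hμ : μ ≠ 0) {s : Π x, AtZero E H x}
    {X : Π x : M, TangentSpace 𝓘(ℂ, E) x} {x : M} (hs : HolAt 𝓘(ℂ, E) F s x)
    (hX : HolAt 𝓘(ℂ, E) E X x) : HolAt 𝓘(ℂ, E) F (fun y => sliceConn hD μ s y (X y)) x :=
  holAt_slice hD.isTrivialAlong (p := (μ : OnePoint ℂ))
    (hD.isHolConnection.holomorphic _ (liftField X) _ (coe_mem_regularLocus hμ x)
      (holAt_hat _ hs _) (holAt_liftField (z := ((μ : OnePoint ℂ), x)) hX))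

theorem sliceEnd_holomorphic {μ : ℂ} (hμ : μ ≠ 0) {s : Π x, AtZero E H x} {x : M}
    (hs : HolAt 𝓘(ℂ, E) F s x) : HolAt 𝓘(ℂ, E) F (sliceEnd hD μ s) x :=
  holAt_slice hD.isTrivialAlong (p := (μ : OnePoint ℂ))
    (hD.isHolConnection.holomorphic _ (lamField E M) _ (coe_mem_regularLocus hμ x)
      (holAt_hat _ hs _) (holAt_lamField (z := ((μ : OnePoint ℂ), x)) (by simp)))

theorem sliceConn_normalized {μ : ℂ} {s : Π x, AtZero E H x} {x : M}
    (hs : ¬ DiffAt 𝓘(ℂ, E) F s x) : sliceConn hD μ s x = 0 := by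
  ext v
  apply (constEquiv hD.isTrivialAlong ((μ : OnePoint ℂ), x)).injective
  rw [constEquiv_sliceConn, hD.isHolConnection.normalized _ _ fun h =>
    hs ((diffAt_hat_iff hD.isTrivialAlong _).1 h.2)]
  exact (map_zero _).symm

/-- The derivation `λ ∂_λ` kills functions pulled back from `M`, so the Leibniz term vanishes. -/
theorem sliceEnd_tensorialAt {μ : ℂ} (hμ : μ ≠ 0) (x : M) :
    TensorialAt 𝓘(ℂ, E) F (fun s : Π x, AtZero E H x => sliceEnd hD μ s x) x where
  smul {g s} hg hs := by
    apply (constEquiv hD.isTrivialAlong ((μ : OnePoint ℂ), x)).injective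
    have hg' : MDifferentiableAt (modelP E) 𝓘(ℂ, ℂ) (fun z : OnePoint ℂ × M => g z.2)
        ((μ : OnePoint ℂ), x) :=
      MDifferentiableAt.comp (g := g) (f := Prod.snd) ((μ : OnePoint ℂ), x) hg
        mdifferentiableAt_snd
    rw [map_smul, constEquiv_sliceEnd, constEquiv_sliceEnd, hat_smul,
      hD.isHolConnection.covariant.leibniz (diffAt_hat _ hs _) hg' (coe_mem_regularLocus hμ x)]
    have h2 := (mvfderiv_comp_snd (z := ((μ : OnePoint ℂ), x)) hg
      (tangentVec ((μ : OnePoint ℂ), x) μ 0)).trans (map_zero _)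
    refine (congrArg₂ (· + ·) rfl (congrArg (· • hat hD.isTrivialAlong s ((μ : OnePoint ℂ), x))
      h2)).trans ?_
    exact (congrArg₂ (· + ·) rfl (zero_smul ℂ _)).trans (add_zero _)
  add {s t} hs ht := by
    apply (constEquiv hD.isTrivialAlong ((μ : OnePoint ℂ), x)).injective
    rw [map_add, constEquiv_sliceEnd, constEquiv_sliceEnd,
      constEquiv_sliceEnd, hat_add, hD.isHolConnection.covariant.add
        (diffAt_hat _ hs _) (diffAt_hat _ ht _) (coe_mem_regularLocus hμ x)]
    rfl

/-- The pole conditions feed `exists_eq_add_inv_smul`. They concern vector fields, so `v` is first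
extended to a local holomorphic field. -/
theorem exists_sliceConn_eq {s : Π x, AtZero E H x} {x : M} (hs : HolAt 𝓘(ℂ, E) F s x)
    (v : TangentSpace 𝓘(ℂ, E) x) : ∃ a b : AtZero E H x, ∀ μ : ℂ, μ ≠ 0 →
      sliceConn hD μ s x v = a + μ⁻¹ • b := by
  have hX : HolAt 𝓘(ℂ, E) E (FiberBundle.extend E v) x := holAt_extend v
  have hv : (FiberBundle.extend E v : Π x : M, TangentSpace 𝓘(ℂ, E) x) x = v :=
    FiberBundle.extend_apply_self E v
  obtain ⟨a, b, h⟩ := exists_eq_add_inv_smul hD.isTrivialAlong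
    (τ := fun z => D (hat hD.isTrivialAlong s) z (liftField (FiberBundle.extend E v) z)) (x := x)
    (fun μ hμ => hD.isHolConnection.holomorphic _ (liftField _) _ (coe_mem_regularLocus hμ x)
      (holAt_hat _ hs _) (holAt_liftField (z := ((μ : OnePoint ℂ), x)) hX))
    (hD.pole_zero _ _ x (holAt_hat _ hs _) hX).1 (hD.pole_infty _ _ x (holAt_hat _ hs _) hX).1
  refine ⟨a, b, fun μ hμ => ?_⟩
  apply (constEquiv hD.isTrivialAlong ((μ : OnePoint ℂ), x)).injective
  rw [constEquiv_sliceConn]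
  refine Eq.trans ?_ (h μ hμ)
  exact congrArg (fun w => D (hat hD.isTrivialAlong s) ((μ : OnePoint ℂ), x)
    (tangentVec ((μ : OnePoint ℂ), x) 0 w)) hv.symm

theorem exists_sliceEnd_eq {s : Π x, AtZero E H x} {x : M} (hs : HolAt 𝓘(ℂ, E) F s x) :
    ∃ a b : AtZero E H x, ∀ μ : ℂ, μ ≠ 0 → sliceEnd hD μ s x = a + μ⁻¹ • b := by
  have hX : HolAt 𝓘(ℂ, E) E (fun _ => 0 : Π x : M, TangentSpace 𝓘(ℂ, E) x) x :=
    Bundle.contMDiff_zeroSection ℂ _ x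
  obtain ⟨a, b, h⟩ := exists_eq_add_inv_smul hD.isTrivialAlong
    (τ := fun z => D (hat hD.isTrivialAlong s) z (lamField E M z)) (x := x)
    (fun μ hμ => hD.isHolConnection.holomorphic _ (lamField E M) _ (coe_mem_regularLocus hμ x)
      (holAt_hat _ hs _) (holAt_lamField (z := ((μ : OnePoint ℂ), x)) (by simp)))
    (hD.pole_zero _ _ x (holAt_hat _ hs _) hX).2 (hD.pole_infty _ _ x (holAt_hat _ hs _) hX).2
  refine ⟨a, b, fun μ hμ => ?_⟩
  apply (constEquiv hD.isTrivialAlong ((μ : OnePoint ℂ), x)).injective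
  rw [constEquiv_sliceEnd]
  exact h μ hμ

/-- The connection `∇ʳ`. -/
def residualConn (s : Π x, AtZero E H x) (x : M) : TangentSpace 𝓘(ℂ, E) x →L[ℂ] AtZero E H x :=
  -- For `a + μ⁻¹ b` the half sum of the values at `μ = ±1` is `a` and the half difference is `b`;
  -- the other coefficients are extracted likewise.
  (2⁻¹ : ℂ) • (sliceConn hD 1 s x + sliceConn hD (-1) s x)

/-- The Higgs field `𝒞`. -/
def residualHiggs (x : M) : TangentSpace 𝓘(ℂ, E) x →ₗ[ℂ] AtZero E H x →ₗ[ℂ] AtZero E H x :=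
  haveI : ContMDiffVectorBundle 1 F (AtZero E H) 𝓘(ℂ, E) := .of_le (n := ω) (by simp)
  -- The difference of two covariant derivatives is tensorial; it takes the section before the
  -- tangent vector, hence the flip.
  LinearMap.flip
    ((2⁻¹ : ℂ) • (ContinuousLinearMap.coeLM ℂ).comp
      ((sliceConn_covariant hD one_ne_zero).difference
        (sliceConn_covariant hD (neg_ne_zero.2 one_ne_zero)) x).toLinearMap)

theorem residualHiggs_apply {s : Π x, AtZero E H x} {x : M} (hs : DiffAt 𝓘(ℂ, E) F s x)
    (v : TangentSpace 𝓘(ℂ, E) x) : residualHiggs hD x v (s x) =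
      (2⁻¹ : ℂ) • (sliceConn hD 1 s x v - sliceConn hD (-1) s x v) := by
  have : ContMDiffVectorBundle 1 F (AtZero E H) 𝓘(ℂ, E) := .of_le (n := ω) (by simp)
  have h := (sliceConn_covariant hD one_ne_zero).difference_apply
    (sliceConn_covariant hD (neg_ne_zero.2 one_ne_zero)) (mem_univ x) hs
  exact congrArg (fun L : TangentSpace 𝓘(ℂ, E) x →L[ℂ] AtZero E H x => (2⁻¹ : ℂ) • L v) h

/-- The value at `s x` of the tensorial operator `sliceEnd`. -/
def sliceHom {μ : ℂ} (hμ : μ ≠ 0) (x : M) : AtZero E H x →ₗ[ℂ] AtZero E H x :=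
  haveI : ContMDiffVectorBundle 1 F (AtZero E H) 𝓘(ℂ, E) := .of_le (n := ω) (by simp)
  (TensorialAt.mkHom _ x (sliceEnd_tensorialAt hD hμ x)).toLinearMap

theorem sliceHom_apply {μ : ℂ} (hμ : μ ≠ 0) {s : Π x, AtZero E H x} {x : M}
    (hs : DiffAt 𝓘(ℂ, E) F s x) : sliceHom hD hμ x (s x) = sliceEnd hD μ s x := by
  have : ContMDiffVectorBundle 1 F (AtZero E H) 𝓘(ℂ, E) := .of_le (n := ω) (by simp)
  exact TensorialAt.mkHom_apply (sliceEnd_tensorialAt hD hμ x) hs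

/-- The endomorphism `𝒰`. -/
def residualU (x : M) : AtZero E H x →ₗ[ℂ] AtZero E H x :=
  (2⁻¹ : ℂ) • (sliceHom hD one_ne_zero x - sliceHom hD (neg_ne_zero.2 one_ne_zero) x)

/-- The endomorphism `𝒱`. -/
def residualV (x : M) : AtZero E H x →ₗ[ℂ] AtZero E H x :=
  -- The sign is that of `-p^*𝒱` in the associated connection.
  -((2⁻¹ : ℂ) • (sliceHom hD one_ne_zero x + sliceHom hD (neg_ne_zero.2 one_ne_zero) x))

/-- A decomposition `a + μ⁻¹ b` valid for all `μ ≠ 0` exists, and its values at `μ = ±1` identify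
the coefficients. -/
theorem sliceConn_eq {s : Π x, AtZero E H x} {x : M} (hs : HolAt 𝓘(ℂ, E) F s x)
    (v : TangentSpace 𝓘(ℂ, E) x) {μ : ℂ} (hμ : μ ≠ 0) :
    sliceConn hD μ s x v = residualConn hD s x v + μ⁻¹ • residualHiggs hD x v (s x) := by
  obtain ⟨a, b, h⟩ := exists_sliceConn_eq hD hs v
  rw [residualHiggs_apply hD hs.diffAt]
  have h1 : residualConn hD s x v = (2⁻¹ : ℂ) • (sliceConn hD 1 s x v + sliceConn hD (-1) s x v) :=
    rfl
  rw [h1, h μ hμ, h 1 one_ne_zero, h (-1) (neg_ne_zero.2 one_ne_zero)]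
  simp only [inv_one, inv_neg]
  module

theorem sliceEnd_eq {s : Π x, AtZero E H x} {x : M} (hs : HolAt 𝓘(ℂ, E) F s x)
    {μ : ℂ} (hμ : μ ≠ 0) :
    sliceEnd hD μ s x = μ⁻¹ • residualU hD x (s x) - residualV hD x (s x) := by
  obtain ⟨a, b, h⟩ := exists_sliceEnd_eq hD hs
  have h1 : residualU hD x (s x) = (2⁻¹ : ℂ) • (sliceHom hD one_ne_zero x (s x) -
    sliceHom hD (neg_ne_zero.2 one_ne_zero) x (s x)) := rfl
  have h2 : residualV hD x (s x) = -((2⁻¹ : ℂ) • (sliceHom hD one_ne_zero x (s x) +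
    sliceHom hD (neg_ne_zero.2 one_ne_zero) x (s x))) := rfl
  rw [h1, h2, sliceHom_apply hD _ hs.diffAt, sliceHom_apply hD _ hs.diffAt, h μ hμ,
    h 1 one_ne_zero, h (-1) (neg_ne_zero.2 one_ne_zero)]
  simp only [inv_one, inv_neg]
  module

end Slices

/-! ### Flatness as a Frobenius type structure; existence and uniqueness of the associated one -/

section Residual

variable {E : Type*} [NormedAddCommGroup E] [NormedSpace ℂ E] [FiniteDimensional ℂ E]
  {M : Type*} [TopologicalSpace M] [ChartedSpace E M] [IsManifold 𝓘(ℂ, E) ω M]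
  {F : Type*} [NormedAddCommGroup F] [NormedSpace ℂ F] [FiniteDimensional ℂ F]
  {H : OnePoint ℂ × M → Type*} [TopologicalSpace (TotalSpace F H)]
  [∀ z, AddCommGroup (H z)] [∀ z, Module ℂ (H z)] [∀ z, TopologicalSpace (H z)]
  [∀ z, IsTopologicalAddGroup (H z)] [∀ z, ContinuousSMul ℂ (H z)]
  [FiberBundle F H] [VectorBundle ℂ F H] [ContMDiffVectorBundle ω F H (modelP E)]
  {D : (Π z, H z) → Π z, TangentSpace (modelP E) z →L[ℂ] H z} (hD : IsTrTLE F D)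

theorem residualConn_holomorphic {s : Π x, AtZero E H x}
    {X : Π x : M, TangentSpace 𝓘(ℂ, E) x} {x : M} (hs : HolAt 𝓘(ℂ, E) F s x)
    (hX : HolAt 𝓘(ℂ, E) E X x) : HolAt 𝓘(ℂ, E) F (fun y => residualConn hD s y (X y)) x :=
  ((sliceConn_holomorphic hD one_ne_zero hs hX).add
    (sliceConn_holomorphic hD (neg_ne_zero.2 one_ne_zero) hs hX)).const_smul (2⁻¹ : ℂ)

theorem residualHiggs_holomorphic {s : Π x, AtZero E H x}
    {X : Π x : M, TangentSpace 𝓘(ℂ, E) x} {x : M} (hs : HolAt 𝓘(ℂ, E) F s x)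
    (hX : HolAt 𝓘(ℂ, E) E X x) : HolAt 𝓘(ℂ, E) F (fun y => residualHiggs hD y (X y) (s y)) x := by
  refine (((sliceConn_holomorphic hD one_ne_zero hs hX).sub
    (sliceConn_holomorphic hD (neg_ne_zero.2 one_ne_zero) hs hX)).const_smul (2⁻¹ : ℂ)).congr ?_
  filter_upwards [hs.eventually] with y hy using (residualHiggs_apply hD hy.diffAt (X y)).symm

theorem residualU_holomorphic {s : Π x, AtZero E H x} {x : M} (hs : HolAt 𝓘(ℂ, E) F s x) :
    HolAt 𝓘(ℂ, E) F (fun y => residualU hD y (s y)) x := by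
  refine (((sliceEnd_holomorphic hD one_ne_zero hs).sub
    (sliceEnd_holomorphic hD (neg_ne_zero.2 one_ne_zero) hs)).const_smul (2⁻¹ : ℂ)).congr ?_
  filter_upwards [hs.eventually] with y hy
  rw [← sliceHom_apply hD one_ne_zero hy.diffAt,
    ← sliceHom_apply hD (neg_ne_zero.2 one_ne_zero) hy.diffAt]
  rfl

theorem residualV_holomorphic {s : Π x, AtZero E H x} {x : M} (hs : HolAt 𝓘(ℂ, E) F s x) :
    HolAt 𝓘(ℂ, E) F (fun y => residualV hD y (s y)) x := by
  refine (((sliceEnd_holomorphic hD one_ne_zero hs).add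
    (sliceEnd_holomorphic hD (neg_ne_zero.2 one_ne_zero) hs)).const_smul (2⁻¹ : ℂ)).neg.congr ?_
  filter_upwards [hs.eventually] with y hy
  rw [← sliceHom_apply hD one_ne_zero hy.diffAt,
    ← sliceHom_apply hD (neg_ne_zero.2 one_ne_zero) hy.diffAt]
  rfl

theorem residualConn_isHolConnection :
    IsHolConnection 𝓘(ℂ, E) F (V := AtZero E H) univ (residualConn hD) where
  covariant := by
    have h1 := sliceConn_covariant hD one_ne_zero
    have h2 := sliceConn_covariant hD (neg_ne_zero.2 one_ne_zero)
    constructor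
    · intro s t x hs ht hx
      have e : ∀ s : Π x, AtZero E H x, residualConn hD s x =
        (2⁻¹ : ℂ) • (sliceConn hD 1 s x + sliceConn hD (-1) s x) := fun _ => rfl
      rw [e, e, e, h1.add hs ht hx, h2.add hs ht hx]
      module
    · intro s g x hs hg hx
      have e : ∀ s : Π x, AtZero E H x, residualConn hD s x =
        (2⁻¹ : ℂ) • (sliceConn hD 1 s x + sliceConn hD (-1) s x) := fun _ => rfl
      rw [e, e, h1.leibniz hs hg hx, h2.leibniz hs hg hx]
      module
  holomorphic s X x _ hs hX := residualConn_holomorphic hD hs hX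
  normalized s x h := by
    have hs : ¬ DiffAt 𝓘(ℂ, E) F s x := fun h' => h ⟨mem_univ x, h'⟩
    rw [residualConn, sliceConn_normalized hD hs, sliceConn_normalized hD hs, add_zero]
    exact smul_zero _

/-- The covariant derivative of a section of the form `a + λ⁻¹ b`. -/
theorem conn_add_inv_smul {a b : Π x, AtZero E H x} {x : M} (ha : HolAt 𝓘(ℂ, E) F a x)
    (hb : HolAt 𝓘(ℂ, E) F b x) {μ : ℂ} (hμ : μ ≠ 0) {τ : Π z, H z}
    (hτ : HolAt (modelP E) F τ ((μ : OnePoint ℂ), x))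
    (h : ∀ᶠ y in 𝓝 x, ∀ ν : ℂ, ν ≠ 0 → τ ((ν : OnePoint ℂ), y) =
      constEquiv hD.isTrivialAlong ((ν : OnePoint ℂ), y) (a y + ν⁻¹ • b y))
    (w : TangentSpace (modelP E) (((μ : OnePoint ℂ), x) : OnePoint ℂ × M)) :
    D τ ((μ : OnePoint ℂ), x) w = D (hat hD.isTrivialAlong a) ((μ : OnePoint ℂ), x) w +
      μ⁻¹ • D (hat hD.isTrivialAlong b) ((μ : OnePoint ℂ), x) w -
      (μ⁻¹ ^ 2 * w.1) • constEquiv hD.isTrivialAlong ((μ : OnePoint ℂ), x) (b x) := by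
  have hz : ((μ : OnePoint ℂ), x) ∈ regularLocus M := coe_mem_regularLocus hμ x
  have hreg : regularLocus M ∈ 𝓝 ((μ : OnePoint ℂ), x) := isOpen_regularLocus.mem_nhds hz
  let g : OnePoint ℂ × M → ℂ := fun z => (lam z.1)⁻¹
  have hlam : ContMDiffAt (modelP E) 𝓘(ℂ, ℂ) ω (fun w : OnePoint ℂ × M => lam w.1)
    ((μ : OnePoint ℂ), x) := contMDiffAt_lam_fst hz.2
  have hinv : HasDerivAt (fun t : ℂ => t⁻¹) (-(μ ^ 2)⁻¹) μ := hasDerivAt_inv hμ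
  have hg : MDifferentiableAt (modelP E) 𝓘(ℂ, ℂ) g ((μ : OnePoint ℂ), x) :=
    MDifferentiableAt.comp (I' := 𝓘(ℂ, ℂ)) (g := fun t : ℂ => t⁻¹) _
      (by rw [lam_coe]; exact hinv.differentiableAt.mdifferentiableAt)
      (hlam.mdifferentiableAt (by simp))
  -- Along `λ ∂_λ` this derivative of `λ⁻¹` contributes `-μ⁻¹ b`, the origin of the isolated term
  -- `𝒞` in `∇ʳ(𝒰) - [𝒞, 𝒱] + 𝒞 = 0`.
  have hdg : mvfderiv (modelP E) g ((μ : OnePoint ℂ), x) w = -(μ⁻¹ ^ 2 * w.1) := by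
    have h1 := mfderiv_comp_apply (I := modelP E) (I' := 𝓘(ℂ, ℂ)) (I'' := 𝓘(ℂ, ℂ))
      (g := fun t : ℂ => t⁻¹) (f := fun w : OnePoint ℂ × M => lam w.1) ((μ : OnePoint ℂ), x)
      (by rw [lam_coe]; exact hinv.differentiableAt.mdifferentiableAt)
      (hlam.mdifferentiableAt (by simp)) w
    have h2 := mvfderiv_lam_fst (E := E) hz.2 w
    refine h1.trans ?_
    rw [mfderiv_eq_fderiv]
    refine (congrArg (fun t => fderiv ℂ (fun t : ℂ => t⁻¹) (lam (μ : OnePoint ℂ)) t) h2).trans ?_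
    rw [lam_coe, hinv.hasFDerivAt.fderiv]
    simp
    ring
  have hA := diffAt_hat hD.isTrivialAlong ha.diffAt (μ : OnePoint ℂ)
  have hB := diffAt_hat hD.isTrivialAlong hb.diffAt (μ : OnePoint ℂ)
  have hgB : DiffAt (modelP E) F (g • hat hD.isTrivialAlong b) ((μ : OnePoint ℂ), x) :=
    hg.smul_section hB
  have e : ∀ᶠ z in 𝓝 ((μ : OnePoint ℂ), x),
      τ z = (hat hD.isTrivialAlong a + g • hat hD.isTrivialAlong b) z := by
    filter_upwards [hreg, (continuous_snd.tendsto ((μ : OnePoint ℂ), x)).eventually h]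
    rintro ⟨p, y⟩ hp hy
    obtain ⟨ν, rfl⟩ := OnePoint.ne_infty_iff_exists.1 hp.2
    have hν : ν ≠ 0 := by simpa [lam_coe] using lam_ne_zero hp
    refine (hy ν hν).trans ?_
    rw [map_add, map_smul]
    rfl
  have hc := hD.isHolConnection.covariant
  rw [hc.congr_of_eventuallyEq hτ.diffAt (mdifferentiableAt_add_section hA hgB) hreg e,
    hc.add hA hgB hz, hc.leibniz hB hg hz]
  have : (D (hat hD.isTrivialAlong a) ((μ : OnePoint ℂ), x) +
      (g ((μ : OnePoint ℂ), x) • D (hat hD.isTrivialAlong b) ((μ : OnePoint ℂ), x) +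
      (mvfderiv (modelP E) g ((μ : OnePoint ℂ), x)).smulRight
        (hat hD.isTrivialAlong b ((μ : OnePoint ℂ), x)))) w =
      D (hat hD.isTrivialAlong a) ((μ : OnePoint ℂ), x) w +
      (μ⁻¹ • D (hat hD.isTrivialAlong b) ((μ : OnePoint ℂ), x) w +
        mvfderiv (modelP E) g ((μ : OnePoint ℂ), x) w •
          constEquiv hD.isTrivialAlong ((μ : OnePoint ℂ), x) (b x)) := rfl
  rw [this, hdg]
  module

/-- Meant for iterated derivatives: a first derivative of a constant section is of the form `a + λ⁻¹
b`, and the second becomes a quadratic polynomial in `μ⁻¹`. -/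
theorem sliceConn_add_inv_smul {a b : Π x, AtZero E H x} {x : M} (ha : HolAt 𝓘(ℂ, E) F a x)
    (hb : HolAt 𝓘(ℂ, E) F b x) {μ : ℂ} (hμ : μ ≠ 0) {τ : Π z, H z}
    (hτ : HolAt (modelP E) F τ ((μ : OnePoint ℂ), x))
    (h : ∀ᶠ y in 𝓝 x, ∀ ν : ℂ, ν ≠ 0 → τ ((ν : OnePoint ℂ), y) =
      constEquiv hD.isTrivialAlong ((ν : OnePoint ℂ), y) (a y + ν⁻¹ • b y))
    (v : TangentSpace 𝓘(ℂ, E) x) :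
    D τ ((μ : OnePoint ℂ), x) (tangentVec ((μ : OnePoint ℂ), x) 0 v) =
      constEquiv hD.isTrivialAlong ((μ : OnePoint ℂ), x)
        (residualConn hD a x v + μ⁻¹ • (residualHiggs hD x v (a x) + residualConn hD b x v) +
          μ⁻¹ ^ 2 • residualHiggs hD x v (b x)) := by
  rw [conn_add_inv_smul hD ha hb hμ hτ h, ← constEquiv_sliceConn hD, ← constEquiv_sliceConn hD,
    sliceConn_eq hD ha v hμ, sliceConn_eq hD hb v hμ]
  have h0 : (tangentVec ((μ : OnePoint ℂ), x) 0 v : TangentSpace (modelP E)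
    (((μ : OnePoint ℂ), x) : OnePoint ℂ × M)).1 = (0 : ℂ) := rfl
  rw [h0, mul_zero, zero_smul, sub_zero]
  simp only [map_add, map_smul]
  module

theorem sliceEnd_add_inv_smul {a b : Π x, AtZero E H x} {x : M} (ha : HolAt 𝓘(ℂ, E) F a x)
    (hb : HolAt 𝓘(ℂ, E) F b x) {μ : ℂ} (hμ : μ ≠ 0) {τ : Π z, H z}
    (hτ : HolAt (modelP E) F τ ((μ : OnePoint ℂ), x))
    (h : ∀ᶠ y in 𝓝 x, ∀ ν : ℂ, ν ≠ 0 → τ ((ν : OnePoint ℂ), y) =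
      constEquiv hD.isTrivialAlong ((ν : OnePoint ℂ), y) (a y + ν⁻¹ • b y)) :
    D τ ((μ : OnePoint ℂ), x) (tangentVec ((μ : OnePoint ℂ), x) μ 0) =
      constEquiv hD.isTrivialAlong ((μ : OnePoint ℂ), x)
        (-residualV hD x (a x) + μ⁻¹ • (residualU hD x (a x) - residualV hD x (b x) - b x) +
          μ⁻¹ ^ 2 • residualU hD x (b x)) := by
  rw [conn_add_inv_smul hD ha hb hμ hτ h, ← constEquiv_sliceEnd hD, ← constEquiv_sliceEnd hD,
    sliceEnd_eq hD ha hμ, sliceEnd_eq hD hb hμ]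
  have h0 : (tangentVec ((μ : OnePoint ℂ), x) μ 0 : TangentSpace (modelP E)
    (((μ : OnePoint ℂ), x) : OnePoint ℂ × M)).1 = μ := rfl
  have : μ⁻¹ ^ 2 * μ = μ⁻¹ := by field_simp
  rw [h0, this]
  simp only [map_add, map_sub, map_neg, map_smul]
  module

/-- The values `μ⁻¹ = 1, -1, 2` determine a quadratic polynomial; the rational factors invert the
corresponding Vandermonde matrix. -/
theorem eq_zero_of_polynomial {V : Type*} [AddCommGroup V] [Module ℂ V] {a b c : V}
    (h : ∀ μ : ℂ, μ ≠ 0 → a + μ⁻¹ • b + μ⁻¹ ^ 2 • c = 0) : a = 0 ∧ b = 0 ∧ c = 0 := by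
  have h1 := h 1 one_ne_zero
  have h2 := h (-1) (neg_ne_zero.2 one_ne_zero)
  have h3 := h (2⁻¹) (by norm_num)
  simp only [inv_one, inv_neg, inv_inv] at h1 h2 h3
  refine ⟨?_, ?_, ?_⟩
  · linear_combination (norm := module) (1 : ℂ) • h1 + (1 / 3 : ℂ) • h2 - (1 / 3 : ℂ) • h3
  · linear_combination (norm := module) (1 / 2 : ℂ) • h1 - (1 / 2 : ℂ) • h2
  · linear_combination (norm := module) (-1 / 2 : ℂ) • h1 + (1 / 6 : ℂ) • h2 + (1 / 3 : ℂ) • h3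

/-- The curvature of `D` on the lifts of `X` and `Y` is quadratic in `μ⁻¹`; the coefficients of `1`,
`μ⁻¹`, `μ⁻²` are the three expressions. -/
theorem flat_tangential {s : Π x, AtZero E H x} {X Y : Π x : M, TangentSpace 𝓘(ℂ, E) x} {x : M}
    (hs : HolAt 𝓘(ℂ, E) F s x) (hX : HolAt 𝓘(ℂ, E) E X x) (hY : HolAt 𝓘(ℂ, E) E Y x) :
    (residualConn hD (fun y => residualConn hD s y (Y y)) x (X x) -
        residualConn hD (fun y => residualConn hD s y (X y)) x (Y x) -
        residualConn hD s x (VectorField.mlieBracket 𝓘(ℂ, E) X Y x) = 0) ∧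
    ((residualConn hD (fun y => residualHiggs hD y (Y y) (s y)) x (X x) -
        residualHiggs hD x (Y x) (residualConn hD s x (X x))) -
      (residualConn hD (fun y => residualHiggs hD y (X y) (s y)) x (Y x) -
        residualHiggs hD x (X x) (residualConn hD s x (Y x))) -
        residualHiggs hD x (VectorField.mlieBracket 𝓘(ℂ, E) X Y x) (s x) = 0) ∧
    residualHiggs hD x (X x) (residualHiggs hD x (Y x) (s x)) -
      residualHiggs hD x (Y x) (residualHiggs hD x (X x) (s x)) = 0 := by
  have key : ∀ (Z : Π x : M, TangentSpace 𝓘(ℂ, E) x), HolAt 𝓘(ℂ, E) E Z x → ∀ μ : ℂ, μ ≠ 0 →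
      ∀ v : TangentSpace 𝓘(ℂ, E) x,
      D (fun z => D (hat hD.isTrivialAlong s) z (liftField Z z)) ((μ : OnePoint ℂ), x)
        (tangentVec ((μ : OnePoint ℂ), x) 0 v) =
      constEquiv hD.isTrivialAlong ((μ : OnePoint ℂ), x)
        (residualConn hD (fun y => residualConn hD s y (Z y)) x v +
          μ⁻¹ • (residualHiggs hD x v (residualConn hD s x (Z x)) +
            residualConn hD (fun y => residualHiggs hD y (Z y) (s y)) x v) +
          μ⁻¹ ^ 2 • residualHiggs hD x v (residualHiggs hD x (Z x) (s x))) := by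
    intro Z hZ μ hμ v
    refine sliceConn_add_inv_smul hD (residualConn_holomorphic hD hs hZ)
      (residualHiggs_holomorphic hD hs hZ) hμ
      (hD.isHolConnection.holomorphic _ (liftField Z) _ (coe_mem_regularLocus hμ x)
        (holAt_hat _ hs _) (holAt_liftField (z := ((μ : OnePoint ℂ), x)) hZ)) ?_ v
    filter_upwards [hs.eventually] with y hy ν hν
    rw [← sliceConn_eq hD hy (Z y) hν, constEquiv_sliceConn]
    rfl
  have main := eq_zero_of_polynomial (a := residualConn hD (fun y => residualConn hD s y (Y y)) x (X x) -
        residualConn hD (fun y => residualConn hD s y (X y)) x (Y x) -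
        residualConn hD s x (VectorField.mlieBracket 𝓘(ℂ, E) X Y x))
    (b := (residualConn hD (fun y => residualHiggs hD y (Y y) (s y)) x (X x) -
        residualHiggs hD x (Y x) (residualConn hD s x (X x))) -
      (residualConn hD (fun y => residualHiggs hD y (X y) (s y)) x (Y x) -
        residualHiggs hD x (X x) (residualConn hD s x (Y x))) -
        residualHiggs hD x (VectorField.mlieBracket 𝓘(ℂ, E) X Y x) (s x))
    (c := residualHiggs hD x (X x) (residualHiggs hD x (Y x) (s x)) -
      residualHiggs hD x (Y x) (residualHiggs hD x (X x) (s x)))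
  refine main fun μ hμ => ?_
  have hf := hD.isFlat (hat hD.isTrivialAlong s) (liftField X) (liftField Y) _
    (coe_mem_regularLocus hμ x) (holAt_hat _ hs _)
    (holAt_liftField (z := ((μ : OnePoint ℂ), x)) hX)
    (holAt_liftField (z := ((μ : OnePoint ℂ), x)) hY)
  rw [mlieBracket_liftField (z := ((μ : OnePoint ℂ), x)) (by simp) hX hY,
    ← constEquiv_sliceConn hD, sliceConn_eq hD hs _ hμ] at hf
  have h1 := key Y hY μ hμ (X x)
  have h2 := key X hX μ hμ (Y x)
  apply (constEquiv hD.isTrivialAlong ((μ : OnePoint ℂ), x)).injective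
  refine Eq.trans ?_ (hf.trans (map_zero _).symm)
  refine Eq.trans ?_ (congrArg₂ (fun p q => p - q - _) h1 h2).symm
  rw [← map_sub, ← map_sub]
  congr 1
  module

/-- The same comparison for the commuting fields `λ ∂_λ` and a lift of `v`. -/
theorem flat_transversal {s : Π x, AtZero E H x} {x : M} (hs : HolAt 𝓘(ℂ, E) F s x)
    (v : TangentSpace 𝓘(ℂ, E) x) :
    (residualConn hD (fun y => residualV hD y (s y)) x v -
      residualV hD x (residualConn hD s x v) = 0) ∧
    ((residualConn hD (fun y => residualU hD y (s y)) x v -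
        residualU hD x (residualConn hD s x v)) -
      (residualHiggs hD x v (residualV hD x (s x)) - residualV hD x (residualHiggs hD x v (s x))) +
      residualHiggs hD x v (s x) = 0) ∧
    residualHiggs hD x v (residualU hD x (s x)) - residualU hD x (residualHiggs hD x v (s x)) =
      0 := by
  let X : Π x : M, TangentSpace 𝓘(ℂ, E) x := FiberBundle.extend E v
  have hX : HolAt 𝓘(ℂ, E) E X x := holAt_extend v
  have hv : X x = v := FiberBundle.extend_apply_self E v
  rw [← hv]
  have hconn := residualConn_isHolConnection hD
  have hVs := residualV_holomorphic hD hs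
  have hnV : residualConn hD (fun y => -residualV hD y (s y)) x =
      -residualConn hD (fun y => residualV hD y (s y)) x := by
    have h := hconn.covariant.smul_const (-1) hVs.diffAt (mem_univ x)
    have e : ((-1 : ℂ) • fun y => residualV hD y (s y)) = fun y => -residualV hD y (s y) := by
      funext y
      exact neg_one_smul ℂ (residualV hD y (s y))
    rw [e] at h
    exact h.trans (neg_one_smul ℂ (residualConn hD (fun y => residualV hD y (s y)) x))
  -- With `λ ∂_λ` as the first field, the coefficients of `μ⁻¹` and `μ⁻²` appear with the opposite
  -- sign.
  have main := eq_zero_of_polynomial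
    (a := residualConn hD (fun y => residualV hD y (s y)) x (X x) -
      residualV hD x (residualConn hD s x (X x)))
    (b := -((residualConn hD (fun y => residualU hD y (s y)) x (X x) -
        residualU hD x (residualConn hD s x (X x))) -
      (residualHiggs hD x (X x) (residualV hD x (s x)) -
        residualV hD x (residualHiggs hD x (X x) (s x))) + residualHiggs hD x (X x) (s x)))
    (c := -(residualHiggs hD x (X x) (residualU hD x (s x)) -
      residualU hD x (residualHiggs hD x (X x) (s x))))
  rw [neg_eq_zero, neg_eq_zero] at main
  refine main fun μ hμ => ?_
  have hz := coe_mem_regularLocus hμ x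
  have hf := hD.isFlat (hat hD.isTrivialAlong s) (lamField E M) (liftField X) _
    hz (holAt_hat _ hs _) (holAt_lamField (z := ((μ : OnePoint ℂ), x)) hz.2)
    (holAt_liftField (z := ((μ : OnePoint ℂ), x)) hX)
  rw [mlieBracket_lamField_liftField (z := ((μ : OnePoint ℂ), x)) hz.2 hX, map_zero, sub_zero] at hf
  have h1 := sliceEnd_add_inv_smul hD (residualConn_holomorphic hD hs hX)
      (residualHiggs_holomorphic hD hs hX) hμ
      (hD.isHolConnection.holomorphic _ (liftField X) _ hz
        (holAt_hat _ hs _) (holAt_liftField (z := ((μ : OnePoint ℂ), x)) hX)) (by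
    filter_upwards [hs.eventually] with y hy ν hν
    rw [← sliceConn_eq hD hy (X y) hν, constEquiv_sliceConn]
    rfl)
  have h2 := sliceConn_add_inv_smul hD hVs.neg (residualU_holomorphic hD hs) hμ
      (hD.isHolConnection.holomorphic _ (lamField E M) _ hz
        (holAt_hat _ hs _) (holAt_lamField (z := ((μ : OnePoint ℂ), x)) hz.2)) (by
    filter_upwards [hs.eventually] with y hy ν hν
    have e : -residualV hD y (s y) + ν⁻¹ • residualU hD y (s y) = sliceEnd hD ν s y := by
      rw [sliceEnd_eq hD hy hν]
      module
    rw [e, constEquiv_sliceEnd]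
    rfl) (X x)
  rw [hnV, map_neg] at h2
  apply (constEquiv hD.isTrivialAlong ((μ : OnePoint ℂ), x)).injective
  refine Eq.trans ?_ (hf.trans (map_zero _).symm)
  refine Eq.trans ?_ (congrArg₂ (fun p q => p - q) h1 h2).symm
  rw [← map_sub, neg_apply]
  congr 1
  module

/-- The Frobenius type structure induced by a trTLE-structure. -/
def residualStructure : FrobeniusTypeStructure 𝓘(ℂ, E) F (AtZero E H) where
  conn := residualConn hD
  higgs := residualHiggs hD
  endU := residualU hD
  endV := residualV hD
  isHolConnection := residualConn_isHolConnection hD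
  isFlat s X Y x _ hs hX hY := (flat_tangential hD hs hX hY).1
  isHiggsField :=
    { holomorphic := fun s X x hs hX => residualHiggs_holomorphic hD hs hX
      comm := fun x a b v => by
        have h := (flat_tangential hD (s := FiberBundle.extend F v)
          (X := FiberBundle.extend E a) (Y := FiberBundle.extend E b) (x := x)
          (holAt_extend v) (holAt_extend a) (holAt_extend b)).2.2
        have ha : (FiberBundle.extend E a : Π x : M, TangentSpace 𝓘(ℂ, E) x) x = a :=
          FiberBundle.extend_apply_self E a
        have hb : (FiberBundle.extend E b : Π x : M, TangentSpace 𝓘(ℂ, E) x) x = b :=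
          FiberBundle.extend_apply_self E b
        have hv : (FiberBundle.extend F v : Π x : M, AtZero E H x) x = v :=
          FiberBundle.extend_apply_self F v
        rw [ha, hb, hv] at h
        exact sub_eq_zero.1 h }
  holomorphic_endU s x hs := residualU_holomorphic hD hs
  holomorphic_endV s x hs := residualV_holomorphic hD hs
  conn_higgs s X Y x hs hX hY := (flat_tangential hD hs hX hY).2.1
  conn_endV s x a hs := (flat_transversal hD hs a).1
  higgs_endU x a v := by
    have hv : (FiberBundle.extend F v : Π x : M, AtZero E H x) x = v :=
      FiberBundle.extend_apply_self F v
    have h := (flat_transversal hD (s := FiberBundle.extend F v) (holAt_extend v) a).2.2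
    rwa [hv] at h
  conn_endU s x a hs := (flat_transversal hD hs a).2.1

/-- A section over `ℙ¹ × U` coincides near `x` with the constant extension of its restriction to `λ
= 0`, and `D` is local. -/
theorem isAssociated_of_hat {Φ : FrobeniusTypeStructure 𝓘(ℂ, E) F (AtZero E H)}
    (h : ∀ (s : Π x, AtZero E H x) (x : M), HolAt 𝓘(ℂ, E) F s x → ∀ μ : ℂ, μ ≠ 0 →
      (∀ v, sliceConn hD μ s x v = Φ.conn s x v + μ⁻¹ • Φ.higgs x v (s x)) ∧
      sliceEnd hD μ s x = μ⁻¹ • Φ.endU x (s x) - Φ.endV x (s x)) : IsAssociated F D Φ := by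
  intro σ x hσ μ hμ
  have hs := holAt_restrictZero (hσ.self_of_nhds ((0 : ℂ) : OnePoint ℂ))
  have hz := coe_mem_regularLocus hμ x
  have e : D σ ((μ : OnePoint ℂ), x) =
      D (hat hD.isTrivialAlong (restrictZero E σ)) ((μ : OnePoint ℂ), x) := by
    refine hD.isHolConnection.covariant.congr_of_eventuallyEq (hσ.self_of_nhds _).diffAt
      (holAt_hat hD.isTrivialAlong hs _).diffAt (isOpen_regularLocus.mem_nhds hz) ?_
    filter_upwards [(continuous_snd.tendsto ((μ : OnePoint ℂ), x)).eventually
      (hat_restrictZero hD.isTrivialAlong hσ)] with z hz using (hz z.1).symm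
  obtain ⟨h1, h2⟩ := h _ x hs μ hμ
  refine ⟨fun v => ?_, ?_⟩
  · rw [e, ← h1 v]
    exact (constEquiv_sliceConn hD μ _ x v).symm
  · rw [e, ← h2]
    exact (constEquiv_sliceEnd hD μ _ x).symm

theorem residualStructure_isAssociated : IsAssociated F D (residualStructure hD) :=
  isAssociated_of_hat hD fun _ _ hs _ hμ =>
    ⟨fun v => sliceConn_eq hD hs v hμ, sliceEnd_eq hD hs hμ⟩

theorem IsAssociated.sliceConn_eq {Φ : FrobeniusTypeStructure 𝓘(ℂ, E) F (AtZero E H)}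
    (hΦ : IsAssociated F D Φ) {s : Π x, AtZero E H x} {x : M} (hs : HolAt 𝓘(ℂ, E) F s x)
    {μ : ℂ} (hμ : μ ≠ 0) (v : TangentSpace 𝓘(ℂ, E) x) :
    sliceConn hD μ s x v = Φ.conn s x v + μ⁻¹ • Φ.higgs x v (s x) := by
  apply (constEquiv hD.isTrivialAlong ((μ : OnePoint ℂ), x)).injective
  have h := (hΦ _ x (holAlongAt_hat hD.isTrivialAlong hs) μ hμ).1 v
  rw [restrictZero_hat] at h
  rw [constEquiv_sliceConn]
  exact h

theorem IsAssociated.sliceEnd_eq {Φ : FrobeniusTypeStructure 𝓘(ℂ, E) F (AtZero E H)}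
    (hΦ : IsAssociated F D Φ) {s : Π x, AtZero E H x} {x : M} (hs : HolAt 𝓘(ℂ, E) F s x)
    {μ : ℂ} (hμ : μ ≠ 0) :
    sliceEnd hD μ s x = μ⁻¹ • Φ.endU x (s x) - Φ.endV x (s x) := by
  apply (constEquiv hD.isTrivialAlong ((μ : OnePoint ℂ), x)).injective
  have h := (hΦ _ x (holAlongAt_hat hD.isTrivialAlong hs) μ hμ).2
  rw [restrictZero_hat] at h
  rw [constEquiv_sliceEnd]
  exact h

theorem eq_of_add_inv_smul {V : Type*} [AddCommGroup V] [Module ℂ V] {a b a' b' : V}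
    (h : ∀ μ : ℂ, μ ≠ 0 → a + μ⁻¹ • b = a' + μ⁻¹ • b') : a = a' ∧ b = b' := by
  have h1 := h 1 one_ne_zero
  have h2 := h (-1) (neg_ne_zero.2 one_ne_zero)
  simp only [inv_one, inv_neg] at h1 h2
  constructor
  · linear_combination (norm := module) (1 / 2 : ℂ) • h1 + (1 / 2 : ℂ) • h2
  · linear_combination (norm := module) (1 / 2 : ℂ) • h1 - (1 / 2 : ℂ) • h2

/-- The coefficients of `1` and `μ⁻¹` coincide on holomorphic sections. For the tensors, every
vector is the value of such a section; for the connection, `IsHolConnection.ext` applies. -/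
theorem eq_residualStructure {Φ : FrobeniusTypeStructure 𝓘(ℂ, E) F (AtZero E H)}
    (hΦ : IsAssociated F D Φ) : Φ = residualStructure hD := by
  have h1 : ∀ (s : Π x, AtZero E H x) (x : M), HolAt 𝓘(ℂ, E) F s x → ∀ v,
      Φ.conn s x v = residualConn hD s x v ∧ Φ.higgs x v (s x) = residualHiggs hD x v (s x) := by
    intro s x hs v
    refine eq_of_add_inv_smul fun μ hμ => ?_
    rw [← hΦ.sliceConn_eq hD hs hμ, MixedFrobenius.sliceConn_eq hD hs v hμ]
  have h2 : ∀ (s : Π x, AtZero E H x) (x : M), HolAt 𝓘(ℂ, E) F s x →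
      -Φ.endV x (s x) = -residualV hD x (s x) ∧ Φ.endU x (s x) = residualU hD x (s x) := by
    intro s x hs
    refine eq_of_add_inv_smul fun μ hμ => ?_
    have h3 := hΦ.sliceEnd_eq hD hs hμ
    rw [MixedFrobenius.sliceEnd_eq hD hs hμ] at h3
    linear_combination (norm := module) (-1 : ℂ) • h3
  have hv : ∀ (x : M) (v : AtZero E H x), (FiberBundle.extend F v : Π x : M, AtZero E H x) x = v :=
    fun x v => FiberBundle.extend_apply_self F v
  have e1 : Φ.conn = residualConn hD :=
    IsHolConnection.ext (F := F) (V := AtZero E H) isOpen_univ Φ.isHolConnection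
      (residualConn_isHolConnection hD)
      fun s x _ hs => by ext v; exact (h1 s x hs v).1
  have e2 : Φ.higgs = residualHiggs hD := by
    funext x
    ext a v
    have h := (h1 (FiberBundle.extend F v) x (holAt_extend v) a).2
    rwa [hv] at h
  have e3 : Φ.endU = residualU hD := by
    funext x
    ext v
    have h := (h2 (FiberBundle.extend F v) x (holAt_extend v)).2
    rwa [hv] at h
  have e4 : Φ.endV = residualV hD := by
    funext x
    ext v
    have h := (h2 (FiberBundle.extend F v) x (holAt_extend v)).1
    rw [hv] at h
    exact neg_injective h
  cases Φ
  dsimp only at e1 e2 e3 e4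
  subst e1 e2 e3 e4
  rfl

end Residual

/-! ### Linear algebra of graded pieces -/

section GradedAlgebra

variable {B : Type*} {V : B → Type*} [∀ x, AddCommGroup (V x)] [∀ x, Module ℂ (V x)]
  {W : ℤ → Π x : B, Submodule ℂ (V x)} {k : ℤ} {x : B}

theorem toGr_of_mem {v : V x} (h : v ∈ W k x) :
    toGr W k x v = Submodule.Quotient.mk ⟨v, h⟩ :=
  dif_pos h

theorem toGr_of_notMem {v : V x} (h : v ∉ W k x) : toGr W k x v = 0 :=
  dif_neg h

theorem toGr_add {v w : V x} (hv : v ∈ W k x) (hw : w ∈ W k x) :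
    toGr W k x (v + w) = toGr W k x v + toGr W k x w := by
  rw [toGr_of_mem hv, toGr_of_mem hw, toGr_of_mem (add_mem hv hw)]
  rfl

theorem toGr_smul (c : ℂ) {v : V x} (hv : v ∈ W k x) :
    toGr W k x (c • v) = c • toGr W k x v := by
  rw [toGr_of_mem hv, toGr_of_mem (Submodule.smul_mem _ c hv)]
  rfl

theorem toGr_sub {v w : V x} (hv : v ∈ W k x) (hw : w ∈ W k x) :
    toGr W k x (v - w) = toGr W k x v - toGr W k x w := by
  rw [toGr_of_mem hv, toGr_of_mem hw, toGr_of_mem (sub_mem hv hw)]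
  rfl

theorem toGr_sum {ι : Type*} (t : Finset ι) {c : ι → ℂ} {v : ι → V x} (hv : ∀ i, v i ∈ W k x) :
    toGr W k x (∑ i ∈ t, c i • v i) = ∑ i ∈ t, c i • toGr W k x (v i) := by
  classical
  induction t using Finset.induction_on with
  | empty =>
    rw [Finset.sum_empty, Finset.sum_empty, toGr_of_mem (zero_mem _)]
    rfl
  | insert a t ha ih =>
    rw [Finset.sum_insert ha, Finset.sum_insert ha, toGr_add (Submodule.smul_mem _ _ (hv a))
      (sum_mem fun i _ => Submodule.smul_mem _ _ (hv i)), toGr_smul _ (hv a), ih]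

theorem toGr_eq_zero_iff {v : V x} (hv : v ∈ W k x) :
    toGr W k x v = 0 ↔ v ∈ W (k - 1) x := by
  rw [toGr_of_mem hv, Submodule.Quotient.mk_eq_zero]
  rfl

theorem exists_toGr_eq (a : Gr W k x) : ∃ v ∈ W k x, toGr W k x v = a := by
  obtain ⟨⟨v, hv⟩, rfl⟩ := Submodule.Quotient.mk_surjective _ a
  exact ⟨v, hv, toGr_of_mem hv⟩

variable {B' : Type*} {V' : B' → Type*} [∀ x, AddCommGroup (V' x)] [∀ x, Module ℂ (V' x)]
  {W' : ℤ → Π x : B', Submodule ℂ (V' x)} {x' : B'}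

/-- The isomorphism of graded pieces induced by a filtered isomorphism. -/
def grEquiv (e : V x ≃ₗ[ℂ] V' x') (he : ∀ k v, v ∈ W k x ↔ e v ∈ W' k x') (k : ℤ) :
    Gr W k x ≃ₗ[ℂ] Gr W' k x' :=
  have h : ∀ k, (W k x).map (e : V x →ₗ[ℂ] V' x') = W' k x' := by
    intro k
    ext w
    constructor
    · rintro ⟨v, hv, rfl⟩
      exact (he k v).1 hv
    · intro hw
      exact ⟨e.symm w, (he k _).2 (by simpa using hw), by simp⟩
  Submodule.Quotient.equiv _ _ (e.ofSubmodules (W k x) (W' k x') (h k)) (by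
    ext ⟨w, hw⟩
    constructor
    · rintro ⟨⟨v, hv⟩, hv', hvw⟩
      have e1 : e v = w := congrArg Subtype.val hvw
      subst e1
      exact (he (k - 1) v).1 hv'
    · intro hw'
      refine ⟨⟨e.symm w, (he k _).2 (by simpa using hw)⟩, ?_, ?_⟩
      · have h2 : e (e.symm w) ∈ W' (k - 1) x' := by
          rw [e.apply_symm_apply]
          exact hw'
        exact (he (k - 1) _).2 h2
      · ext
        simp)

/-- No membership is needed: outside the `k`-th step both classes are zero by convention. -/
theorem grEquiv_toGr (e : V x ≃ₗ[ℂ] V' x') (he : ∀ k v, v ∈ W k x ↔ e v ∈ W' k x') (k : ℤ)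
    (v : V x) : grEquiv e he k (toGr W k x v) = toGr W' k x' (e v) := by
  by_cases hv : v ∈ W k x
  · rw [toGr_of_mem hv, toGr_of_mem ((he k v).1 hv)]
    rfl
  · rw [toGr_of_notMem hv, toGr_of_notMem fun h => hv ((he k v).2 h), map_zero]

theorem nondegenerate_compl₁₂ {A A' C C' : Type*} [AddCommGroup A] [Module ℂ A] [AddCommGroup A']
    [Module ℂ A'] [AddCommGroup C] [Module ℂ C] [AddCommGroup C'] [Module ℂ C']
    {b : A →ₗ[ℂ] C →ₗ[ℂ] ℂ} (hb : b.Nondegenerate) (e : A' ≃ₗ[ℂ] A) (f : C' ≃ₗ[ℂ] C) :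
    (b.compl₁₂ (e : A' →ₗ[ℂ] A) (f : C' →ₗ[ℂ] C)).Nondegenerate := by
  constructor
  · intro a h
    refine e.map_eq_zero_iff.1 (hb.1 (e a) fun c => ?_)
    simpa using h (f.symm c)
  · intro c h
    refine f.map_eq_zero_iff.1 (hb.2 (f c) fun a => ?_)
    simpa using h (e.symm a)

end GradedAlgebra

/-! ### Constancy of the filtration along `ℙ¹` -/

section WeightFiltration

variable {E : Type*} [NormedAddCommGroup E] [NormedSpace ℂ E]
  {M : Type*} [TopologicalSpace M] [ChartedSpace E M] [IsManifold 𝓘(ℂ, E) ω M]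
  {F : Type*} [NormedAddCommGroup F] [NormedSpace ℂ F] [FiniteDimensional ℂ F]
  {H : OnePoint ℂ × M → Type*} [TopologicalSpace (TotalSpace F H)]
  [∀ z, AddCommGroup (H z)] [∀ z, Module ℂ (H z)] [∀ z, TopologicalSpace (H z)]
  [∀ z, IsTopologicalAddGroup (H z)] [∀ z, ContinuousSMul ℂ (H z)]
  [FiberBundle F H] [VectorBundle ℂ F H] [ContMDiffVectorBundle ω F H (modelP E)]
  {T : MixedTrTLEPData E H} (hT : IsMixedTrTLEP F T)

/-- The restriction of the filtration to `λ = 0`. -/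
def MixedTrTLEPData.weightZero (T : MixedTrTLEPData E H) (k : ℤ) (x : M) :
    Submodule ℂ (AtZero E H x) :=
  T.W k (((0 : ℂ) : OnePoint ℂ), x)

/-- The rank of a holomorphic subbundle is constant along `ℙ¹`. -/
theorem IsHolSubbundle.finrank_eq {W : Π z, Submodule ℂ (H z)}
    (hW : IsHolSubbundle (modelP E) F W) (x : M) (p q : OnePoint ℂ) :
    Module.finrank ℂ (W (p, x)) = Module.finrank ℂ (W (q, x)) := by
  refine IsLocallyConstant.apply_eq_of_preconnectedSpace
    (f := fun p : OnePoint ℂ => Module.finrank ℂ (W (p, x))) ?_ p q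
  rw [IsLocallyConstant.iff_eventually_eq]
  intro p
  obtain ⟨r, s, hs⟩ := hW (p, x)
  have h : ∀ z, LinearIndependent ℂ (fun i => s i z) →
      Submodule.span ℂ (range fun i => s i z) = W z → Module.finrank ℂ (W z) = r := by
    intro z h1 h2
    rw [← h2, finrank_span_eq_card h1, Fintype.card_fin]
  have hs' : ∀ᶠ q in 𝓝 p, Module.finrank ℂ (W (q, x)) = r := by
    filter_upwards [((Continuous.prodMk_left x).tendsto p).eventually hs] with q hq
      using h _ hq.2.1 hq.2.2
  filter_upwards [hs'] with q hq
  rw [hq, hs'.self_of_nhds]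

/-- The bundle `Gr_k` is accessible only through local lifts. Near `p`, lifts of the frame `τ`
together with a frame of `W_{k-1}` are independent; the dual functionals of the lifts, applied to
`σ`, give the `c i`, which are therefore holomorphic on the sphere. -/
theorem IsMixedTrTLEP.gr_coeff_const {k : ℤ} {x : M} {r : ℕ} {τ : Fin r → Π z, Gr T.W k z}
    (hT : IsMixedTrTLEP F T)
    (hτ : ∀ p : OnePoint ℂ, (∀ i, ∃ s : Π z, H z, HolSectionAt (modelP E) F (T.W k) s (p, x) ∧
        ∀ᶠ w in 𝓝 (p, x), toGr T.W k w (s w) = τ i w) ∧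
      LinearIndependent ℂ fun i => τ i (p, x))
    {σ : Π z, H z} (hσ : HolAlongAt E F σ x) (hσW : ∀ p : OnePoint ℂ, σ (p, x) ∈ T.W k (p, x))
    {c : Fin r → OnePoint ℂ → ℂ}
    (hc : ∀ p : OnePoint ℂ, toGr T.W k (p, x) (σ (p, x)) = ∑ i, c i p • τ i (p, x))
    (i : Fin r) (p q : OnePoint ℂ) : c i p = c i q := by
  refine eq_of_contMDiff_sphere (fun p => ?_) p q
  obtain ⟨hs, hli⟩ := hτ p
  choose s hs hsτ using hs
  obtain ⟨m, u, hu⟩ := hT.isFiltration.subbundle (k - 1) (p, x)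
  let t : Fin r ⊕ Fin m → Π z, H z := Sum.elim s u
  have hux := hu.self_of_nhds
  have htx : LinearIndependent ℂ fun j => t j (p, x) := by
    rw [Fintype.linearIndependent_iff]
    intro g hg
    rw [Fintype.sum_sum_type] at hg
    change ∑ i, g (Sum.inl i) • s i (p, x) + ∑ j, g (Sum.inr j) • u j (p, x) = 0 at hg
    have huW : ∑ j, g (Sum.inr j) • u j (p, x) ∈ T.W (k - 1) (p, x) := by
      rw [← hux.2.2]
      exact sum_mem fun j _ => Submodule.smul_mem _ _ (Submodule.subset_span ⟨j, rfl⟩)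
    have hsW : ∀ i, s i (p, x) ∈ T.W k (p, x) := fun i => (hs i).2.self_of_nhds
    have h1 : ∑ i, g (Sum.inl i) • s i (p, x) ∈ T.W (k - 1) (p, x) := by
      rw [eq_neg_of_add_eq_zero_left hg]
      exact neg_mem huW
    rw [← toGr_eq_zero_iff (sum_mem fun i _ => Submodule.smul_mem _ _ (hsW i)),
      toGr_sum _ hsW] at h1
    have h2 : ∀ i, g (Sum.inl i) = 0 := by
      refine Fintype.linearIndependent_iff.1 hli _ ?_
      rw [← h1]
      exact Finset.sum_congr rfl fun i _ => by rw [(hsτ i).self_of_nhds]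
    have h3 : ∀ j, g (Sum.inr j) = 0 := by
      refine Fintype.linearIndependent_iff.1 hux.2.1 _ ?_
      simpa [h2] using hg
    rintro (i | j)
    · exact h2 i
    · exact h3 j
  have hthol : ∀ j, HolAt (modelP E) F (t j) (p, x) := by
    rintro (i | j)
    · exact (hs i).1
    · exact hux.1 j
  obtain ⟨γ, hγ, hγ', -⟩ := exists_dual hthol htx
  -- The functional is restricted to `ℙ¹ × {x}`, the only place where `σ` is known to lie in `W_k`.
  have hcomp := (hγ' σ (hσ.self_of_nhds p) (Sum.inl i)).comp p (contMDiff_slice_snd x).contMDiffAt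
  refine hcomp.congr_of_eventuallyEq ?_
  have hslice := (Continuous.prodMk_left x (X := OnePoint ℂ)).tendsto p
  filter_upwards [hslice.eventually hγ, hslice.eventually hu,
    hslice.eventually (eventually_all.2 hsτ), hslice.eventually (eventually_all.2 fun i => (hs i).2)]
    with q h1 h2 h3 h4
  -- The class of this difference in `Gr_k` is zero, so it is a combination of the frame `u`,
  -- invisible to the functionals dual to the lifts.
  have h5 : σ (q, x) - ∑ i, c i q • s i (q, x) ∈ T.W (k - 1) (q, x) := by
    have h6 : ∑ i, c i q • s i (q, x) ∈ T.W k (q, x) :=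
      sum_mem fun i _ => Submodule.smul_mem _ _ (h4 i)
    rw [← toGr_eq_zero_iff (sub_mem (hσW q) h6), toGr_sub (hσW q) h6, toGr_sum _ h4, hc,
      sub_eq_zero]
    exact Finset.sum_congr rfl fun i _ => by rw [h3 i]
  rw [← h2.2.2] at h5
  obtain ⟨b, hb⟩ := (Submodule.mem_span_range_iff_exists_fun ℂ).1 h5
  have h6 := h1 (Sum.elim (fun i => c i q) b) Finset.univ (fun j hj => absurd (Finset.mem_univ j) hj)
    (Sum.inl i)
  rw [Fintype.sum_sum_type] at h6
  change γ (Sum.inl i) (q, x) (∑ i, c i q • s i (q, x) + ∑ j, b j • u j (q, x)) = c i q at h6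
  rw [hb, add_sub_cancel] at h6
  exact h6.symm

/-- The filtration is constant along `ℙ¹`. -/
theorem IsMixedTrTLEP.constEquiv_mem_iff (k : ℤ) (z : OnePoint ℂ × M) (v : AtZero E H z.2) :
    v ∈ T.weightZero k z.2 ↔ constEquiv hT.isTrTLE.isTrivialAlong z v ∈ T.W k z := by
  set hH := hT.isTrTLE.isTrivialAlong
  obtain ⟨p, x⟩ := z
  -- An index where the filtration is everything at `λ = 0`; by constancy of the rank it is
  -- everything along all of `ℙ¹ × {x}`.
  obtain ⟨K, hK⟩ := hT.isFiltration.exhaustive (((0 : ℂ) : OnePoint ℂ), x)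
  have htop : ∀ p : OnePoint ℂ, T.W K (p, x) = ⊤ := by
    intro p
    have := VectorBundle.finiteDimensional ℂ F H (p, x)
    apply Submodule.eq_top_of_finrank_eq
    rw [(hT.isFiltration.subbundle K).finrank_eq x p ((0 : ℂ) : OnePoint ℂ), hK, finrank_top]
    exact (constEquiv hH (p, x)).finrank_eq
  have hmono : Monotone fun k => T.W k (p, x) :=
    monotone_int_of_le_succ fun k => by simpa using hT.isFiltration.mono (k + 1) (p, x)
  have h0 : ∀ (v : AtZero E H x), constEquiv hH (((0 : ℂ) : OnePoint ℂ), x) v = v := by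
    intro v
    obtain ⟨σ, hσ, rfl⟩ := exists_holAlongAt hH v
    exact constExt_restrictZero hH (z := (((0 : ℂ) : OnePoint ℂ), x)) hσ
  -- Descending induction from `K`. Lying in `W_{k-1}` at `p` makes the class in `Gr_k` vanish at
  -- `p`; its coefficients do not depend on the point of `ℙ¹`, so the class vanishes at `q`.
  have main : ∀ k ≤ K, ∀ (v : AtZero E H x) (p q : OnePoint ℂ),
      constEquiv hH (p, x) v ∈ T.W k (p, x) → constEquiv hH (q, x) v ∈ T.W k (q, x) := by
    intro k hk
    induction k, hk using Int.leInductionDown with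
    | base =>
      intro v p q _
      rw [htop q]
      trivial
    | pred k hk ih =>
      intro v p q hv
      obtain ⟨r, τ, hτ⟩ := hT.trivial_Gr k x
      have hτx := hτ.self_of_nhds
      have hvk : ∀ q, constEquiv hH (q, x) v ∈ T.W k (q, x) :=
        fun q => ih v p q (hT.isFiltration.mono k _ hv)
      obtain ⟨σ, hσ, hσv⟩ := exists_holAlongAt hH v
      have hσ' : ∀ q : OnePoint ℂ, σ (q, x) = constEquiv hH (q, x) v := by
        intro q
        rw [← hσv]
        exact (constExt_restrictZero hH (z := (q, x)) hσ).symm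
      have hex : ∀ q : OnePoint ℂ, ∃ c : Fin r → ℂ,
          toGr T.W k (q, x) (σ (q, x)) = ∑ i, c i • τ i (q, x) := by
        intro q
        have h1 : toGr T.W k (q, x) (σ (q, x)) ∈ Submodule.span ℂ (range fun i => τ i (q, x)) := by
          rw [(hτx q).2.2]
          trivial
        obtain ⟨c, hc⟩ := (Submodule.mem_span_range_iff_exists_fun ℂ).1 h1
        exact ⟨c, hc.symm⟩
      choose c hc using hex
      have hconst := hT.gr_coeff_const (c := fun i q => c q i) (fun q => ⟨(hτx q).1, (hτx q).2.1⟩) hσ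
        (fun q => by rw [hσ']; exact hvk q) hc
      have hp : c p = 0 := by
        have h1 := (toGr_eq_zero_iff (hvk p)).2 hv
        rw [← hσ', hc] at h1
        exact funext fun i => Fintype.linearIndependent_iff.1 (hτx p).2.1 _ h1 i
      rw [← toGr_eq_zero_iff (hvk q), ← hσ', hc]
      refine Finset.sum_eq_zero fun i _ => ?_
      rw [hconst i q p, hp, Pi.zero_apply, zero_smul]
  by_cases hk : k ≤ K
  · have h1 := main k hk v ((0 : ℂ) : OnePoint ℂ) p
    have h2 := main k hk v p ((0 : ℂ) : OnePoint ℂ)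
    rw [h0] at h1 h2
    exact ⟨h1, h2⟩
  · have hk' := (not_le.1 hk).le
    have h1 : ∀ q, T.W k (q, x) = ⊤ := by
      intro q
      have hmono : Monotone fun k => T.W k (q, x) :=
        monotone_int_of_le_succ fun k => by simpa using hT.isFiltration.mono (k + 1) (q, x)
      exact top_le_iff.1 ((htop q).ge.trans (hmono hk'))
    rw [h1, MixedTrTLEPData.weightZero, h1]
    exact ⟨fun _ => trivial, fun _ => trivial⟩

end WeightFiltration

/-! ### Filtrations and metrics compatible with a Frobenius type structure -/

section Filtered

variable {EB HB : Type*} [NormedAddCommGroup EB] [NormedSpace ℂ EB] [TopologicalSpace HB]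
  {I : ModelWithCorners ℂ EB HB} {B : Type*} [TopologicalSpace B] [ChartedSpace HB B]
  {F : Type*} [NormedAddCommGroup F] [NormedSpace ℂ F]
  {V : B → Type*} [TopologicalSpace (TotalSpace F V)]
  [∀ x, AddCommGroup (V x)] [∀ x, Module ℂ (V x)] [∀ x, TopologicalSpace (V x)]
  [FiberBundle F V] [IsManifold I 1 B]
  [∀ x, IsTopologicalAddGroup (V x)] [∀ x, ContinuousSMul ℂ (V x)]

/-- A filtration and graded metrics which are compatible with a Frobenius type structure. -/
structure IsFilteredMetric (Φ : FrobeniusTypeStructure I F V) (W : ℤ → Π x : B, Submodule ℂ (V x))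
    (g : Π (k : ℤ) (x : B), Gr W k x →ₗ[ℂ] Gr W k x →ₗ[ℂ] ℂ) : Prop where
  isFiltration : IsSubbundleFiltration I F W
  conn_mem : ∀ (k : ℤ) (s : Π x, V x) (x : B), HolSectionAt I F (W k) s x →
    ∀ a : TangentSpace I x, Φ.conn s x a ∈ W k x
  higgs_mem : ∀ (k : ℤ) (x : B) (a : TangentSpace I x), ∀ v ∈ W k x, Φ.higgs x a v ∈ W k x
  endV_mem : ∀ (k : ℤ) (x : B), ∀ v ∈ W k x, Φ.endV x v ∈ W k x
  g_holomorphic : ∀ (k : ℤ) (s t : Π x, V x) (x : B), HolSectionAt I F (W k) s x →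
    HolSectionAt I F (W k) t x →
      ContMDiffAt I 𝓘(ℂ, ℂ) ω (fun y => g k y (toGr W k y (s y)) (toGr W k y (t y))) x
  g_symm : ∀ (k : ℤ) (x : B) (a b : Gr W k x), g k x a b = g k x b a
  g_nondegenerate : ∀ (k : ℤ) (x : B), (g k x).Nondegenerate
  g_flat : ∀ (k : ℤ) (s t : Π x, V x) (x : B), HolSectionAt I F (W k) s x →
    HolSectionAt I F (W k) t x → ∀ a : TangentSpace I x,
      mvfderiv I (fun y => g k y (toGr W k y (s y)) (toGr W k y (t y))) x a =
        g k x (toGr W k x (Φ.conn s x a)) (toGr W k x (t x)) +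
          g k x (toGr W k x (s x)) (toGr W k x (Φ.conn t x a))
  g_higgs : ∀ (k : ℤ) (x : B) (a : TangentSpace I x), ∀ v ∈ W k x, ∀ w ∈ W k x,
    g k x (toGr W k x (Φ.higgs x a v)) (toGr W k x w) =
      g k x (toGr W k x v) (toGr W k x (Φ.higgs x a w))
  g_endV : ∀ (k : ℤ) (x : B), ∀ v ∈ W k x, ∀ w ∈ W k x,
    g k x (toGr W k x (Φ.endV x v)) (toGr W k x w) +
      g k x (toGr W k x v) (toGr W k x (Φ.endV x w)) =
        k * g k x (toGr W k x v) (toGr W k x w)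

end Filtered

/-! ### The graded metrics at `λ = 0` and their identities -/

section Metric

variable {E : Type*} [NormedAddCommGroup E] [NormedSpace ℂ E] [FiniteDimensional ℂ E]
  {M : Type*} [TopologicalSpace M] [ChartedSpace E M] [IsManifold 𝓘(ℂ, E) ω M]
  {F : Type*} [NormedAddCommGroup F] [NormedSpace ℂ F] [FiniteDimensional ℂ F]
  {H : OnePoint ℂ × M → Type*} [TopologicalSpace (TotalSpace F H)]
  [∀ z, AddCommGroup (H z)] [∀ z, Module ℂ (H z)] [∀ z, TopologicalSpace (H z)]
  [∀ z, IsTopologicalAddGroup (H z)] [∀ z, ContinuousSMul ℂ (H z)]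
  [FiberBundle F H] [VectorBundle ℂ F H] [ContMDiffVectorBundle ω F H (modelP E)]
  {T : MixedTrTLEPData E H} (hT : IsMixedTrTLEP F T)

/-- The natural isomorphism on the graded pieces. -/
def grConst (k : ℤ) (z : OnePoint ℂ × M) : Gr T.weightZero k z.2 ≃ₗ[ℂ] Gr T.W k z :=
  grEquiv (constEquiv hT.isTrTLE.isTrivialAlong z)
    (fun k v => hT.constEquiv_mem_iff k z v) k

/-- The pairing induced by `pairing k` on the `k`-th graded piece of `H|_{λ = 0}`. -/
def metricZero (k : ℤ) (x : M) :
    Gr T.weightZero k x →ₗ[ℂ] Gr T.weightZero k x →ₗ[ℂ] ℂ :=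
  -- The base point `λ = 1`, paired with `-1`, is an arbitrary choice by `pairing_eq_metricZero`.
  (T.pairing k (((1 : ℂ) : OnePoint ℂ), x)).compl₁₂
    (grConst hT k (((1 : ℂ) : OnePoint ℂ), x)).toLinearMap
    (grConst hT k (jmap (((1 : ℂ) : OnePoint ℂ), x))).toLinearMap

theorem HolSectionAt.hat {k : ℤ} {s : Π x, AtZero E H x} {x : M}
    (hs : HolSectionAt 𝓘(ℂ, E) F (T.weightZero k) s x) (p : OnePoint ℂ) :
    HolSectionAt (modelP E) F (T.W k) (hat hT.isTrTLE.isTrivialAlong s) (p, x) := by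
  refine ⟨holAt_hat _ hs.1 p, ?_⟩
  filter_upwards [(continuous_snd.tendsto (p, x)).eventually hs.2] with z hz
    using (hT.constEquiv_mem_iff k z _).1 hz

theorem isHolSubbundle_weightZero (hT : IsMixedTrTLEP F T) (k : ℤ) :
    IsHolSubbundle 𝓘(ℂ, E) F (V := AtZero E H) (T.weightZero k) := by
  intro x
  obtain ⟨r, s, hs⟩ := hT.isFiltration.subbundle k (((0 : ℂ) : OnePoint ℂ), x)
  refine ⟨r, fun i => restrictZero E (s i), ?_⟩
  filter_upwards [((contMDiff_slice (E := E) ((0 : ℂ) : OnePoint ℂ)).continuous.tendsto x).eventually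
    hs] with y hy
  exact ⟨fun i => holAt_restrictZero (hy.1 i), hy.2⟩

/-- Along `ℙ¹`, the pairing is constant. -/
theorem pairing_eq_metricZero (k : ℤ) (z : OnePoint ℂ × M) {v w : AtZero E H z.2}
    (hv : v ∈ T.weightZero k z.2) (hw : w ∈ T.weightZero k z.2) :
    T.pairing k z (toGr T.W k z (constEquiv hT.isTrTLE.isTrivialAlong z v))
      (toGr T.W k (jmap z) (constEquiv hT.isTrTLE.isTrivialAlong (jmap z) w)) =
    metricZero hT k z.2 (toGr T.weightZero k z.2 v) (toGr T.weightZero k z.2 w) := by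
  obtain ⟨p, x⟩ := z
  obtain ⟨s, hs, rfl⟩ := (isHolSubbundle_weightZero hT k).exists_section hv
  obtain ⟨t, ht, rfl⟩ := (isHolSubbundle_weightZero hT k).exists_section hw
  have h := eq_of_contMDiff_sphere (f := fun p : OnePoint ℂ =>
    T.pairing k (p, x) (toGr T.W k (p, x) (constEquiv hT.isTrTLE.isTrivialAlong (p, x) (s x)))
      (toGr T.W k (jmap (p, x)) (constEquiv hT.isTrTLE.isTrivialAlong (jmap (p, x)) (t x))))
    (fun p => ContMDiffAt.comp p (hT.pairing_holomorphic k (MixedFrobenius.hat _ s)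
      (MixedFrobenius.hat _ t) (p, x) (hs.hat hT p) (ht.hat hT _))
      (contMDiff_slice_snd x).contMDiffAt) p ((1 : ℂ) : OnePoint ℂ)
  refine h.trans ?_
  have e1 := grEquiv_toGr (W' := T.W) (constEquiv hT.isTrTLE.isTrivialAlong
    (((1 : ℂ) : OnePoint ℂ), x)) (fun k v => hT.constEquiv_mem_iff k _ v) k (s x)
  have e2 := grEquiv_toGr (W' := T.W) (constEquiv hT.isTrTLE.isTrivialAlong
    (jmap (((1 : ℂ) : OnePoint ℂ), x))) (fun k v => hT.constEquiv_mem_iff k _ v) k (t x)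
  exact (congrArg₂ (fun a b => T.pairing k (((1 : ℂ) : OnePoint ℂ), x) a b) e1 e2).symm

/-- `W_k` is flat, and constant along `ℙ¹`; so the derivatives of a constant section of `W_k`,
brought back to `λ = 0`, stay in it. -/
theorem conn_hat_mem {k : ℤ} {s : Π x, AtZero E H x} {x : M}
    (hs : HolSectionAt 𝓘(ℂ, E) F (T.weightZero k) s x) {μ : ℂ} (hμ : μ ≠ 0)
    (v : TangentSpace 𝓘(ℂ, E) x) :
    sliceConn hT.isTrTLE μ s x v ∈ T.weightZero k x ∧
      sliceEnd hT.isTrTLE μ s x ∈ T.weightZero k x := by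
  constructor
  · refine (hT.constEquiv_mem_iff k ((μ : OnePoint ℂ), x) _).2 ?_
    rw [constEquiv_sliceConn]
    exact hT.flat_W k _ _ (coe_mem_regularLocus hμ x) (hs.hat hT _) _
  · refine (hT.constEquiv_mem_iff k ((μ : OnePoint ℂ), x) _).2 ?_
    rw [constEquiv_sliceEnd]
    exact hT.flat_W k _ _ (coe_mem_regularLocus hμ x) (hs.hat hT _) _

theorem metricZero_holomorphic {k : ℤ} {s t : Π x, AtZero E H x} {x : M}
    (hs : HolSectionAt 𝓘(ℂ, E) F (T.weightZero k) s x)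
    (ht : HolSectionAt 𝓘(ℂ, E) F (T.weightZero k) t x) :
    ContMDiffAt 𝓘(ℂ, E) 𝓘(ℂ, ℂ) ω (fun y => metricZero hT k y (toGr T.weightZero k y (s y))
      (toGr T.weightZero k y (t y))) x := by
  have h := ContMDiffAt.comp x (hT.pairing_holomorphic k (MixedFrobenius.hat _ s)
    (MixedFrobenius.hat _ t) (((1 : ℂ) : OnePoint ℂ), x) (hs.hat hT _) (ht.hat hT _))
    (contMDiff_slice _).contMDiffAt
  refine h.congr_of_eventuallyEq ?_
  filter_upwards [hs.2, ht.2] with y h1 h2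
  exact (pairing_eq_metricZero hT k (((1 : ℂ) : OnePoint ℂ), y) h1 h2).symm

/-- Used with exponent `-k` for `P_k` on constant sections. The derivative of the power of `λ` is
what produces the `k` in `𝒱 + 𝒱^* = k`. -/
theorem mvfderiv_lam_zpow_mul {g : M → ℂ} {x : M} (hg : MDifferentiableAt 𝓘(ℂ, E) 𝓘(ℂ, ℂ) g x)
    (m : ℤ) {μ : ℂ} (hμ : μ ≠ 0) (a : ℂ) (v : TangentSpace 𝓘(ℂ, E) x) :
    mvfderiv (modelP E) (fun w : OnePoint ℂ × M => lam w.1 ^ m * g w.2) ((μ : OnePoint ℂ), x)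
      (tangentVec ((μ : OnePoint ℂ), x) a v) =
      μ ^ m * mvfderiv 𝓘(ℂ, E) g x v + g x * (m * μ ^ (m - 1) * a) := by
  have hz := coe_mem_regularLocus hμ x
  have hlam : ContMDiffAt (modelP E) 𝓘(ℂ, ℂ) ω (fun w : OnePoint ℂ × M => lam w.1)
    ((μ : OnePoint ℂ), x) := contMDiffAt_lam_fst hz.2
  have hpow : HasDerivAt (fun t : ℂ => t ^ m) (m * μ ^ (m - 1)) μ := hasDerivAt_zpow m μ (Or.inl hμ)
  have hpow' : MDifferentiableAt 𝓘(ℂ, ℂ) 𝓘(ℂ, ℂ) (fun t : ℂ => t ^ m) (lam (μ : OnePoint ℂ)) := by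
    rw [lam_coe]
    exact hpow.differentiableAt.mdifferentiableAt
  have h1 : MDifferentiableAt (modelP E) 𝓘(ℂ, ℂ) (fun w : OnePoint ℂ × M => lam w.1 ^ m)
      ((μ : OnePoint ℂ), x) :=
    MDifferentiableAt.comp (I' := 𝓘(ℂ, ℂ)) (g := fun t : ℂ => t ^ m)
      (f := fun w : OnePoint ℂ × M => lam w.1) _ hpow' (hlam.mdifferentiableAt (by simp))
  have h2 : MDifferentiableAt (modelP E) 𝓘(ℂ, ℂ) (fun w : OnePoint ℂ × M => g w.2)
      ((μ : OnePoint ℂ), x) :=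
    MDifferentiableAt.comp (g := g) (f := Prod.snd) ((μ : OnePoint ℂ), x) hg mdifferentiableAt_snd
  have h3 : mvfderiv (modelP E) (fun w : OnePoint ℂ × M => lam w.1 ^ m) ((μ : OnePoint ℂ), x)
      (tangentVec ((μ : OnePoint ℂ), x) a v) = m * μ ^ (m - 1) * a := by
    have h4 := mfderiv_comp_apply (I := modelP E) (I' := 𝓘(ℂ, ℂ)) (I'' := 𝓘(ℂ, ℂ))
      (g := fun t : ℂ => t ^ m) (f := fun w : OnePoint ℂ × M => lam w.1) ((μ : OnePoint ℂ), x)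
      hpow' (hlam.mdifferentiableAt (by simp)) (tangentVec ((μ : OnePoint ℂ), x) a v)
    have h5 := mvfderiv_lam_fst (E := E) hz.2 (tangentVec ((μ : OnePoint ℂ), x) a v)
    refine h4.trans ?_
    rw [mfderiv_eq_fderiv]
    refine (congrArg (fun c => fderiv ℂ (fun t : ℂ => t ^ m) (lam (μ : OnePoint ℂ)) c) h5).trans ?_
    rw [lam_coe, hpow.hasFDerivAt.fderiv]
    exact mul_comm _ _
  have h6 := congrArg (fun L => L (tangentVec ((μ : OnePoint ℂ), x) a v)) (mvfderiv_mul h1 h2)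
  refine h6.trans ?_
  have h7 := mvfderiv_comp_snd (z := ((μ : OnePoint ℂ), x)) hg (tangentVec ((μ : OnePoint ℂ), x) a v)
  refine (congrArg₂ (fun p q => lam (μ : OnePoint ℂ) ^ m * p + g x * q) h7 h3).trans ?_
  rw [lam_coe]
  rfl

theorem mem_of_add_inv_smul_mem {V : Type*} [AddCommGroup V] [Module ℂ V] {W : Submodule ℂ V}
    {a b : V} (h : ∀ μ : ℂ, μ ≠ 0 → a + μ⁻¹ • b ∈ W) : a ∈ W ∧ b ∈ W := by
  have h1 := h 1 one_ne_zero
  have h2 := h (-1) (neg_ne_zero.2 one_ne_zero)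
  constructor
  · convert W.smul_mem (2⁻¹ : ℂ) (add_mem h1 h2) using 1
    simp only [inv_one, inv_neg]
    module
  · convert W.smul_mem (2⁻¹ : ℂ) (sub_mem h1 h2) using 1
    simp only [inv_one, inv_neg]
    module

variable {Φ : FrobeniusTypeStructure 𝓘(ℂ, E) F (AtZero E H)} (hΦ : IsAssociated F T.conn Φ)

include hT hΦ

theorem IsAssociated.conn_mem {k : ℤ} {s : Π x, AtZero E H x} {x : M}
    (hs : HolSectionAt 𝓘(ℂ, E) F (T.weightZero k) s x) (v : TangentSpace 𝓘(ℂ, E) x) :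
    Φ.conn s x v ∈ T.weightZero k x ∧ Φ.higgs x v (s x) ∈ T.weightZero k x := by
  refine mem_of_add_inv_smul_mem fun μ hμ => ?_
  rw [← hΦ.sliceConn_eq hT.isTrTLE hs.1 hμ v]
  exact (conn_hat_mem hT hs hμ v).1

theorem IsAssociated.end_mem {k : ℤ} {s : Π x, AtZero E H x} {x : M}
    (hs : HolSectionAt 𝓘(ℂ, E) F (T.weightZero k) s x) :
    Φ.endV x (s x) ∈ T.weightZero k x ∧ Φ.endU x (s x) ∈ T.weightZero k x := by
  have h : -Φ.endV x (s x) ∈ T.weightZero k x ∧ Φ.endU x (s x) ∈ T.weightZero k x := by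
    refine mem_of_add_inv_smul_mem fun μ hμ => ?_
    have h1 := hΦ.sliceEnd_eq hT.isTrTLE hs.1 hμ
    rw [neg_add_eq_sub, ← h1]
    exact (conn_hat_mem hT hs hμ 0).2
  exact ⟨neg_mem_iff.1 h.1, h.2⟩

omit hΦ in
/-- The flatness of the pairing, in terms of the connection on `H|_{λ = 0} ≃ H|_{λ = μ}`. -/
theorem metricZero_flat {k : ℤ} {s t : Π x, AtZero E H x} {x : M}
    (hs : HolSectionAt 𝓘(ℂ, E) F (T.weightZero k) s x)
    (ht : HolSectionAt 𝓘(ℂ, E) F (T.weightZero k) t x) {μ : ℂ} (hμ : μ ≠ 0) (a : ℂ)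
    (v : TangentSpace 𝓘(ℂ, E) x) {s' t' : AtZero E H x} (hs' : s' ∈ T.weightZero k x)
    (ht' : t' ∈ T.weightZero k x)
    (es : T.conn (hat hT.isTrTLE.isTrivialAlong s) ((μ : OnePoint ℂ), x)
      (tangentVec ((μ : OnePoint ℂ), x) a v) =
      constEquiv hT.isTrTLE.isTrivialAlong ((μ : OnePoint ℂ), x) s')
    (et : T.conn (hat hT.isTrTLE.isTrivialAlong t) (((-μ : ℂ) : OnePoint ℂ), x)
      (tangentVec (((-μ : ℂ) : OnePoint ℂ), x) (-a) v) =
      constEquiv hT.isTrTLE.isTrivialAlong (((-μ : ℂ) : OnePoint ℂ), x) t') :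
    mvfderiv 𝓘(ℂ, E) (fun y => metricZero hT k y (toGr T.weightZero k y (s y))
      (toGr T.weightZero k y (t y))) x v -
        k * (μ⁻¹ * a) * metricZero hT k x (toGr T.weightZero k x (s x)) (toGr T.weightZero k x (t x)) =
      metricZero hT k x (toGr T.weightZero k x s') (toGr T.weightZero k x (t x)) +
        metricZero hT k x (toGr T.weightZero k x (s x)) (toGr T.weightZero k x t') := by
  have h := hT.P_flat k (hat hT.isTrTLE.isTrivialAlong s) (hat hT.isTrTLE.isTrivialAlong t)
    ((μ : OnePoint ℂ), x) (coe_mem_regularLocus hμ x) (hs.hat hT _) (ht.hat hT _) a v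
  have e : (fun w => T.P k w (toGr T.W k w (hat hT.isTrTLE.isTrivialAlong s w))
      (toGr T.W k (jmap w) (hat hT.isTrTLE.isTrivialAlong t (jmap w)))) =ᶠ[𝓝 ((μ : OnePoint ℂ), x)]
      fun w => lam w.1 ^ (-k) * metricZero hT k w.2 (toGr T.weightZero k w.2 (s w.2))
        (toGr T.weightZero k w.2 (t w.2)) := by
    filter_upwards [(continuous_snd.tendsto ((μ : OnePoint ℂ), x)).eventually hs.2,
      (continuous_snd.tendsto ((μ : OnePoint ℂ), x)).eventually ht.2] with w h1 h2
    exact congrArg (fun c => lam w.1 ^ (-k) * c) (pairing_eq_metricZero hT k w h1 h2)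
  rw [mvfderiv_congr e] at h
  replace h := (mvfderiv_lam_zpow_mul ((metricZero_holomorphic hT hs ht).mdifferentiableAt (by simp))
    (-k) hμ a v).symm.trans h
  have p1 := pairing_eq_metricZero hT k ((μ : OnePoint ℂ), x) hs' ht.2.self_of_nhds
  have p2 := pairing_eq_metricZero hT k ((μ : OnePoint ℂ), x) hs.2.self_of_nhds ht'
  have q1 : T.P k ((μ : OnePoint ℂ), x) (toGr T.W k ((μ : OnePoint ℂ), x)
      (T.conn (hat hT.isTrTLE.isTrivialAlong s) ((μ : OnePoint ℂ), x)
        (tangentVec ((μ : OnePoint ℂ), x) a v)))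
      (toGr T.W k (jmap ((μ : OnePoint ℂ), x)) (hat hT.isTrTLE.isTrivialAlong t
        (jmap ((μ : OnePoint ℂ), x)))) = μ ^ (-k) * metricZero hT k x (toGr T.weightZero k x s')
          (toGr T.weightZero k x (t x)) := by
    rw [es]
    exact congrArg₂ (fun c d => c ^ (-k) * d) (lam_coe μ) p1
  have q2 : T.P k ((μ : OnePoint ℂ), x) (toGr T.W k ((μ : OnePoint ℂ), x)
      (hat hT.isTrTLE.isTrivialAlong s ((μ : OnePoint ℂ), x)))
      (toGr T.W k (jmap ((μ : OnePoint ℂ), x)) (T.conn (hat hT.isTrTLE.isTrivialAlong t)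
        (jmap ((μ : OnePoint ℂ), x)) (tangentVec (jmap ((μ : OnePoint ℂ), x)) (-a) v))) =
      μ ^ (-k) * metricZero hT k x (toGr T.weightZero k x (s x)) (toGr T.weightZero k x t') := by
    refine Eq.trans ?_ (congrArg₂ (fun c d => c ^ (-k) * d) (lam_coe μ) p2)
    exact congrArg (fun c => T.P k ((μ : OnePoint ℂ), x) (toGr T.W k ((μ : OnePoint ℂ), x)
      (hat hT.isTrTLE.isTrivialAlong s ((μ : OnePoint ℂ), x)))
        (toGr T.W k (jmap ((μ : OnePoint ℂ), x)) c)) et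
  rw [q1, q2] at h
  -- All terms carry the factor `μ ^ (-k)`, which is cancelled.
  have hk : μ ^ (-k) ≠ 0 := zpow_ne_zero _ hμ
  apply mul_left_cancel₀ hk
  rw [zpow_sub_one₀ hμ] at h
  push_cast at h
  linear_combination h

/-- The derivatives of the pairing of two sections which are constant along `ℙ¹`. -/
theorem IsAssociated.metricZero_identities {k : ℤ} {s t : Π x, AtZero E H x} {x : M}
    (hs : HolSectionAt 𝓘(ℂ, E) F (T.weightZero k) s x)
    (ht : HolSectionAt 𝓘(ℂ, E) F (T.weightZero k) t x) (v : TangentSpace 𝓘(ℂ, E) x) :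
    (let G : AtZero E H x → AtZero E H x → ℂ := fun a b =>
      metricZero hT k x (toGr T.weightZero k x a) (toGr T.weightZero k x b)
    mvfderiv 𝓘(ℂ, E) (fun y => metricZero hT k y (toGr T.weightZero k y (s y))
      (toGr T.weightZero k y (t y))) x v = G (Φ.conn s x v) (t x) + G (s x) (Φ.conn t x v) ∧
    G (Φ.higgs x v (s x)) (t x) = G (s x) (Φ.higgs x v (t x)) ∧
    G (Φ.endV x (s x)) (t x) + G (s x) (Φ.endV x (t x)) = k * G (s x) (t x)) := by
  intro G
  have hsx := hs.2.self_of_nhds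
  have htx := ht.2.self_of_nhds
  have hs1 := fun v => hΦ.conn_mem hT hs v
  have ht1 := fun v => hΦ.conn_mem hT ht v
  have hs2 := hΦ.end_mem hT hs
  have ht2 := hΦ.end_mem hT ht
  have Gl : ∀ {a b c : AtZero E H x} (m : ℂ), a ∈ T.weightZero k x → b ∈ T.weightZero k x →
      G (a + m • b) c = G a c + m * G b c := by
    intro a b c m ha hb
    simp only [G]
    rw [toGr_add ha (Submodule.smul_mem _ _ hb), toGr_smul _ hb, map_add, map_smul]
    rfl
  have Gr : ∀ {a b c : AtZero E H x} (m : ℂ), a ∈ T.weightZero k x → b ∈ T.weightZero k x →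
      G c (a + m • b) = G c a + m * G c b := by
    intro a b c m ha hb
    simp only [G]
    rw [toGr_add ha (Submodule.smul_mem _ _ hb), toGr_smul _ hb, map_add, map_smul]
    rfl
  -- Along `v` the first argument contributes `∇ʳ + μ⁻¹ 𝒞` and the second, at `-μ`, contributes `∇ʳ
  -- - μ⁻¹ 𝒞`. Comparing coefficients gives flatness and the symmetry of `𝒞`.
  have h1 : mvfderiv 𝓘(ℂ, E) (fun y => metricZero hT k y (toGr T.weightZero k y (s y))
        (toGr T.weightZero k y (t y))) x v = G (Φ.conn s x v) (t x) + G (s x) (Φ.conn t x v) ∧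
      0 = G (Φ.higgs x v (s x)) (t x) - G (s x) (Φ.higgs x v (t x)) := by
    refine eq_of_add_inv_smul fun μ hμ => ?_
    have h := metricZero_flat hT hs ht hμ 0 v (conn_hat_mem hT hs hμ v).1
      (conn_hat_mem hT ht (neg_ne_zero.2 hμ) v).1 (constEquiv_sliceConn _ _ _ _ _).symm (by
        rw [neg_zero]
        exact (constEquiv_sliceConn _ _ _ _ _).symm)
    rw [hΦ.sliceConn_eq hT.isTrTLE hs.1 hμ, hΦ.sliceConn_eq hT.isTrTLE ht.1 (neg_ne_zero.2 hμ)] at h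
    have e1 := Gl (c := t x) μ⁻¹ (hs1 v).1 (hs1 v).2
    have e2 := Gr (c := s x) (-μ)⁻¹ (ht1 v).1 (ht1 v).2
    have h' := h.trans (congrArg₂ (· + ·) e1 e2)
    rw [mul_zero, mul_zero, zero_mul, sub_zero] at h'
    rw [h', inv_neg, smul_zero, smul_eq_mul]
    ring
  -- The field `λ ∂_λ` is invariant under `j`, so both arguments contribute `-𝒱` to the constant
  -- coefficient.
  have h2 : -(k * G (s x) (t x)) = -(G (Φ.endV x (s x)) (t x) + G (s x) (Φ.endV x (t x))) ∧
      0 = G (Φ.endU x (s x)) (t x) - G (s x) (Φ.endU x (t x)) := by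
    refine eq_of_add_inv_smul fun μ hμ => ?_
    have h := metricZero_flat hT hs ht hμ μ 0 (conn_hat_mem hT hs hμ 0).2
      (conn_hat_mem hT ht (neg_ne_zero.2 hμ) 0).2 (constEquiv_sliceEnd _ _ _ _).symm
      (constEquiv_sliceEnd _ _ _ _).symm
    rw [hΦ.sliceEnd_eq hT.isTrTLE hs.1 hμ, hΦ.sliceEnd_eq hT.isTrTLE ht.1 (neg_ne_zero.2 hμ)] at h
    have e1 := Gl (c := t x) μ⁻¹ (neg_mem hs2.1) hs2.2
    have e2 := Gr (c := s x) (-μ)⁻¹ (neg_mem ht2.1) ht2.2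
    -- `-𝒱 s` is treated as `0 + (-1) • 𝒱 s`; the values of `G` at `0` that remain vanish by `e5`
    -- and `e6`.
    have e3 := Gl (c := t x) (-1) (zero_mem _) hs2.1
    have e4 := Gr (c := s x) (-1) (zero_mem _) ht2.1
    have e5 := Gl (c := t x) (-1) (zero_mem _) (zero_mem (T.weightZero k x))
    have e6 := Gr (c := s x) (-1) (zero_mem _) (zero_mem (T.weightZero k x))
    rw [neg_one_smul, zero_add] at e3 e4
    rw [smul_zero, zero_add] at e5 e6
    rw [e3, neg_add_eq_sub] at e1
    rw [e4, neg_add_eq_sub] at e2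
    have h' := h.trans (congrArg₂ (· + ·) e1 e2)
    rw [map_zero, inv_mul_cancel₀ hμ, mul_one, zero_sub] at h'
    change -(k * G (s x) (t x)) = _ at h'
    rw [h', inv_neg, smul_zero, smul_eq_mul]
    linear_combination e5 + e6
  exact ⟨h1.1, (sub_eq_zero.1 h1.2.symm), (neg_injective h2.1).symm⟩

theorem IsAssociated.isFilteredMetric :
    IsFilteredMetric Φ T.weightZero (metricZero hT) where
  isFiltration :=
    { mono := fun k x => hT.isFiltration.mono k _
      exhaustive := fun x => hT.isFiltration.exhaustive _
      separated := fun x => hT.isFiltration.separated _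
      subbundle := isHolSubbundle_weightZero hT }
  conn_mem k s x hs a := (hΦ.conn_mem hT hs a).1
  higgs_mem k x a v hv := by
    obtain ⟨s, hs, rfl⟩ := (isHolSubbundle_weightZero hT k).exists_section hv
    exact (hΦ.conn_mem hT hs a).2
  endV_mem k x v hv := by
    obtain ⟨s, hs, rfl⟩ := (isHolSubbundle_weightZero hT k).exists_section hv
    exact (hΦ.end_mem hT hs).1
  g_holomorphic k s t x hs ht := metricZero_holomorphic hT hs ht
  g_symm k x a b := by
    obtain ⟨v, hv, rfl⟩ := exists_toGr_eq a
    obtain ⟨w, hw, rfl⟩ := exists_toGr_eq b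
    obtain ⟨s, hs, rfl⟩ := (isHolSubbundle_weightZero hT k).exists_section hv
    obtain ⟨t, ht, rfl⟩ := (isHolSubbundle_weightZero hT k).exists_section hw
    have h := hT.P_symm k (MixedFrobenius.hat hT.isTrTLE.isTrivialAlong t)
      (MixedFrobenius.hat hT.isTrTLE.isTrivialAlong s) (((1 : ℂ) : OnePoint ℂ), x)
      (coe_mem_regularLocus one_ne_zero x)
    have h1 := pairing_eq_metricZero hT k (jmap (((1 : ℂ) : OnePoint ℂ), x)) hv hw
    have h2 := pairing_eq_metricZero hT k (((1 : ℂ) : OnePoint ℂ), x) hw hv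
    -- The factor `(-1)^{-k}` from `λ = -1` equals the sign `(-1)^k` of `P_k`; they cancel, so the
    -- metric is symmetric for every `k`.
    have h3 := (congrArg (fun c => lam (((-1 : ℂ) : OnePoint ℂ)) ^ (-k) * c) h1).symm.trans
      (h.trans (congrArg (fun c => (-1) ^ k * (lam ((1 : ℂ) : OnePoint ℂ) ^ (-k) * c)) h2))
    have h4 : ((-1 : ℂ)) ^ k ≠ 0 := zpow_ne_zero _ (by norm_num)
    rw [lam_coe, lam_coe, one_zpow, one_mul, zpow_neg, ← inv_zpow] at h3
    have h5 : ((-1 : ℂ))⁻¹ = -1 := by norm_num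
    rw [h5] at h3
    exact mul_left_cancel₀ h4 h3
  g_nondegenerate k x := nondegenerate_compl₁₂ (hT.pairing_nondegenerate k _) _ _
  g_flat k s t x hs ht a := (hΦ.metricZero_identities hT hs ht a).1
  g_higgs k x a v hv w hw := by
    obtain ⟨s, hs, rfl⟩ := (isHolSubbundle_weightZero hT k).exists_section hv
    obtain ⟨t, ht, rfl⟩ := (isHolSubbundle_weightZero hT k).exists_section hw
    exact (hΦ.metricZero_identities hT hs ht a).2.1
  g_endV k x v hv w hw := by
    obtain ⟨s, hs, rfl⟩ := (isHolSubbundle_weightZero hT k).exists_section hv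
    obtain ⟨t, ht, rfl⟩ := (isHolSubbundle_weightZero hT k).exists_section hw
    exact (hΦ.metricZero_identities hT hs ht 0).2.2

end Metric

/-! ### Transport along isomorphisms of holomorphic bundles -/

section Transport

variable {EB HB : Type*} [NormedAddCommGroup EB] [NormedSpace ℂ EB] [FiniteDimensional ℂ EB]
  [TopologicalSpace HB]
  {I : ModelWithCorners ℂ EB HB} {B : Type*} [TopologicalSpace B] [ChartedSpace HB B]
  [IsManifold I ω B] [IsManifold I 1 B]
  {F : Type*} [NormedAddCommGroup F] [NormedSpace ℂ F] [FiniteDimensional ℂ F]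
  {V : B → Type*} [TopologicalSpace (TotalSpace F V)]
  [∀ x, AddCommGroup (V x)] [∀ x, Module ℂ (V x)] [∀ x, TopologicalSpace (V x)]
  [∀ x, IsTopologicalAddGroup (V x)] [∀ x, ContinuousSMul ℂ (V x)]
  [FiberBundle F V] [VectorBundle ℂ F V] [ContMDiffVectorBundle ω F V I]
  {F' : Type*} [NormedAddCommGroup F'] [NormedSpace ℂ F'] [FiniteDimensional ℂ F']
  {V' : B → Type*} [TopologicalSpace (TotalSpace F' V')]
  [∀ x, AddCommGroup (V' x)] [∀ x, Module ℂ (V' x)] [∀ x, TopologicalSpace (V' x)]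
  [∀ x, IsTopologicalAddGroup (V' x)] [∀ x, ContinuousSMul ℂ (V' x)]
  [FiberBundle F' V'] [VectorBundle ℂ F' V'] [ContMDiffVectorBundle ω F' V' I]

variable (I F F') in
/-- A fibrewise linear isomorphism which identifies the holomorphic sections. -/
def IsHolIso (ψ : Π x, V x ≃ₗ[ℂ] V' x) : Prop :=
  ∀ (σ : Π x, V x) (x : B), HolAt I F σ x ↔ HolAt I F' (fun y => ψ y (σ y)) x

/-- The pull-back of an operator along a fibrewise isomorphism. -/
def pullConn (ψ : Π x, V x ≃ₗ[ℂ] V' x)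
    (D : (Π x : B, V' x) → Π x : B, TangentSpace I x →L[ℂ] V' x)
    (σ : Π x, V x) (x : B) : TangentSpace I x →L[ℂ] V x :=
  LinearMap.toContinuousLinearMap
    ((ψ x).symm.toLinearMap ∘ₗ (D (fun y => ψ y (σ y)) x).toLinearMap)

omit [IsManifold I ω B] [IsManifold I 1 B] [FiniteDimensional ℂ F] [FiniteDimensional ℂ F']
  [∀ x, IsTopologicalAddGroup (V' x)] [∀ x, ContinuousSMul ℂ (V' x)] in
theorem apply_pullConn (ψ : Π x, V x ≃ₗ[ℂ] V' x)
    (D : (Π x : B, V' x) → Π x : B, TangentSpace I x →L[ℂ] V' x)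
    (σ : Π x, V x) (x : B) (v : TangentSpace I x) :
    ψ x (pullConn ψ D σ x v) = D (fun y => ψ y (σ y)) x v :=
  (ψ x).apply_symm_apply _

variable {ψ : Π x, V x ≃ₗ[ℂ] V' x} (hψ : IsHolIso I F F' ψ)

include hψ

theorem IsHolIso.symm_iff (σ : Π x, V' x) (x : B) :
    HolAt I F (fun y => (ψ y).symm (σ y)) x ↔ HolAt I F' σ x := by
  rw [hψ]
  simp

theorem IsHolIso.diffAt_iff (σ : Π x, V x) (x : B) :
    DiffAt I F σ x ↔ DiffAt I F' (fun y => ψ y (σ y)) x := by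
  have h : ∀ σ, HolAt I F σ x → HolAt I F' (fun y => (ψ y).toLinearMap (σ y)) x :=
    fun σ => (hψ σ x).1
  exact ⟨fun hσ => DiffAt.map h hσ, fun hσ => DiffAt.of_map h (ψ x).injective hσ⟩

theorem IsHolIso.isHolConnection {S : Set B}
    {D : (Π x : B, V' x) → Π x : B, TangentSpace I x →L[ℂ] V' x}
    (hD : IsHolConnection I F' S D) : IsHolConnection I F S (pullConn ψ D) where
  covariant :=
    { add := by
        intro σ τ x hσ hτ hx
        ext v
        apply (ψ x).injective
        rw [add_apply, map_add, apply_pullConn, apply_pullConn, apply_pullConn]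
        have h := hD.covariant.add ((hψ.diffAt_iff σ x).1 hσ) ((hψ.diffAt_iff τ x).1 hτ) hx
        refine Eq.trans ?_ (congrArg (fun L => L v) h)
        congr 2
        funext y
        exact map_add (ψ y) _ _
      leibniz := by
        intro σ g x hσ hg hx
        ext v
        apply (ψ x).injective
        have h1 : (g x • pullConn ψ D σ x + (mvfderiv I g x).smulRight (σ x)) v =
          g x • pullConn ψ D σ x v + mvfderiv I g x v • σ x := rfl
        rw [h1, map_add, map_smul, map_smul, apply_pullConn, apply_pullConn]
        have h := hD.covariant.leibniz ((hψ.diffAt_iff σ x).1 hσ) hg hx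
        refine Eq.trans ?_ (congrArg (fun L => L v) h)
        congr 2
        funext y
        exact map_smul (ψ y) _ _ }
  holomorphic σ X x hx hσ hX := by
    rw [hψ]
    simp_rw [apply_pullConn]
    exact hD.holomorphic _ _ x hx ((hψ σ x).1 hσ) hX
  normalized σ x h := by
    ext v
    apply (ψ x).injective
    rw [apply_pullConn, hD.normalized _ x fun h' => h ⟨h'.1, (hψ.diffAt_iff σ x).2 h'.2⟩]
    exact (map_zero _).symm

theorem IsHolIso.isFlat {S : Set B}
    {D : (Π x : B, V' x) → Π x : B, TangentSpace I x →L[ℂ] V' x}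
    (hD : IsFlat I F' S D) : IsFlat I F S (pullConn ψ D) := by
  intro σ X Y x hx hσ hX hY
  apply (ψ x).injective
  rw [map_sub, map_sub, apply_pullConn, apply_pullConn, apply_pullConn]
  simp_rw [apply_pullConn]
  rw [map_zero]
  exact hD _ X Y x hx ((hψ σ x).1 hσ) hX hY

theorem IsHolIso.isHolSubbundle {W : Π x, Submodule ℂ (V x)} {W' : Π x, Submodule ℂ (V' x)}
    (hW : ∀ x v, v ∈ W x ↔ ψ x v ∈ W' x) (h : IsHolSubbundle I F' W') : IsHolSubbundle I F W := by
  intro x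
  obtain ⟨r, s, hs⟩ := h x
  refine ⟨r, fun i y => (ψ y).symm (s i y), ?_⟩
  filter_upwards [hs] with y hy
  refine ⟨fun i => (hψ.symm_iff _ y).2 (hy.1 i), hy.2.1.map' (ψ y).symm.toLinearMap
    (LinearEquiv.ker _), ?_⟩
  ext v
  rw [hW, ← hy.2.2]
  have e : (range fun i => (ψ y).symm (s i y)) = (ψ y).symm '' range fun i => s i y := by
    rw [← range_comp]
    rfl
  rw [e]
  have h1 := Submodule.map_span (ψ y).symm.toLinearMap (range fun i => s i y)
  have h2 : Submodule.span ℂ ((ψ y).symm '' range fun i => s i y) =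
    (Submodule.span ℂ (range fun i => s i y)).map (ψ y).symm.toLinearMap := h1.symm
  rw [h2]
  constructor
  · rintro ⟨w, hw, rfl⟩
    rw [LinearEquiv.coe_coe, LinearEquiv.apply_symm_apply]
    exact hw
  · intro hv
    exact ⟨ψ y v, hv, (ψ y).symm_apply_apply v⟩

theorem IsHolIso.isSubbundleFiltration {W : ℤ → Π x, Submodule ℂ (V x)}
    {W' : ℤ → Π x, Submodule ℂ (V' x)} (hW : ∀ k x v, v ∈ W k x ↔ ψ x v ∈ W' k x)
    (h : IsSubbundleFiltration I F' W') : IsSubbundleFiltration I F W where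
  mono k x v hv := (hW k x v).2 (h.mono k x ((hW _ x v).1 hv))
  exhaustive x := by
    obtain ⟨k, hk⟩ := h.exhaustive x
    exact ⟨k, Submodule.eq_top_iff'.2 fun v => (hW k x v).2 (hk ▸ Submodule.mem_top)⟩
  separated x := by
    obtain ⟨k, hk⟩ := h.separated x
    refine ⟨k, (Submodule.eq_bot_iff _).2 fun v hv => ?_⟩
    have h1 := (hW k x v).1 hv
    rw [hk, Submodule.mem_bot] at h1
    exact (ψ x).map_eq_zero_iff.1 h1
  subbundle k := hψ.isHolSubbundle (hW k) (h.subbundle k)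

theorem IsHolIso.holSectionAt_iff {W : Π x, Submodule ℂ (V x)} {W' : Π x, Submodule ℂ (V' x)}
    (hW : ∀ x v, v ∈ W x ↔ ψ x v ∈ W' x) (s : Π x, V x) (x : B) :
    HolSectionAt I F W s x ↔ HolSectionAt I F' W' (fun y => ψ y (s y)) x := by
  rw [HolSectionAt, HolSectionAt, hψ]
  simp_rw [hW]

end Transport

theorem cov_neg {EB HB : Type*} [NormedAddCommGroup EB] [NormedSpace ℂ EB] [TopologicalSpace HB]
    {I : ModelWithCorners ℂ EB HB} {B : Type*} [TopologicalSpace B] [ChartedSpace HB B]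
    {F : Type*} [NormedAddCommGroup F] [NormedSpace ℂ F]
    {V : B → Type*} [TopologicalSpace (TotalSpace F V)]
    [∀ x, AddCommGroup (V x)] [∀ x, Module ℂ (V x)] [∀ x, TopologicalSpace (V x)]
    [∀ x, IsTopologicalAddGroup (V x)] [∀ x, ContinuousSMul ℂ (V x)] [FiberBundle F V]
    [VectorBundle ℂ F V]
    {S : Set B} {D : (Π x : B, V x) → Π x : B, TangentSpace I x →L[ℂ] V x}
    (hD : IsCovariantDerivativeOn F D S) {x : B} (hx : x ∈ S) {σ : Π x, V x}
    (hσ : DiffAt I F σ x) : D (fun y => -σ y) x = -D σ x := by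
  have h := hD.smul_const (-1) hσ hx
  have e : ((-1 : ℂ) • σ) = fun y => -σ y := by
    funext y
    exact neg_one_smul ℂ (σ y)
  rw [e] at h
  exact h.trans (neg_one_smul ℂ (D σ x))

/-! ### The mixed Frobenius structure defined by a primitive homogeneous section -/

section Primitive

variable {E : Type*} [NormedAddCommGroup E] [NormedSpace ℂ E] [FiniteDimensional ℂ E]
  {M : Type*} [TopologicalSpace M] [ChartedSpace E M] [IsManifold 𝓘(ℂ, E) ω M]
  {F : Type*} [NormedAddCommGroup F] [NormedSpace ℂ F] [FiniteDimensional ℂ F]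
  {V : M → Type*} [TopologicalSpace (TotalSpace F V)]
  [∀ x, AddCommGroup (V x)] [∀ x, Module ℂ (V x)] [∀ x, TopologicalSpace (V x)]
  [∀ x, IsTopologicalAddGroup (V x)] [∀ x, ContinuousSMul ℂ (V x)]
  [FiberBundle F V] [VectorBundle ℂ F V] [ContMDiffVectorBundle ω F V 𝓘(ℂ, E)]

/-- A primitive homogeneous section of a Frobenius type structure. -/
structure IsPrimitive (Φ : FrobeniusTypeStructure 𝓘(ℂ, E) F V) (ζ : Π x, V x) (d : ℂ) : Prop where
  holomorphic : ∀ x, HolAt 𝓘(ℂ, E) F ζ x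
  flat : ∀ x, Φ.conn ζ x = 0
  bijective : ∀ x, Function.Bijective fun a : TangentSpace 𝓘(ℂ, E) x => Φ.higgs x a (ζ x)
  homogeneous : ∀ x, Φ.endV x (ζ x) = (d / 2) • ζ x

variable {Φ : FrobeniusTypeStructure 𝓘(ℂ, E) F V} {ζ : Π x, V x} {d : ℂ}
  (hζ : IsPrimitive Φ ζ d)

/-- The isomorphism `-𝒞_• ζ`. -/
def primEquiv (x : M) : TangentSpace 𝓘(ℂ, E) x ≃ₗ[ℂ] V x :=
  LinearEquiv.ofBijective (-(Φ.higgs x).flip (ζ x)) <| by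
    have h := (Equiv.neg (V x)).bijective.comp (hζ.bijective x)
    exact h

theorem primEquiv_apply (x : M) (a : TangentSpace 𝓘(ℂ, E) x) :
    primEquiv hζ x a = -Φ.higgs x a (ζ x) :=
  rfl

theorem isHolIso_primEquiv : IsHolIso 𝓘(ℂ, E) E F (primEquiv hζ) := by
  have h : ∀ (σ : Π x : M, TangentSpace 𝓘(ℂ, E) x) (x : M), HolAt 𝓘(ℂ, E) E σ x →
      HolAt 𝓘(ℂ, E) F (fun y => (primEquiv hζ y).toLinearMap (σ y)) x := fun σ x hσ =>
    (Φ.isHiggsField.holomorphic ζ σ x (hζ.holomorphic x) hσ).neg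
  exact fun σ x => ⟨h σ x, fun hσ =>
    HolAt.of_map (fun σ hσ => h σ x hσ) (primEquiv hζ x).injective hσ⟩

/-- The Higgs field on the tangent bundle induced by a primitive section. -/
def primHiggs (x : M) : TangentSpace 𝓘(ℂ, E) x →ₗ[ℂ] TangentSpace 𝓘(ℂ, E) x →ₗ[ℂ]
    TangentSpace 𝓘(ℂ, E) x where
  toFun a := (primEquiv hζ x).symm.toLinearMap ∘ₗ Φ.higgs x a ∘ₗ (primEquiv hζ x).toLinearMap
  map_add' a b := by
    rw [map_add, LinearMap.add_comp, LinearMap.comp_add]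
  map_smul' c a := by
    rw [map_smul, LinearMap.smul_comp, LinearMap.comp_smul, RingHom.id_apply]

theorem primEquiv_primHiggs (x : M) (a b : TangentSpace 𝓘(ℂ, E) x) :
    primEquiv hζ x (primHiggs hζ x a b) = Φ.higgs x a (primEquiv hζ x b) :=
  (primEquiv hζ x).apply_symm_apply _

/-- The unit field. -/
def primUnit (x : M) : TangentSpace 𝓘(ℂ, E) x :=
  (primEquiv hζ x).symm (ζ x)

/-- The Euler field. -/
def primEuler (x : M) : TangentSpace 𝓘(ℂ, E) x :=
  (primEquiv hζ x).symm (Φ.endU x (ζ x))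

theorem primEquiv_primUnit (x : M) : primEquiv hζ x (primUnit hζ x) = ζ x :=
  (primEquiv hζ x).apply_symm_apply _

theorem primEquiv_primEuler (x : M) : primEquiv hζ x (primEuler hζ x) = Φ.endU x (ζ x) :=
  (primEquiv hζ x).apply_symm_apply _

/-- Both sides correspond under `-𝒞_• ζ` to values of the commuting operators `𝒞_a 𝒞_b` on `ζ`. -/
theorem primHiggs_symm (x : M) (a b : TangentSpace 𝓘(ℂ, E) x) :
    primHiggs hζ x a b = primHiggs hζ x b a := by
  apply (primEquiv hζ x).injective
  rw [primEquiv_primHiggs, primEquiv_primHiggs, primEquiv_apply, primEquiv_apply, map_neg, map_neg,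
    Φ.isHiggsField.comm]

theorem primHiggs_primUnit (x : M) (a : TangentSpace 𝓘(ℂ, E) x) :
    primHiggs hζ x (primUnit hζ x) a = -a := by
  rw [primHiggs_symm]
  apply (primEquiv hζ x).injective
  rw [primEquiv_primHiggs, primEquiv_primUnit, map_neg, primEquiv_apply, neg_neg]

/-- The relation `[𝒞, 𝒰] = 0` applied to `ζ`: in terms of `ψ = -𝒞_• ζ`, the operator `θ_E` is `-𝒰`.
-/
theorem primHiggs_primEuler (x : M) (a : TangentSpace 𝓘(ℂ, E) x) :
    primEquiv hζ x (primHiggs hζ x (primEuler hζ x) a) = -Φ.endU x (primEquiv hζ x a) := by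
  rw [primHiggs_symm, primEquiv_primHiggs, primEquiv_primEuler, primEquiv_apply, map_neg, neg_neg]
  exact sub_eq_zero.1 (Φ.higgs_endU x a (ζ x))

theorem pullConn_primUnit (x : M) : pullConn (primEquiv hζ) Φ.conn (primUnit hζ) x = 0 := by
  ext a
  apply (primEquiv hζ x).injective
  rw [apply_pullConn]
  simp_rw [primEquiv_primUnit]
  rw [hζ.flat]
  exact (map_zero _).symm

/-- The equation `∇ʳ(𝒰) - [𝒞, 𝒱] + 𝒞 = 0` applied to `ζ`, with `∇ʳ ζ = 0` and `𝒱 ζ = (d/2) ζ`. The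
`1` comes from the last term `𝒞`, the `-d/2` from `𝒞 𝒱 ζ`. -/
theorem pullConn_primEuler (x : M) (a : TangentSpace 𝓘(ℂ, E) x) :
    primEquiv hζ x (pullConn (primEquiv hζ) Φ.conn (primEuler hζ) x a) =
      (1 - d / 2) • primEquiv hζ x a + Φ.endV x (primEquiv hζ x a) := by
  rw [apply_pullConn]
  simp_rw [primEquiv_primEuler]
  have h := Φ.conn_endU ζ x a (hζ.holomorphic x)
  rw [hζ.flat, hζ.homogeneous, map_smul] at h
  have h0 : Φ.endU x ((0 : TangentSpace 𝓘(ℂ, E) x →L[ℂ] V x) a) = 0 := map_zero _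
  rw [h0, sub_zero] at h
  rw [primEquiv_apply, map_neg]
  linear_combination (norm := module) h

/-- This is `∇ʳ(𝒞) = 0` evaluated on the flat section `ζ`. -/
theorem prim_torsionFree (X Y : Π x : M, TangentSpace 𝓘(ℂ, E) x) (x : M)
    (hX : HolAt 𝓘(ℂ, E) E X x) (hY : HolAt 𝓘(ℂ, E) E Y x) :
    pullConn (primEquiv hζ) Φ.conn Y x (X x) - pullConn (primEquiv hζ) Φ.conn X x (Y x) =
      VectorField.mlieBracket 𝓘(ℂ, E) X Y x := by
  apply (primEquiv hζ x).injective
  rw [map_sub, apply_pullConn, apply_pullConn]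
  simp_rw [primEquiv_apply]
  have hc := Φ.isHolConnection.covariant
  rw [cov_neg hc (mem_univ x) (Φ.isHiggsField.holomorphic ζ Y x (hζ.holomorphic x) hY).diffAt,
    cov_neg hc (mem_univ x) (Φ.isHiggsField.holomorphic ζ X x (hζ.holomorphic x) hX).diffAt]
  have h := Φ.conn_higgs ζ X Y x (hζ.holomorphic x) hX hY
  have h0 : ∀ a b : TangentSpace 𝓘(ℂ, E) x,
      Φ.higgs x b ((0 : TangentSpace 𝓘(ℂ, E) x →L[ℂ] V x) a) = 0 := fun a b => map_zero _
  rw [hζ.flat, h0, h0, sub_zero, sub_zero] at h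
  rw [neg_apply, neg_apply]
  linear_combination (norm := module) (-1 : ℂ) • h

theorem holAt_primEuler (x : M) : HolAt 𝓘(ℂ, E) E (primEuler hζ) x :=
  ((isHolIso_primEquiv hζ).symm_iff _ x).2 (Φ.holomorphic_endU ζ x (hζ.holomorphic x))

/-- The Saito structure induced by a primitive section. -/
def primSaito (hhat : IsFlat (modelP E) E (regularLocus M)
    (hatConn 0 (pullConn (primEquiv hζ) Φ.conn) (primHiggs hζ) (primEuler hζ))) :
    SaitoStructure E M where
  conn := pullConn (primEquiv hζ) Φ.conn
  θ := primHiggs hζ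
  unit := primUnit hζ
  euler := primEuler hζ
  isHolConnection := (isHolIso_primEquiv hζ).isHolConnection Φ.isHolConnection
  isFlat := (isHolIso_primEquiv hζ).isFlat Φ.isFlat
  torsionFree := prim_torsionFree hζ
  isHiggsField :=
    { holomorphic := fun s X x hs hX => by
        rw [isHolIso_primEquiv hζ]
        simp_rw [primEquiv_primHiggs]
        exact Φ.isHiggsField.holomorphic _ X x ((isHolIso_primEquiv hζ s x).1 hs) hX
      comm := fun x a b c => by
        apply (primEquiv hζ x).injective
        rw [primEquiv_primHiggs, primEquiv_primHiggs, primEquiv_primHiggs, primEquiv_primHiggs,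
          Φ.isHiggsField.comm] }
  θ_symm := primHiggs_symm hζ
  holomorphic_unit x := ((isHolIso_primEquiv hζ).symm_iff _ x).2 (hζ.holomorphic x)
  holomorphic_euler := holAt_primEuler hζ
  conn_unit := pullConn_primUnit hζ
  θ_unit := primHiggs_primUnit hζ
  isFlat_hat := hhat

variable (W : ℤ → Π x : M, Submodule ℂ (V x))

/-- The filtration of the tangent bundle. -/
def primFilt (k : ℤ) (x : M) : Submodule ℂ (TangentSpace 𝓘(ℂ, E) x) :=
  (W k x).comap (primEquiv hζ x).toLinearMap

theorem mem_primFilt (k : ℤ) (x : M) (a : TangentSpace 𝓘(ℂ, E) x) :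
    a ∈ primFilt hζ W k x ↔ primEquiv hζ x a ∈ W k x :=
  Iff.rfl

/-- The isomorphism on graded pieces. -/
def primGr (k : ℤ) (x : M) : Gr (primFilt hζ W) k x ≃ₗ[ℂ] Gr W k x :=
  grEquiv (primEquiv hζ x) (fun k a => mem_primFilt hζ W k x a) k

variable {W} (g : Π (k : ℤ) (x : M), Gr W k x →ₗ[ℂ] Gr W k x →ₗ[ℂ] ℂ)

/-- The metrics on the graded pieces of the tangent bundle. -/
def primMetric (k : ℤ) (x : M) :
    Gr (primFilt hζ W) k x →ₗ[ℂ] Gr (primFilt hζ W) k x →ₗ[ℂ] ℂ :=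
  (g k x).compl₁₂ (primGr hζ W k x).toLinearMap (primGr hζ W k x).toLinearMap

theorem primMetric_toGr (k : ℤ) (x : M) (a b : TangentSpace 𝓘(ℂ, E) x) :
    primMetric hζ g k x (toGr (primFilt hζ W) k x a) (toGr (primFilt hζ W) k x b) =
      g k x (toGr W k x (primEquiv hζ x a)) (toGr W k x (primEquiv hζ x b)) :=
  congrArg₂ (fun p q => g k x p q)
    (grEquiv_toGr _ (fun k a => mem_primFilt hζ W k x a) k a)
    (grEquiv_toGr _ (fun k a => mem_primFilt hζ W k x a) k b)

variable {g} (hg : IsFilteredMetric Φ W g)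

include hg

theorem primConn_mem {k : ℤ} {s : Π x : M, TangentSpace 𝓘(ℂ, E) x} {x : M}
    (hs : HolSectionAt 𝓘(ℂ, E) E (primFilt hζ W k) s x) (a : TangentSpace 𝓘(ℂ, E) x) :
    pullConn (primEquiv hζ) Φ.conn s x a ∈ primFilt hζ W k x := by
  rw [mem_primFilt, apply_pullConn]
  exact hg.conn_mem k _ x (((isHolIso_primEquiv hζ).holSectionAt_iff
    (mem_primFilt hζ W k) s x).1 hs) a

-- Torsion-freeness, `[E, s] = ∇_E s - ∇_s E`, with `∇_s E` taken from `pullConn_primEuler`.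
omit hg in
theorem prim_bracket {s : Π x : M, TangentSpace 𝓘(ℂ, E) x} {x : M} (hs : HolAt 𝓘(ℂ, E) E s x) :
    primEquiv hζ x (VectorField.mlieBracket 𝓘(ℂ, E) (primEuler hζ) s x) =
      primEquiv hζ x (pullConn (primEquiv hζ) Φ.conn s x (primEuler hζ x)) -
        ((1 - d / 2) • primEquiv hζ x (s x) + Φ.endV x (primEquiv hζ x (s x))) := by
  rw [← prim_torsionFree hζ _ _ x (holAt_primEuler hζ x) hs, map_sub, pullConn_primEuler]

/-- The terms with `∇_E` cancel by flatness of the metric. What is left is `g(∇_s E, t) + g(s, ∇_t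
E)`, where the scalar `1 - d/2` gives `2 - d` and `𝒱 + 𝒱^*` gives `k`. -/
theorem prim_metric_bracket {k : ℤ} {s t : Π x : M, TangentSpace 𝓘(ℂ, E) x} {x : M}
    (hs : HolSectionAt 𝓘(ℂ, E) E (primFilt hζ W k) s x)
    (ht : HolSectionAt 𝓘(ℂ, E) E (primFilt hζ W k) t x) :
    mvfderiv 𝓘(ℂ, E) (fun y => primMetric hζ g k y (toGr (primFilt hζ W) k y (s y))
        (toGr (primFilt hζ W) k y (t y))) x (primEuler hζ x)
      - primMetric hζ g k x (toGr (primFilt hζ W) k x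
          (VectorField.mlieBracket 𝓘(ℂ, E) (primEuler hζ) s x)) (toGr (primFilt hζ W) k x (t x))
      - primMetric hζ g k x (toGr (primFilt hζ W) k x (s x)) (toGr (primFilt hζ W) k x
          (VectorField.mlieBracket 𝓘(ℂ, E) (primEuler hζ) t x)) =
      (2 - d + k) * primMetric hζ g k x (toGr (primFilt hζ W) k x (s x))
        (toGr (primFilt hζ W) k x (t x)) := by
  have hs' := ((isHolIso_primEquiv hζ).holSectionAt_iff (mem_primFilt hζ W k) s x).1 hs
  have ht' := ((isHolIso_primEquiv hζ).holSectionAt_iff (mem_primFilt hζ W k) t x).1 ht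
  have hsx := hs'.2.self_of_nhds
  have htx := ht'.2.self_of_nhds
  simp_rw [primMetric_toGr]
  rw [hg.g_flat k _ _ x hs' ht', prim_bracket hζ hs.1, prim_bracket hζ ht.1]
  have h := hg.g_endV k x _ hsx _ htx
  have hVs := hg.endV_mem k x _ hsx
  have hVt := hg.endV_mem k x _ htx
  have hDs := hg.conn_mem k _ x hs' (primEuler hζ x)
  have hDt := hg.conn_mem k _ x ht' (primEuler hζ x)
  rw [apply_pullConn, apply_pullConn,
    toGr_sub hDs (add_mem (Submodule.smul_mem _ _ hsx) hVs),
    toGr_add (Submodule.smul_mem _ _ hsx) hVs, toGr_smul _ hsx,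
    toGr_sub hDt (add_mem (Submodule.smul_mem _ _ htx) hVt),
    toGr_add (Submodule.smul_mem _ _ htx) hVt, toGr_smul _ htx]
  simp only [map_sub, map_add, map_smul, LinearMap.sub_apply, LinearMap.add_apply,
    LinearMap.smul_apply, smul_eq_mul]
  linear_combination h

/-- The mixed Frobenius structure induced by a primitive homogeneous section. -/
def primMFS (hhat : IsFlat (modelP E) E (regularLocus M)
    (hatConn 0 (pullConn (primEquiv hζ) Φ.conn) (primHiggs hζ) (primEuler hζ))) :
    MixedFrobeniusStructure E M d where
  toSaitoStructure := primSaito hζ hhat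
  filt := primFilt hζ W
  g := primMetric hζ g
  isFiltration := (isHolIso_primEquiv hζ).isSubbundleFiltration
    (fun k x v => mem_primFilt hζ W k x v) hg.isFiltration
  θ_invariant k x a b hb := by
    rw [mem_primFilt]
    exact (primEquiv_primHiggs hζ x a b).symm ▸ hg.higgs_mem k x a _ hb
  flat_filt k s x hs a := primConn_mem hζ hg hs a
  euler_closed k s x hs := by
    rw [mem_primFilt]
    refine (prim_bracket hζ hs.1).symm ▸ ?_
    have hsx := hs.2.self_of_nhds
    exact sub_mem (primConn_mem hζ hg hs _) (add_mem (Submodule.smul_mem _ _ hsx)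
      (hg.endV_mem k x _ hsx))
  g_holomorphic k s t x hs ht := by
    simp_rw [primMetric_toGr]
    exact hg.g_holomorphic k _ _ x
      (((isHolIso_primEquiv hζ).holSectionAt_iff (mem_primFilt hζ W k) s x).1 hs)
      (((isHolIso_primEquiv hζ).holSectionAt_iff (mem_primFilt hζ W k) t x).1 ht)
  g_symm k x a b := hg.g_symm k x _ _
  g_nondegenerate k x := nondegenerate_compl₁₂ (hg.g_nondegenerate k x) _ _
  g_flat k s t x hs ht a := by
    simp_rw [primMetric_toGr]
    refine (hg.g_flat k _ _ x
      (((isHolIso_primEquiv hζ).holSectionAt_iff (mem_primFilt hζ W k) s x).1 hs)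
      (((isHolIso_primEquiv hζ).holSectionAt_iff (mem_primFilt hζ W k) t x).1 ht) a).trans ?_
    rw [← apply_pullConn, ← apply_pullConn]
    rfl
  g_θ k x a b hb c hc := by
    rw [primMetric_toGr, primMetric_toGr]
    have h := hg.g_higgs k x a _ hb _ hc
    exact (primEquiv_primHiggs hζ x a b).symm ▸ (primEquiv_primHiggs hζ x a c).symm ▸ h
  lie_g k s t x hs ht := prim_metric_bracket hζ hg hs ht

end Primitive

/-! ### The meromorphic connection on `p^* Θ_M` as a covariant derivative -/

section HatConnection

variable {E : Type*} [NormedAddCommGroup E] [NormedSpace ℂ E] [FiniteDimensional ℂ E]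
  {M : Type*} [TopologicalSpace M] [ChartedSpace E M] [IsManifold 𝓘(ℂ, E) ω M]

/-- The restriction of a section of `p^* Θ_M` to `{p} × M`. -/
def tangentSlice (p : OnePoint ℂ) (σ : Π z, PTangent E M z) (x : M) : TangentSpace 𝓘(ℂ, E) x :=
  σ (p, x)

/-- The derivative of a section of `p^* Θ_M` along `ℙ¹`. -/
def lamDeriv (μ : ℂ) (σ : Π z, PTangent E M z) (x : M) : TangentSpace 𝓘(ℂ, E) x :=
  (deriv (fun ν : ℂ => (σ ((ν : OnePoint ℂ), x) : E)) μ : E)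

theorem diffAt_tangentSlice {σ : Π z, PTangent E M z} {p : OnePoint ℂ} {x : M}
    (hσ : DiffAt (modelP E) E σ (p, x)) : DiffAt 𝓘(ℂ, E) E (tangentSlice p σ) x := by
  have h := (diffAt_pullback_iff (I' := modelP E) ContMDiffMap.snd).1 hσ
  refine diffAt_iff.2 ?_
  have h1 : MDifferentiableAt 𝓘(ℂ, E) (modelP E) (fun y : M => (p, y)) x :=
    (contMDiff_slice (E := E) p).contMDiffAt.mdifferentiableAt (by simp)
  exact MDifferentiableAt.comp (I' := modelP E) (f := fun y : M => (p, y))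
    (g := fun w => (trivializationAt E (TangentSpace 𝓘(ℂ, E)) x
      ⟨w.2, (σ w : TangentSpace 𝓘(ℂ, E) w.2)⟩).2) x h h1

/-- Along `ℙ¹ × {x}` the fibre of `p^* Θ_M` is fixed, and the trivialisation at `x` is the identity
on it; so differentiability of the section is that of a vector-valued function. -/
theorem hasDerivAt_lamDeriv {σ : Π z, PTangent E M z} {μ : ℂ} {x : M}
    (hσ : DiffAt (modelP E) E σ ((μ : OnePoint ℂ), x)) :
    HasDerivAt (fun ν : ℂ => (σ ((ν : OnePoint ℂ), x) : E)) (lamDeriv μ σ x : E) μ := by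
  refine DifferentiableAt.hasDerivAt ?_
  have h := (diffAt_pullback_iff (I' := modelP E) ContMDiffMap.snd).1 hσ
  have h1 := MDifferentiableAt.comp (μ : OnePoint ℂ) h
    ((contMDiff_slice_snd x).contMDiffAt.mdifferentiableAt (by simp))
  have h2 := (MDifferentiableAt.comp μ h1
    (contMDiff_coe.contMDiffAt.mdifferentiableAt (by simp))).differentiableAt
  refine h2.congr_of_eventuallyEq (Eventually.of_forall fun ν => ?_)
  have hx := mem_chart_source E x
  have h3 := TangentBundle.continuousLinearMapAt_trivializationAt (I := 𝓘(ℂ, E)) hx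
  have h4 := DFunLike.congr_fun h3 (tangentSlice (ν : OnePoint ℂ) σ x)
  rw [Trivialization.continuousLinearMapAt_apply, Trivialization.coe_linearMapAt_of_mem _
    (by simp), mfderiv_extChartAt_self] at h4
  exact h4.symm

variable {c : ℂ} {conn : (Π x : M, TangentSpace 𝓘(ℂ, E) x) →
      Π x : M, TangentSpace 𝓘(ℂ, E) x →L[ℂ] TangentSpace 𝓘(ℂ, E) x}
    {θ : Π x : M, TangentSpace 𝓘(ℂ, E) x →ₗ[ℂ] TangentSpace 𝓘(ℂ, E) x →ₗ[ℂ]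
      TangentSpace 𝓘(ℂ, E) x}
    {eul : Π x : M, TangentSpace 𝓘(ℂ, E) x}

/-- The value of `hatConn` as a linear expression. -/
def hatVal {V : Type*} [AddCommGroup V] [Module ℂ V] (μ a c : ℂ) (A B C : V →ₗ[ℂ] V) (p s l : V) :
    V :=
  p + μ⁻¹ • A s + a • (l - μ⁻¹ • (μ⁻¹ • B s + C s) + μ⁻¹ • c • s)

theorem hatVal_add {V : Type*} [AddCommGroup V] [Module ℂ V] (μ a c : ℂ) (A B C : V →ₗ[ℂ] V)
    (p s l p' s' l' : V) : hatVal μ a c A B C (p + p') (s + s') (l + l') =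
      hatVal μ a c A B C p s l + hatVal μ a c A B C p' s' l' := by
  simp only [hatVal, map_add]
  module

theorem hatVal_leibniz {V : Type*} [AddCommGroup V] [Module ℂ V] (μ a c : ℂ) (A B C : V →ₗ[ℂ] V)
    (p s l : V) (f dx dl : ℂ) : hatVal μ a c A B C (f • p + dx • s) (f • s) (f • l + dl • s) =
      f • hatVal μ a c A B C p s l + (a * dl + dx) • s := by
  simp only [hatVal, map_smul]
  module

theorem hatConn_apply {σ : Π z, PTangent E M z} {μ : ℂ} (hμ : μ ≠ 0) {x : M}
    (hσ : DiffAt (modelP E) E σ ((μ : OnePoint ℂ), x)) (a : ℂ) (v : TangentSpace 𝓘(ℂ, E) x) :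
    hatConn c conn θ eul σ ((μ : OnePoint ℂ), x) (tangentVec ((μ : OnePoint ℂ), x) a v) =
      hatVal μ a c (θ x v) (θ x (eul x)) (conn eul x).toLinearMap
        (conn (tangentSlice (μ : OnePoint ℂ) σ) x v) (tangentSlice (μ : OnePoint ℂ) σ x)
        (lamDeriv μ σ x) :=
  DFunLike.congr_fun (if_pos ⟨coe_mem_regularLocus hμ x, hσ⟩ :
    hatConn c conn θ eul σ ((μ : OnePoint ℂ), x) = _) _

theorem hatConn_normalized (σ : Π z, PTangent E M z) (z : OnePoint ℂ × M)
    (h : ¬ (z ∈ regularLocus M ∧ DiffAt (modelP E) E σ z)) :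
    hatConn c conn θ eul σ z = 0 :=
  if_neg h

theorem tangent_clm_ext {G : Type*} [AddCommGroup G] [Module ℂ G] [TopologicalSpace G]
    {p : OnePoint ℂ} {x : M} {L L' : TangentSpace (modelP E) (p, x) →L[ℂ] G}
    (h : ∀ (a : ℂ) (v : TangentSpace 𝓘(ℂ, E) x),
      L (tangentVec (p, x) a v) = L' (tangentVec (p, x) a v)) : L = L' :=
  ContinuousLinearMap.ext fun w => h w.1 w.2

/-- The inclusion of `ℂ` in the sphere is inverse to `lam`, whose derivative is the identity; hence
so is its own. -/
theorem mvfderiv_coe_apply {f : OnePoint ℂ → ℂ} {μ : ℂ}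
    (hf : MDifferentiableAt 𝓘(ℂ, ℂ) 𝓘(ℂ, ℂ) f (μ : OnePoint ℂ)) (a : ℂ) :
    mvfderiv 𝓘(ℂ, ℂ) f (μ : OnePoint ℂ) a = a * deriv (fun ν : ℂ => f ν) μ := by
  have hc : MDifferentiableAt 𝓘(ℂ, ℂ) 𝓘(ℂ, ℂ) (fun z : ℂ => (z : OnePoint ℂ)) μ :=
    contMDiff_coe.contMDiffAt.mdifferentiableAt (by simp)
  have h : ∀ b : ℂ, (mfderiv 𝓘(ℂ, ℂ) 𝓘(ℂ, ℂ) (fun z : ℂ => (z : OnePoint ℂ)) μ b : ℂ) = b := by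
    intro b
    have h1 := mfderiv_comp_apply μ
      ((contMDiffAt_lam (OnePoint.coe_ne_infty μ)).mdifferentiableAt (by simp)) hc b
    have h2 := mfderiv_lam (OnePoint.coe_ne_infty μ)
      (mfderiv 𝓘(ℂ, ℂ) 𝓘(ℂ, ℂ) (fun z : ℂ => (z : OnePoint ℂ)) μ b : ℂ)
    have h3 : mfderiv 𝓘(ℂ, ℂ) 𝓘(ℂ, ℂ) (lam ∘ fun z : ℂ => (z : OnePoint ℂ)) μ b = b := by
      have e : (lam ∘ fun z : ℂ => (z : OnePoint ℂ)) = id := rfl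
      rw [e, mfderiv_id]
      rfl
    exact h2.symm.trans (h1.symm.trans h3)
  have h4 := mfderiv_comp_apply μ hf hc a
  rw [mfderiv_eq_fderiv] at h4
  have h5 : (fderiv ℂ (f ∘ fun z : ℂ => (z : OnePoint ℂ)) μ : ℂ →L[ℂ] ℂ) a =
    a * deriv (fun ν : ℂ => f ν) μ := by
    rw [fderiv_eq_smul_deriv]
    rfl
  refine Eq.trans ?_ (h4.symm.trans h5)
  exact congrArg (fun b : ℂ => (mfderiv 𝓘(ℂ, ℂ) 𝓘(ℂ, ℂ) f (μ : OnePoint ℂ) : ℂ →L[ℂ] ℂ) b)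
    (h a).symm

theorem mvfderiv_tangentVec {g : OnePoint ℂ × M → ℂ} {μ : ℂ} {x : M}
    (hg : MDifferentiableAt (modelP E) 𝓘(ℂ, ℂ) g ((μ : OnePoint ℂ), x)) (a : ℂ)
    (v : TangentSpace 𝓘(ℂ, E) x) :
    mvfderiv (modelP E) g ((μ : OnePoint ℂ), x) (tangentVec ((μ : OnePoint ℂ), x) a v) =
      a * deriv (fun ν : ℂ => g ((ν : OnePoint ℂ), x)) μ +
        mvfderiv 𝓘(ℂ, E) (fun y => g ((μ : OnePoint ℂ), y)) x v := by
  have h1 := DFunLike.congr_fun (mfderiv_prod_eq_add hg) (tangentVec ((μ : OnePoint ℂ), x) a v)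
  have hg1 : MDifferentiableAt 𝓘(ℂ, ℂ) 𝓘(ℂ, ℂ) (fun p => g (p, x)) (μ : OnePoint ℂ) :=
    MDifferentiableAt.comp (μ : OnePoint ℂ) hg
      ((contMDiff_slice_snd (E := E) x).contMDiffAt.mdifferentiableAt (by simp))
  have hg2 : MDifferentiableAt 𝓘(ℂ, E) 𝓘(ℂ, ℂ) (fun y => g ((μ : OnePoint ℂ), y)) x :=
    MDifferentiableAt.comp x hg
      ((contMDiff_slice (E := E) (μ : OnePoint ℂ)).contMDiffAt.mdifferentiableAt (by simp))
  exact h1.trans (congrArg₂ (fun p q : ℂ => p + q)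
    ((mvfderiv_comp_fst (z := ((μ : OnePoint ℂ), x)) hg1 _).trans (mvfderiv_coe_apply hg1 a))
    (mvfderiv_comp_snd (z := ((μ : OnePoint ℂ), x)) hg2 _))

/-- `conn` acts on slices and `∂_λ` on fibres over points of `M`; these account for the two partial
derivatives in the Leibniz rule, and all other terms are linear over functions. -/
theorem hatConn_covariant (hconn : IsCovariantDerivativeOn E conn univ) :
    IsCovariantDerivativeOn (I := modelP E) (V := PTangent E M) E (hatConn c conn θ eul)
      (regularLocus M) where
  add {σ τ z} hσ hτ hz := by
    obtain ⟨p, x⟩ := z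
    obtain ⟨μ, rfl⟩ := OnePoint.ne_infty_iff_exists.1 hz.2
    have hμ : μ ≠ 0 := by simpa [lam_coe] using lam_ne_zero hz
    refine tangent_clm_ext fun a v => ?_
    have h1 := hatConn_apply (c := c) (conn := conn) (θ := θ) (eul := eul) hμ hσ a v
    have h2 := hatConn_apply (c := c) (conn := conn) (θ := θ) (eul := eul) hμ hτ a v
    have h3 := hatConn_apply (c := c) (conn := conn) (θ := θ) (eul := eul) hμ
      (mdifferentiableAt_add_section hσ hτ) a v
    have h4 : conn (tangentSlice (μ : OnePoint ℂ) (σ + τ)) x v =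
        conn (tangentSlice (μ : OnePoint ℂ) σ) x v + conn (tangentSlice (μ : OnePoint ℂ) τ) x v :=
      DFunLike.congr_fun (hconn.add
        (diffAt_tangentSlice hσ) (diffAt_tangentSlice hτ) (mem_univ x)) v
    have h5 : lamDeriv μ (σ + τ) x = lamDeriv μ σ x + lamDeriv μ τ x :=
      ((hasDerivAt_lamDeriv hσ).add (hasDerivAt_lamDeriv hτ)).deriv
    have h6 : tangentSlice (μ : OnePoint ℂ) (σ + τ) x =
      tangentSlice (μ : OnePoint ℂ) σ x + tangentSlice (μ : OnePoint ℂ) τ x := rfl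
    refine h3.trans (Eq.trans ?_ (congrArg₂ (fun p q : TangentSpace 𝓘(ℂ, E) x => p + q) h1 h2).symm)
    rw [h4, h5, h6]
    exact hatVal_add (V := TangentSpace 𝓘(ℂ, E) x) _ _ _ _ _ _ _ _ _ _ _ _
  leibniz {σ g z} hσ hg hz := by
    obtain ⟨p, x⟩ := z
    obtain ⟨μ, rfl⟩ := OnePoint.ne_infty_iff_exists.1 hz.2
    have hμ : μ ≠ 0 := by simpa [lam_coe] using lam_ne_zero hz
    refine tangent_clm_ext fun a v => ?_
    have h1 := hatConn_apply (c := c) (conn := conn) (θ := θ) (eul := eul) hμ hσ a v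
    have h3 := hatConn_apply (c := c) (conn := conn) (θ := θ) (eul := eul) hμ
      (hg.smul_section hσ) a v
    have hgM : MDifferentiableAt 𝓘(ℂ, E) 𝓘(ℂ, ℂ) (fun y => g ((μ : OnePoint ℂ), y)) x :=
      MDifferentiableAt.comp x hg
        ((contMDiff_slice (E := E) (μ : OnePoint ℂ)).contMDiffAt.mdifferentiableAt (by simp))
    have h4 : conn (tangentSlice (μ : OnePoint ℂ) (g • σ)) x v =
        g ((μ : OnePoint ℂ), x) • conn (tangentSlice (μ : OnePoint ℂ) σ) x v +
          mvfderiv 𝓘(ℂ, E) (fun y => g ((μ : OnePoint ℂ), y)) x v •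
            tangentSlice (μ : OnePoint ℂ) σ x := DFunLike.congr_fun (hconn.leibniz
      (diffAt_tangentSlice hσ) hgM (mem_univ x)) v
    have h5 : lamDeriv μ (g • σ) x = g ((μ : OnePoint ℂ), x) • lamDeriv μ σ x +
        deriv (fun ν : ℂ => g ((ν : OnePoint ℂ), x)) μ • tangentSlice (μ : OnePoint ℂ) σ x := by
      have hg1 : DifferentiableAt ℂ (fun ν : ℂ => g ((ν : OnePoint ℂ), x)) μ := by
        have h1 := MDifferentiableAt.comp (μ : OnePoint ℂ) hg
          ((contMDiff_slice_snd (E := E) x).contMDiffAt.mdifferentiableAt (by simp))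
        exact (MDifferentiableAt.comp μ h1
          (contMDiff_coe.contMDiffAt.mdifferentiableAt (by simp))).differentiableAt
      exact (hg1.hasDerivAt.smul (hasDerivAt_lamDeriv hσ)).deriv
    have h6 : tangentSlice (μ : OnePoint ℂ) (g • σ) x =
      g ((μ : OnePoint ℂ), x) • tangentSlice (μ : OnePoint ℂ) σ x := rfl
    have h7 := mvfderiv_tangentVec hg a v
    refine h3.trans (Eq.trans ?_ (congrArg₂ (fun (q : ℂ) (p : TangentSpace 𝓘(ℂ, E) x) =>
      g ((μ : OnePoint ℂ), x) • p + q • tangentSlice (μ : OnePoint ℂ) σ x) h7 h1).symm)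
    rw [h4, h5, h6]
    exact hatVal_leibniz (V := TangentSpace 𝓘(ℂ, E) x) _ _ _ _ _ _ _ _ _ _ _ _

end HatConnection

/-! ### The period map and the comparison of connections -/

section Period

variable {E : Type*} [NormedAddCommGroup E] [NormedSpace ℂ E] [FiniteDimensional ℂ E]
  {M : Type*} [TopologicalSpace M] [ChartedSpace E M] [IsManifold 𝓘(ℂ, E) ω M]

/-- The section of `p^* Θ_M` which is constant along `ℙ¹`. -/
def tangentHat (X : Π x : M, TangentSpace 𝓘(ℂ, E) x) (z : OnePoint ℂ × M) : PTangent E M z :=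
  X z.2

theorem holAt_tangentHat {X : Π x : M, TangentSpace 𝓘(ℂ, E) x} {z : OnePoint ℂ × M}
    (hX : HolAt 𝓘(ℂ, E) E X z.2) : HolAt (modelP E) E (tangentHat X) z :=
  HolAt.pullback (I' := modelP E) ContMDiffMap.snd hX

theorem tangentSlice_tangentHat (p : OnePoint ℂ) (X : Π x : M, TangentSpace 𝓘(ℂ, E) x) :
    tangentSlice p (tangentHat X) = X :=
  rfl

theorem lamDeriv_tangentHat (μ : ℂ) (X : Π x : M, TangentSpace 𝓘(ℂ, E) x) (x : M) :
    lamDeriv μ (tangentHat X) x = 0 :=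
  deriv_const (F := E) μ (X x)

theorem isFrameAt_tangentHat {ι : Type*} {X : ι → Π x : M, TangentSpace 𝓘(ℂ, E) x}
    {z : OnePoint ℂ × M} (hX : IsFrameAt 𝓘(ℂ, E) E X z.2) :
    IsFrameAt (modelP E) E (V := PTangent E M) (fun i => tangentHat (X i)) z := by
  filter_upwards [(continuous_snd.tendsto z).eventually hX] with w hw
  exact ⟨fun i => holAt_tangentHat (hw.1 i), hw.2⟩

variable {F : Type*} [NormedAddCommGroup F] [NormedSpace ℂ F] [FiniteDimensional ℂ F]
  {H : OnePoint ℂ × M → Type*} [TopologicalSpace (TotalSpace F H)]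
  [∀ z, AddCommGroup (H z)] [∀ z, Module ℂ (H z)] [∀ z, TopologicalSpace (H z)]
  [∀ z, IsTopologicalAddGroup (H z)] [∀ z, ContinuousSMul ℂ (H z)]
  [FiberBundle F H] [VectorBundle ℂ F H] [ContMDiffVectorBundle ω F H (modelP E)]
  (hH : IsTrivialAlong (HolAt (modelP E) F (V := H)))
  {Φ : FrobeniusTypeStructure 𝓘(ℂ, E) F (AtZero E H)} {ζ : Π x, AtZero E H x} {d : ℂ}
  (hζ : IsPrimitive Φ ζ d)

/-- The period map as a family of linear isomorphisms. -/
def periodEquiv (z : OnePoint ℂ × M) : PTangent E M z ≃ₗ[ℂ] H z :=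
  (primEquiv hζ z.2).trans (constEquiv hH z)

theorem periodEquiv_tangentHat (X : Π x : M, TangentSpace 𝓘(ℂ, E) x) :
    (fun z => periodEquiv hH hζ z (tangentHat X z)) = hat hH fun x => primEquiv hζ x (X x) :=
  rfl

/-- A frame of `p^* Θ_M` consists of pulled-back fields, and these go to constant extensions of
holomorphic sections. The converse is `HolAt.of_map`. -/
theorem isHolIso_periodEquiv : IsHolIso (modelP E) E F (periodEquiv hH hζ) := by
  have h : ∀ (σ : Π z, PTangent E M z) (z : OnePoint ℂ × M), HolAt (modelP E) E σ z →
      HolAt (modelP E) F (fun w => (periodEquiv hH hζ w).toLinearMap (σ w)) z := by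
    intro σ z hσ
    obtain ⟨r, X, hX⟩ := exists_isFrameAt (F := E) (V := (TangentSpace 𝓘(ℂ, E) : M → Type _))
      𝓘(ℂ, E) z.2
    have hf := isFrameAt_tangentHat hX
    obtain ⟨c, hc⟩ := hf.exists_coeff σ
    refine (HolAt.sum_smul (t := Finset.univ) (hf.holAt_coeff hσ hc) fun i =>
      holAt_hat hH ((isHolIso_primEquiv hζ _ z.2).1 (hX.self_of_nhds.1 i)) z.1).congr ?_
    filter_upwards [hc] with w hw
    rw [hw, map_sum]
    simp_rw [map_smul]
    rfl
  exact fun σ z => ⟨h σ z, fun hσ =>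
    HolAt.of_map (fun σ hσ => h σ z hσ) (periodEquiv hH hζ z).injective hσ⟩

variable {D : (Π z, H z) → Π z, TangentSpace (modelP E) z →L[ℂ] H z} (hD : IsTrTLE F D)
  (hΦ : IsAssociated F D Φ)

theorem tangentVec_eq {μ : ℂ} (hμ : μ ≠ 0) (x : M) (a : ℂ) (v : TangentSpace 𝓘(ℂ, E) x) :
    tangentVec ((μ : OnePoint ℂ), x) a v = tangentVec ((μ : OnePoint ℂ), x) 0 v +
      (a * μ⁻¹) • tangentVec ((μ : OnePoint ℂ), x) μ 0 := by
  refine Prod.ext ?_ ?_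
  · change a = 0 + (a * μ⁻¹) • μ
    rw [smul_eq_mul]
    field_simp
    ring
  · have h (w : E) : w = w + (a * μ⁻¹) • (0 : E) := by simp
    exact h v

include hΦ in
theorem IsAssociated.conn_hat_eq {s : Π x, AtZero E H x} {x : M} (hs : HolAt 𝓘(ℂ, E) F s x)
    {μ : ℂ} (hμ : μ ≠ 0) (a : ℂ) (v : TangentSpace 𝓘(ℂ, E) x) :
    D (hat hD.isTrivialAlong s) ((μ : OnePoint ℂ), x) (tangentVec ((μ : OnePoint ℂ), x) a v) =
      constEquiv hD.isTrivialAlong ((μ : OnePoint ℂ), x)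
        (Φ.conn s x v + μ⁻¹ • Φ.higgs x v (s x) +
          (a * μ⁻¹) • (μ⁻¹ • Φ.endU x (s x) - Φ.endV x (s x))) := by
  rw [tangentVec_eq hμ, map_add, map_smul, ← constEquiv_sliceConn hD, ← constEquiv_sliceEnd hD,
    hΦ.sliceConn_eq hD hs hμ, hΦ.sliceEnd_eq hD hs hμ]
  refine Eq.trans ?_ (map_add (constEquiv hD.isTrivialAlong ((μ : OnePoint ℂ), x)) _ _).symm
  rw [map_smul (constEquiv hD.isTrivialAlong ((μ : OnePoint ℂ), x)) (a * μ⁻¹)]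

/-- The shift `(2 - d)/2` cancels the scalar `1 - d/2` in `∇_• E`, and `-θ_E` becomes `𝒰`; exactly
`μ⁻¹ 𝒰 - 𝒱` remains. -/
theorem primEquiv_hatVal {μ : ℂ} (a : ℂ) {x : M} (v : TangentSpace 𝓘(ℂ, E) x)
    (X : Π x : M, TangentSpace 𝓘(ℂ, E) x) :
    primEquiv hζ x (hatVal μ a ((2 - d) / 2) (primHiggs hζ x v)
      (primHiggs hζ x (primEuler hζ x))
      (pullConn (primEquiv hζ) Φ.conn (primEuler hζ) x).toLinearMap
      (pullConn (primEquiv hζ) Φ.conn X x v) (X x) 0) =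
    Φ.conn (fun y => primEquiv hζ y (X y)) x v + μ⁻¹ • Φ.higgs x v (primEquiv hζ x (X x)) +
      (a * μ⁻¹) • (μ⁻¹ • Φ.endU x (primEquiv hζ x (X x)) - Φ.endV x (primEquiv hζ x (X x))) := by
  simp only [hatVal, map_add, map_smul, map_sub, map_zero, ContinuousLinearMap.coe_coe]
  rw [primHiggs_primEuler, primEquiv_primHiggs, pullConn_primEuler, apply_pullConn]
  module

include hΦ in
theorem hatConn_tangentHat {X : Π x : M, TangentSpace 𝓘(ℂ, E) x} {x : M}
    (hX : HolAt 𝓘(ℂ, E) E X x) {μ : ℂ} (hμ : μ ≠ 0) :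
    hatConn ((2 - d) / 2) (pullConn (primEquiv hζ) Φ.conn) (primHiggs hζ) (primEuler hζ)
        (tangentHat X) ((μ : OnePoint ℂ), x) =
      pullConn (periodEquiv hD.isTrivialAlong hζ) D (tangentHat X) ((μ : OnePoint ℂ), x) := by
  refine tangent_clm_ext fun a v => (periodEquiv hD.isTrivialAlong hζ _).injective ?_
  rw [apply_pullConn, periodEquiv_tangentHat,
    hΦ.conn_hat_eq hD ((isHolIso_primEquiv hζ X x).1 hX) hμ, ← primEquiv_hatVal]
  refine congrArg (periodEquiv hD.isTrivialAlong hζ ((μ : OnePoint ℂ), x)) ?_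
  refine (hatConn_apply hμ (holAt_tangentHat (z := ((μ : OnePoint ℂ), x)) hX).diffAt a v).trans ?_
  rw [lamDeriv_tangentHat]
  rfl

-- Two covariant derivatives that agree on the frame of pulled-back fields agree on differentiable
-- sections; elsewhere both are zero by normalisation.
include hΦ in
theorem hatConn_eq_pullConn :
    hatConn ((2 - d) / 2) (pullConn (primEquiv hζ) Φ.conn) (primHiggs hζ) (primEuler hζ) =
      pullConn (periodEquiv hD.isTrivialAlong hζ) D := by
  have h1 := hatConn_covariant (c := (2 - d) / 2) (θ := primHiggs hζ) (eul := primEuler hζ)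
    ((isHolIso_primEquiv hζ).isHolConnection Φ.isHolConnection).covariant
  have h2 := (isHolIso_periodEquiv hD.isTrivialAlong hζ).isHolConnection hD.isHolConnection
  funext σ z
  by_cases h : z ∈ regularLocus M ∧ DiffAt (modelP E) E σ z
  · obtain ⟨p, x⟩ := z
    obtain ⟨μ, rfl⟩ := OnePoint.ne_infty_iff_exists.1 h.1.2
    have hμ : μ ≠ 0 := by simpa [lam_coe] using lam_ne_zero h.1
    obtain ⟨r, X, hX⟩ := exists_isFrameAt (F := E) (V := (TangentSpace 𝓘(ℂ, E) : M → Type _))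
      𝓘(ℂ, E) x
    exact cov_eq_of_frame h1 h2.covariant (isOpen_regularLocus.mem_nhds h.1)
      (isFrameAt_tangentHat (z := ((μ : OnePoint ℂ), x)) hX)
      (fun i => hatConn_tangentHat hζ hD hΦ (hX.self_of_nhds.1 i) hμ) h.2
  · rw [hatConn_normalized σ z h, h2.normalized σ z h]

end Period

/-! ### Invariance of flatness under local gauge transformations -/

section Gauge

variable {EB HB : Type*} [NormedAddCommGroup EB] [NormedSpace ℂ EB] [TopologicalSpace HB]
  {I : ModelWithCorners ℂ EB HB} {B : Type*} [TopologicalSpace B] [ChartedSpace HB B]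
  [IsManifold I ω B] [IsManifold I 1 B]
  {F : Type*} [NormedAddCommGroup F] [NormedSpace ℂ F]
  {V : B → Type*} [TopologicalSpace (TotalSpace F V)]
  [∀ x, AddCommGroup (V x)] [∀ x, Module ℂ (V x)] [∀ x, TopologicalSpace (V x)]
  [∀ x, IsTopologicalAddGroup (V x)] [∀ x, ContinuousSMul ℂ (V x)]
  [FiberBundle F V] [VectorBundle ℂ F V] [ContMDiffVectorBundle ω F V I]

/-- An operator which is locally gauge equivalent to a flat connection is flat. -/
theorem IsFlat.of_gauge {S : Set B} (hS : IsOpen S)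
    {D D₀ : (Π x : B, V x) → Π x : B, TangentSpace I x →L[ℂ] V x}
    (hD : IsHolConnection I F S D) (hflat : IsFlat I F S D)
    (h : ∀ x ∈ S, ∃ u : B → ℂ, u x ≠ 0 ∧ ContMDiffAt I 𝓘(ℂ, ℂ) ω u x ∧
      ∀ᶠ y in 𝓝 x, ∀ σ : Π x, V x, DiffAt I F σ y →
        D₀ σ y = u y • D (fun w => (u w)⁻¹ • σ w) y) : IsFlat I F S D₀ := by
  intro σ X Y x hx hσ hX hY
  obtain ⟨u, hu0, hu, hev⟩ := h x hx
  have hui : ContMDiffAt I 𝓘(ℂ, ℂ) ω (fun w => (u w)⁻¹) x :=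
    ((contDiffAt_inv ℂ hu0).contMDiffAt).comp x hu
  have hσ' : HolAt I F (fun w => (u w)⁻¹ • σ w) x := hσ.smul hui
  have hne : ∀ᶠ y in 𝓝 x, u y ≠ 0 := hu.continuousAt.eventually_ne hu0
  have key : ∀ X Y : Π x : B, TangentSpace I x, HolAt I EB Y x →
      D₀ (fun y => D₀ σ y (Y y)) x (X x) =
        u x • D (fun y => D (fun w => (u w)⁻¹ • σ w) y (Y y)) x (X x) := by
    intro X Y hY
    -- The gauge relation is needed on a neighbourhood, since the inner derivative is differentiated
    -- again.
    have h1 : ∀ᶠ y in 𝓝 x, D₀ σ y (Y y) = u y • D (fun w => (u w)⁻¹ • σ w) y (Y y) := by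
      filter_upwards [hev, hσ.eventually] with y hy hσy
      exact DFunLike.congr_fun (hy σ hσy.diffAt) (Y y)
    have hhol := hD.holomorphic _ Y x hx hσ' hY
    have hτ : HolAt I F (fun y => D₀ σ y (Y y)) x :=
      (hhol.smul hu).congr (h1.mono fun y hy => hy.symm)
    have h2 : ∀ᶠ y in 𝓝 x, (u y)⁻¹ • D₀ σ y (Y y) = D (fun w => (u w)⁻¹ • σ w) y (Y y) := by
      filter_upwards [h1, hne] with y hy hy0
      rw [hy, inv_smul_smul₀ hy0]
    rw [hev.self_of_nhds _ hτ.diffAt, hD.covariant.congr_of_eventuallyEq (hτ.smul hui).diffAt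
      hhol.diffAt (hS.mem_nhds hx) h2]
    rfl
  rw [key X Y hY, key Y X hX, hev.self_of_nhds σ hσ.diffAt]
  have h3 := hflat _ X Y x hx hσ' hX hY
  have h4 : ∀ w, (u x • D (fun w => (u w)⁻¹ • σ w) x) w = u x • D (fun w => (u w)⁻¹ • σ w) x w :=
    fun w => rfl
  rw [h4, ← smul_sub, ← smul_sub, h3, smul_zero]

end Gauge

/-! ### Removing the term `c dλ/λ` -/

section Twist

variable {E : Type*} [NormedAddCommGroup E] [NormedSpace ℂ E] [FiniteDimensional ℂ E]
  {M : Type*} [TopologicalSpace M] [ChartedSpace E M] [IsManifold 𝓘(ℂ, E) ω M]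
  {c : ℂ} {conn : (Π x : M, TangentSpace 𝓘(ℂ, E) x) →
      Π x : M, TangentSpace 𝓘(ℂ, E) x →L[ℂ] TangentSpace 𝓘(ℂ, E) x}
    {θ : Π x : M, TangentSpace 𝓘(ℂ, E) x →ₗ[ℂ] TangentSpace 𝓘(ℂ, E) x →ₗ[ℂ]
      TangentSpace 𝓘(ℂ, E) x}
    {eul : Π x : M, TangentSpace 𝓘(ℂ, E) x}

theorem hatVal_twist {V : Type*} [AddCommGroup V] [Module ℂ V] (μ a c : ℂ) (A B C : V →ₗ[ℂ] V)
    (p s l : V) : hatVal μ a c A B C p s l =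
      hatVal μ a 0 A B C p s l + (a * μ⁻¹ * c) • s := by
  simp only [hatVal]
  module

/-- Conjugation by the local function `(λ/μ₀)^c` removes `c dλ/λ`. The quotient by `μ₀` allows a
base point anywhere in `ℂ^*`: near `μ₀` the ratio is close to `1`, inside the domain of the
logarithm. -/
theorem hatConn_zero_eq (hconn : IsCovariantDerivativeOn E conn univ) {μ₀ μ : ℂ} (hμ : μ ≠ 0)
    (h : μ / μ₀ ∈ Complex.slitPlane) {x : M} {σ : Π z, PTangent E M z}
    (hσ : DiffAt (modelP E) E σ ((μ : OnePoint ℂ), x)) :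
    hatConn 0 conn θ eul σ ((μ : OnePoint ℂ), x) = Complex.exp (c * Complex.log (μ / μ₀)) •
      hatConn c conn θ eul
        (fun w => (Complex.exp (c * Complex.log (lam w.1 / μ₀)))⁻¹ • σ w) ((μ : OnePoint ℂ), x) := by
  set g : OnePoint ℂ × M → ℂ := fun w => (Complex.exp (c * Complex.log (lam w.1 / μ₀)))⁻¹ with hg
  have hμ₀ : μ₀ ≠ 0 := by
    rintro rfl
    rw [div_zero] at h
    exact Complex.zero_notMem_slitPlane h
  have hder : HasDerivAt (fun ν : ℂ => (Complex.exp (c * Complex.log (ν / μ₀)))⁻¹)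
      (-(μ⁻¹ * c * (Complex.exp (c * Complex.log (μ / μ₀)))⁻¹)) μ := by
    have h1 := ((((hasDerivAt_id μ).div_const μ₀).clog h).const_mul c).cexp.inv
      (Complex.exp_ne_zero _)
    refine h1.congr_deriv ?_
    have := Complex.exp_ne_zero (c * Complex.log (μ / μ₀))
    simp only [id]
    field_simp
  have hgd : MDifferentiableAt (modelP E) 𝓘(ℂ, ℂ) g ((μ : OnePoint ℂ), x) :=
    MDifferentiableAt.comp (g := fun ν : ℂ => (Complex.exp (c * Complex.log (ν / μ₀)))⁻¹)
      ((μ : OnePoint ℂ), x) hder.differentiableAt.mdifferentiableAt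
      ((contMDiffAt_lam_fst (OnePoint.coe_ne_infty μ)).mdifferentiableAt (by simp))
  have hl := (hatConn_covariant (c := c) (θ := θ) (eul := eul) hconn).leibniz hσ hgd
    (coe_mem_regularLocus hμ x)
  refine tangent_clm_ext fun a v => ?_
  have h1 : hatConn c conn θ eul (g • σ) ((μ : OnePoint ℂ), x)
      (tangentVec ((μ : OnePoint ℂ), x) a v) = _ := DFunLike.congr_fun hl _
  have h2 := hatConn_apply (c := c) (conn := conn) (θ := θ) (eul := eul) hμ hσ a v
  have h3 := hatConn_apply (c := 0) (conn := conn) (θ := θ) (eul := eul) hμ hσ a v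
  rw [hatVal_twist] at h2
  have h4 : mvfderiv (modelP E) g ((μ : OnePoint ℂ), x) (tangentVec ((μ : OnePoint ℂ), x) a v) =
      -(a * μ⁻¹ * c) * g ((μ : OnePoint ℂ), x) := by
    rw [mvfderiv_tangentVec hgd]
    have h5 : mvfderiv 𝓘(ℂ, E) (fun y => g ((μ : OnePoint ℂ), y)) x v = 0 := by
      have h6 : mvfderiv 𝓘(ℂ, E) (fun _ : M => g ((μ : OnePoint ℂ), x)) x = 0 := mfderiv_const
      exact DFunLike.congr_fun h6 v
    have h7 : deriv (fun ν : ℂ => g ((ν : OnePoint ℂ), x)) μ = _ := hder.deriv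
    rw [h5, h7]
    simp only [hg, lam_coe]
    ring
  let s : TangentSpace 𝓘(ℂ, E) x := tangentSlice (μ : OnePoint ℂ) σ x
  let u : ℂ := Complex.exp (c * Complex.log (μ / μ₀))
  have hu : u ≠ 0 := Complex.exp_ne_zero _
  have h8 : ∀ p q r : TangentSpace 𝓘(ℂ, E) x, r = p + (a * μ⁻¹ * c) • s → q = p →
      q = u • (u⁻¹ • r + (-(a * μ⁻¹ * c) * u⁻¹) • s) := by
    rintro p q r rfl rfl
    rw [smul_add, smul_smul, smul_smul, mul_inv_cancel₀ hu, mul_comm _ u⁻¹, mul_inv_cancel_left₀ hu]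
    module
  refine (h8 _ _ _ h2 h3).trans ?_
  refine congrArg (fun p : TangentSpace 𝓘(ℂ, E) x => u • p) ?_
  refine Eq.trans ?_ h1.symm
  let r : TangentSpace 𝓘(ℂ, E) x := hatConn c conn θ eul σ ((μ : OnePoint ℂ), x)
    (tangentVec ((μ : OnePoint ℂ), x) a v)
  exact congrArg (fun t : ℂ => u⁻¹ • r + t • s) h4.symm

/-- Comparison with a mixed trTLEP-structure yields flatness of the twisted connection, whereas a
Saito structure asks for the case `c = 0`. -/
theorem isFlat_hatConn_zero (hhol : IsHolConnection (modelP E) E (regularLocus M)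
      (hatConn c conn θ eul)) (hconn : IsCovariantDerivativeOn E conn univ)
    (hflat : IsFlat (modelP E) E (regularLocus M) (hatConn c conn θ eul)) :
    IsFlat (modelP E) E (regularLocus M) (hatConn 0 conn θ eul) := by
  refine IsFlat.of_gauge isOpen_regularLocus hhol hflat fun z hz => ?_
  have hz0 := lam_ne_zero hz
  have h1 := contMDiffAt_lam_fst (E := E) hz.2
  have hs : lam z.1 / lam z.1 ∈ Complex.slitPlane := by
    rw [div_self hz0]
    exact Complex.one_mem_slitPlane
  have hd : ContMDiffAt (modelP E) 𝓘(ℂ, ℂ) ω (fun w : OnePoint ℂ × M => lam w.1 / lam z.1) z :=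
    ContMDiffAt.comp z (g := fun ν : ℂ => ν / lam z.1)
      (contDiff_id.div_const (lam z.1)).contDiffAt.contMDiffAt h1
  refine ⟨fun w => Complex.exp (c * Complex.log (lam w.1 / lam z.1)), Complex.exp_ne_zero _, ?_, ?_⟩
  · have hc : ContDiffAt ℂ ω (fun ν : ℂ => Complex.exp (c * Complex.log ν)) (lam z.1 / lam z.1) :=
      (contDiffAt_const.mul (Complex.contDiffAt_log hs)).cexp
    exact ContMDiffAt.comp z (g := fun ν : ℂ => Complex.exp (c * Complex.log ν))
      hc.contMDiffAt hd
  · filter_upwards [hd.continuousAt.eventually_mem (Complex.isOpen_slitPlane.mem_nhds hs),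
      isOpen_regularLocus.mem_nhds hz] with w hw hwr σ hσ
    obtain ⟨p, x⟩ := w
    obtain ⟨μ, rfl⟩ := OnePoint.ne_infty_iff_exists.1 hwr.2
    exact hatConn_zero_eq hconn (by simpa [lam_coe] using lam_ne_zero hwr) hw hσ

end Twist

/-! ### Transport of mixed trTLEP-structures -/

section TransportTrTLEP

variable {E : Type*} [NormedAddCommGroup E] [NormedSpace ℂ E] [FiniteDimensional ℂ E]
  {M : Type*} [TopologicalSpace M] [ChartedSpace E M] [IsManifold 𝓘(ℂ, E) ω M]
  {F : Type*} [NormedAddCommGroup F] [NormedSpace ℂ F] [FiniteDimensional ℂ F]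
  {H : OnePoint ℂ × M → Type*} [TopologicalSpace (TotalSpace F H)]
  [∀ z, AddCommGroup (H z)] [∀ z, Module ℂ (H z)] [∀ z, TopologicalSpace (H z)]
  [∀ z, IsTopologicalAddGroup (H z)] [∀ z, ContinuousSMul ℂ (H z)]
  [FiberBundle F H] [VectorBundle ℂ F H] [ContMDiffVectorBundle ω F H (modelP E)]
  {F' : Type*} [NormedAddCommGroup F'] [NormedSpace ℂ F'] [FiniteDimensional ℂ F']
  {H' : OnePoint ℂ × M → Type*} [TopologicalSpace (TotalSpace F' H')]
  [∀ z, AddCommGroup (H' z)] [∀ z, Module ℂ (H' z)] [∀ z, TopologicalSpace (H' z)]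
  [∀ z, IsTopologicalAddGroup (H' z)] [∀ z, ContinuousSMul ℂ (H' z)]
  [FiberBundle F' H'] [VectorBundle ℂ F' H'] [ContMDiffVectorBundle ω F' H' (modelP E)]
  {φ : Π z, H z ≃ₗ[ℂ] H' z} (hφ : IsHolIso (modelP E) F F' φ)

include hφ

theorem IsHolIso.extendsAt_iff {τ : Π z, H z} {z : OnePoint ℂ × M}
    (h : ExtendsAt E F' (fun w => φ w (τ w)) z) : ExtendsAt E F τ z := by
  obtain ⟨τ', hτ', h⟩ := h
  refine ⟨fun w => (φ w).symm (τ' w), (hφ.symm_iff τ' z).2 hτ', ?_⟩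
  filter_upwards [h] with w hw hwr
  rw [LinearEquiv.eq_symm_apply]
  exact hw hwr

theorem IsHolIso.isTrTLE {D : (Π z, H' z) → Π z, TangentSpace (modelP E) z →L[ℂ] H' z}
    (hD : IsTrTLE F' D) : IsTrTLE F (pullConn φ D) where
  isTrivialAlong x := by
    obtain ⟨r, s, hs⟩ := hD.isTrivialAlong x
    refine ⟨r, fun i z => (φ z).symm (s i z), ?_⟩
    filter_upwards [hs] with y hy p
    obtain ⟨h1, h2, h3⟩ := hy p
    refine ⟨fun i => (hφ.symm_iff _ _).2 (h1 i), h2.map' (φ (p, y)).symm.toLinearMap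
      (LinearEquiv.ker _), ?_⟩
    have e : (range fun i => (φ (p, y)).symm (s i (p, y))) =
        (φ (p, y)).symm.toLinearMap '' range fun i => s i (p, y) := by
      rw [← range_comp]
      rfl
    rw [e, ← Submodule.map_span, h3, Submodule.map_top, LinearEquiv.range]
  isHolConnection := hφ.isHolConnection hD.isHolConnection
  isFlat := hφ.isFlat hD.isFlat
  pole_zero σ X x hσ hX := by
    have h := hD.pole_zero _ X x ((hφ σ _).1 hσ) hX
    refine ⟨hφ.extendsAt_iff ?_, hφ.extendsAt_iff ?_⟩ <;> simp_rw [map_smul, apply_pullConn]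
    exacts [h.1, h.2]
  pole_infty σ X x hσ hX := by
    have h := hD.pole_infty _ X x ((hφ σ _).1 hσ) hX
    refine ⟨hφ.extendsAt_iff ?_, hφ.extendsAt_iff ?_⟩ <;> simp_rw [apply_pullConn]
    exacts [h.1, h.2]

variable {T : MixedTrTLEPData E H} {T' : MixedTrTLEPData E H'} (hT' : IsMixedTrTLEP F' T')
  (hconn : T.conn = pullConn φ T'.conn)
  (hW : ∀ (k : ℤ) (z : OnePoint ℂ × M) (v : H z), v ∈ T.W k z ↔ φ z v ∈ T'.W k z)
  (hP : ∀ (k : ℤ) (z : OnePoint ℂ × M), ∀ a ∈ T.W k z, ∀ b ∈ T.W k (jmap z),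
    T.pairing k z (toGr T.W k z a) (toGr T.W k (jmap z) b) =
      T'.pairing k z (toGr T'.W k z (φ z a)) (toGr T'.W k (jmap z) (φ (jmap z) b)))

-- The compatibility `hP` concerns vectors in the filtration; for other vectors both sides are zero.
omit hφ in
include hW hP in
theorem pairing_toGr_eq (k : ℤ) (z : OnePoint ℂ × M) (a : H z) (b : H (jmap z)) :
    T.pairing k z (toGr T.W k z a) (toGr T.W k (jmap z) b) =
      T'.pairing k z (toGr T'.W k z (φ z a)) (toGr T'.W k (jmap z) (φ (jmap z) b)) := by
  by_cases ha : a ∈ T.W k z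
  · by_cases hb : b ∈ T.W k (jmap z)
    · exact hP k z a ha b hb
    · rw [toGr_of_notMem hb, toGr_of_notMem fun h => hb ((hW k _ b).2 h), map_zero, map_zero]
  · rw [toGr_of_notMem ha, toGr_of_notMem fun h => ha ((hW k _ a).2 h), map_zero, map_zero,
      LinearMap.zero_apply, LinearMap.zero_apply]

include hT' hconn hW hP

/-- Mixed trTLEP-structures can be transported along isomorphisms of vector bundles. -/
theorem IsHolIso.isMixedTrTLEP : IsMixedTrTLEP F T := by
  have hgr := pairing_toGr_eq hW hP
  have hPgr : ∀ (k : ℤ) (z : OnePoint ℂ × M) (a : H z) (b : H (jmap z)),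
      T.P k z (toGr T.W k z a) (toGr T.W k (jmap z) b) =
        T'.P k z (toGr T'.W k z (φ z a)) (toGr T'.W k (jmap z) (φ (jmap z) b)) :=
    fun k z a b => congrArg (lam z.1 ^ (-k) * ·) (hgr k z a b)
  have hsec := fun k s z => hφ.holSectionAt_iff (hW k) s z
  exact
    { isTrTLE := hconn ▸ hφ.isTrTLE hT'.isTrTLE
      isFiltration := hφ.isSubbundleFiltration hW hT'.isFiltration
      flat_W := fun k s z hz hs v => by
        rw [hW, hconn, apply_pullConn]
        exact hT'.flat_W k _ z hz ((hsec k s z).1 hs) v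
      trivial_Gr := fun k x => by
        obtain ⟨r, s, hs⟩ := hT'.trivial_Gr k x
        let e := fun z => grEquiv (φ z) (fun k v => hW k z v) k
        refine ⟨r, fun i z => (e z).symm (s i z), ?_⟩
        filter_upwards [hs] with y hy p
        obtain ⟨h1, h2, h3⟩ := hy p
        refine ⟨fun i => ?_, h2.map' (e (p, y)).symm.toLinearMap (LinearEquiv.ker _), ?_⟩
        · obtain ⟨t, ht, hts⟩ := h1 i
          refine ⟨fun z => (φ z).symm (t z), (hsec k _ _).2 ?_, ?_⟩
          · simpa using ht
          · filter_upwards [hts] with w hw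
            rw [LinearEquiv.eq_symm_apply, grEquiv_toGr, LinearEquiv.apply_symm_apply, hw]
        · have e' : (range fun i => (e (p, y)).symm (s i (p, y))) =
              (e (p, y)).symm.toLinearMap '' range fun i => s i (p, y) := by
            rw [← range_comp]
            rfl
          rw [e', ← Submodule.map_span, h3, Submodule.map_top, LinearEquiv.range]
      pairing_holomorphic := fun k s t z hs ht => by
        simp_rw [hgr]
        exact hT'.pairing_holomorphic k _ _ z ((hsec k s z).1 hs) ((hsec k t _).1 ht)
      pairing_nondegenerate := fun k z => by
        have h : T.pairing k z = (T'.pairing k z).compl₁₂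
            (grEquiv (φ z) (fun k v => hW k z v) k).toLinearMap
            (grEquiv (φ (jmap z)) (fun k v => hW k (jmap z) v) k).toLinearMap := by
          refine LinearMap.ext fun a => LinearMap.ext fun b => ?_
          obtain ⟨v, hv, rfl⟩ := exists_toGr_eq a
          obtain ⟨w, hw, rfl⟩ := exists_toGr_eq b
          rw [hgr, LinearMap.compl₁₂_apply, LinearEquiv.coe_coe, LinearEquiv.coe_coe,
            grEquiv_toGr, grEquiv_toGr]
        rw [h]
        exact nondegenerate_compl₁₂ (hT'.pairing_nondegenerate k z) _ _
      P_symm := fun k s t z hz => by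
        rw [hPgr, hPgr]
        exact hT'.P_symm k (fun w => φ w (s w)) (fun w => φ w (t w)) z hz
      P_flat := fun k s t z hz hs ht a v => by
        simp_rw [hPgr, hconn, apply_pullConn]
        exact hT'.P_flat k _ _ z hz ((hsec k s z).1 hs) ((hsec k t _).1 ht) a v }

/-- The axioms are required only of the target; those of the source are transported back. -/
theorem IsHolIso.isMixedTrTLEPIso : IsMixedTrTLEPIso F F' T T' (fun z => φ z) where
  source := hφ.isMixedTrTLEP hT' hconn hW hP
  target := hT'
  linear z := (φ z).toLinearMap.isLinear
  bijective z := (φ z).bijective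
  holomorphic := hφ
  conn σ z _ _ v := by
    rw [hconn, apply_pullConn]
  mem_W := hW
  pairing := hP

end TransportTrTLEP

/-! ### Existence of the mixed Frobenius structure -/

section Existence

variable {E : Type*} [NormedAddCommGroup E] [NormedSpace ℂ E] [FiniteDimensional ℂ E]
  {M : Type*} [TopologicalSpace M] [ChartedSpace E M] [IsManifold 𝓘(ℂ, E) ω M]
  {F : Type*} [NormedAddCommGroup F] [NormedSpace ℂ F] [FiniteDimensional ℂ F]
  {H : OnePoint ℂ × M → Type*} [TopologicalSpace (TotalSpace F H)]
  [∀ z, AddCommGroup (H z)] [∀ z, Module ℂ (H z)] [∀ z, TopologicalSpace (H z)]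
  [∀ z, IsTopologicalAddGroup (H z)] [∀ z, ContinuousSMul ℂ (H z)]
  [FiberBundle F H] [VectorBundle ℂ F H] [ContMDiffVectorBundle ω F H (modelP E)]
  {T : MixedTrTLEPData E H} (hT : IsMixedTrTLEP F T)
  {Φ : FrobeniusTypeStructure 𝓘(ℂ, E) F (AtZero E H)} (hΦ : IsAssociated F T.conn Φ)
  {ζ : Π x, AtZero E H x} {d : ℂ} (hζ : IsPrimitive Φ ζ d)

include hT hΦ hζ

/-- The connection twisted by `(2 - d)/2` is the pull-back of the flat connection of `T`; the twist
is then removed. -/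
theorem isFlat_hatConn_prim : IsFlat (modelP E) E (regularLocus M)
    (hatConn 0 (pullConn (primEquiv hζ) Φ.conn) (primHiggs hζ) (primEuler hζ)) := by
  have h := isHolIso_periodEquiv hT.isTrTLE.isTrivialAlong hζ
  have e := hatConn_eq_pullConn hζ hT.isTrTLE hΦ
  have h1 := h.isHolConnection hT.isTrTLE.isHolConnection
  have h2 := h.isFlat hT.isTrTLE.isFlat
  rw [← e] at h1 h2
  exact isFlat_hatConn_zero h1
    ((isHolIso_primEquiv hζ).isHolConnection Φ.isHolConnection).covariant h2

theorem exists_mfs : ∃ 𝓕 : MixedFrobeniusStructure E M d,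
    (∀ x, -(Φ.higgs x (𝓕.unit x) (ζ x)) = ζ x) ∧
      IsMixedTrTLEPIso E F 𝓕.toTrTLEP T (periodMap Φ ζ) := by
  refine ⟨primMFS hζ (hΦ.isFilteredMetric hT) (isFlat_hatConn_prim hT hΦ hζ),
    fun x => primEquiv_primUnit hζ x, ?_⟩
  refine (isHolIso_periodEquiv hT.isTrTLE.isTrivialAlong hζ).isMixedTrTLEPIso hT
    (hatConn_eq_pullConn hζ hT.isTrTLE hΦ)
    (fun k z v => hT.constEquiv_mem_iff k z _) fun k z a ha b hb => ?_
  refine (primMetric_toGr hζ _ k z.2 a b).trans ?_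
  exact (pairing_eq_metricZero hT k z ha hb).symm

end Existence

/-! ### Uniqueness of the mixed Frobenius structure -/

section Uniqueness

variable {E : Type*} [NormedAddCommGroup E] [NormedSpace ℂ E] [FiniteDimensional ℂ E]
  {M : Type*} [TopologicalSpace M] [ChartedSpace E M] [IsManifold 𝓘(ℂ, E) ω M]

/-- The type of the metrics depends on the filtration, so they are compared on representatives of
classes. -/
theorem MixedFrobeniusStructure.ext_of_fields {d : ℂ} {𝓕 𝓖 : MixedFrobeniusStructure E M d}
    (hconn : 𝓕.conn = 𝓖.conn) (hθ : 𝓕.θ = 𝓖.θ) (hunit : 𝓕.unit = 𝓖.unit)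
    (heuler : 𝓕.euler = 𝓖.euler) (hfilt : 𝓕.filt = 𝓖.filt)
    (hg : ∀ (k : ℤ) (x : M), ∀ a ∈ 𝓕.filt k x, ∀ b ∈ 𝓕.filt k x,
      𝓕.g k x (toGr 𝓕.filt k x a) (toGr 𝓕.filt k x b) =
        𝓖.g k x (toGr 𝓖.filt k x a) (toGr 𝓖.filt k x b)) : 𝓕 = 𝓖 := by
  obtain ⟨⟨⟩, filt, g⟩ := 𝓕
  obtain ⟨⟨⟩, filt', g'⟩ := 𝓖
  dsimp only at hconn hθ hunit heuler hfilt hg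
  subst hconn hθ hunit heuler hfilt
  obtain rfl : g = g' := by
    funext k x
    refine LinearMap.ext fun a => LinearMap.ext fun b => ?_
    obtain ⟨v, hv, rfl⟩ := exists_toGr_eq a
    obtain ⟨w, hw, rfl⟩ := exists_toGr_eq b
    exact hg k x v hv w hw
  rfl

variable {F : Type*} [NormedAddCommGroup F] [NormedSpace ℂ F] [FiniteDimensional ℂ F]
  {H : OnePoint ℂ × M → Type*} [TopologicalSpace (TotalSpace F H)]
  [∀ z, AddCommGroup (H z)] [∀ z, Module ℂ (H z)] [∀ z, TopologicalSpace (H z)]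
  [∀ z, IsTopologicalAddGroup (H z)] [∀ z, ContinuousSMul ℂ (H z)]
  [FiberBundle F H] [VectorBundle ℂ F H] [ContMDiffVectorBundle ω F H (modelP E)]
  {T : MixedTrTLEPData E H} {φ : Π z, PTangent E M z → H z} {d : ℂ}
  {𝓕 𝓖 : MixedFrobeniusStructure E M d}
  (h𝓕 : IsMixedTrTLEPIso E F 𝓕.toTrTLEP T φ) (h𝓖 : IsMixedTrTLEPIso E F 𝓖.toTrTLEP T φ)

include h𝓕 h𝓖

/-- Both connections are carried by the same injective `φ` to that of `T`; they are compared on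
sections pulled back from `M`, whose derivative in `λ` is zero. -/
theorem hatVal_eq_of_iso {X : Π x : M, TangentSpace 𝓘(ℂ, E) x} {x : M}
    (hX : HolAt 𝓘(ℂ, E) E X x) {μ : ℂ} (hμ : μ ≠ 0) (a : ℂ) (v : TangentSpace 𝓘(ℂ, E) x) :
    hatVal μ a ((2 - d) / 2) (𝓕.θ x v) (𝓕.θ x (𝓕.euler x)) (𝓕.conn 𝓕.euler x).toLinearMap
        (𝓕.conn X x v) (X x) 0 =
      hatVal μ a ((2 - d) / 2) (𝓖.θ x v) (𝓖.θ x (𝓖.euler x)) (𝓖.conn 𝓖.euler x).toLinearMap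
        (𝓖.conn X x v) (X x) 0 := by
  have hX' : HolAt (modelP E) E (tangentHat X) ((μ : OnePoint ℂ), x) := holAt_tangentHat hX
  have h1 := h𝓕.conn _ _ (coe_mem_regularLocus hμ x) hX' (tangentVec ((μ : OnePoint ℂ), x) a v)
  have h2 := h𝓖.conn _ _ (coe_mem_regularLocus hμ x) hX' (tangentVec ((μ : OnePoint ℂ), x) a v)
  have h3 := (h𝓕.bijective _).1 (h1.trans h2.symm)
  have h4 := hatConn_apply (c := (2 - d) / 2) (conn := 𝓕.conn) (θ := 𝓕.θ) (eul := 𝓕.euler) hμ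
    hX'.diffAt a v
  have h5 := hatConn_apply (c := (2 - d) / 2) (conn := 𝓖.conn) (θ := 𝓖.θ) (eul := 𝓖.euler) hμ
    hX'.diffAt a v
  rw [lamDeriv_tangentHat, tangentSlice_tangentHat] at h4 h5
  exact h4.symm.trans (h3.trans h5)

/-- In directions tangent to `M` the connection is `∇ + μ⁻¹ θ`, and the two coefficients separate.
-/
theorem conn_eq_and_higgs_eq_of_iso {X : Π x : M, TangentSpace 𝓘(ℂ, E) x} {x : M}
    (hX : HolAt 𝓘(ℂ, E) E X x) (v : TangentSpace 𝓘(ℂ, E) x) :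
    𝓕.conn X x v = 𝓖.conn X x v ∧ 𝓕.θ x v (X x) = 𝓖.θ x v (X x) := by
  refine eq_of_add_inv_smul fun μ hμ => ?_
  have h := hatVal_eq_of_iso h𝓕 h𝓖 hX hμ 0 v
  simpa only [hatVal, zero_smul, add_zero] using h

theorem higgs_eq_of_iso : 𝓕.θ = 𝓖.θ := by
  funext x
  refine LinearMap.ext fun v => LinearMap.ext fun w => ?_
  have h := (conn_eq_and_higgs_eq_of_iso h𝓕 h𝓖 (holAt_extend w) v).2
  rwa [FiberBundle.extend_apply_self E w] at h

theorem conn_eq_of_iso : 𝓕.conn = 𝓖.conn :=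
  IsHolConnection.ext isOpen_univ 𝓕.isHolConnection 𝓖.isHolConnection fun _ _ _ hX =>
    ContinuousLinearMap.ext fun v => (conn_eq_and_higgs_eq_of_iso h𝓕 h𝓖 hX v).1

theorem euler_eq_of_iso (hunit : 𝓕.unit = 𝓖.unit) : 𝓕.euler = 𝓖.euler := by
  funext x
  have h : ∀ 𝓐 : MixedFrobeniusStructure E M d, 𝓐.euler x = -𝓐.θ x (𝓐.euler x) (𝓐.unit x) := by
    intro 𝓐
    rw [𝓐.θ_symm, 𝓐.θ_unit, neg_neg]
  rw [h 𝓕, h 𝓖, neg_inj]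
  -- These are the coefficients of `1` and `μ⁻¹` in the derivative of the unit field along `λ ∂_λ`;
  -- the second is `-θ_E e = E`.
  refine (neg_injective (eq_of_add_inv_smul
    (a := ((2 - d) / 2) • 𝓕.unit x - 𝓕.conn 𝓕.euler x (𝓕.unit x))
    (a' := ((2 - d) / 2) • 𝓖.unit x - 𝓖.conn 𝓖.euler x (𝓖.unit x))
    (b := -𝓕.θ x (𝓕.euler x) (𝓕.unit x)) (b' := -𝓖.θ x (𝓖.euler x) (𝓖.unit x))
    fun μ hμ => ?_).2)
  have h := hatVal_eq_of_iso h𝓕 h𝓖 (𝓕.holomorphic_unit x) hμ μ 0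
  rw [higgs_eq_of_iso h𝓕 h𝓖, conn_eq_of_iso h𝓕 h𝓖] at h ⊢
  rw [hunit] at h ⊢
  simp only [hatVal, ContinuousLinearMap.coe_coe, smul_add, smul_sub, smul_smul, ← mul_assoc,
    mul_inv_cancel₀ hμ, one_mul, one_smul, smul_zero] at h
  linear_combination (norm := module) h

theorem filt_eq_of_iso : 𝓕.filt = 𝓖.filt := by
  funext k x
  ext a
  exact (h𝓕.mem_W k (((1 : ℂ) : OnePoint ℂ), x) a).trans
    (h𝓖.mem_W k (((1 : ℂ) : OnePoint ℂ), x) a).symm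

theorem eq_of_iso (hunit : 𝓕.unit = 𝓖.unit) : 𝓕 = 𝓖 := by
  have hfilt := filt_eq_of_iso h𝓕 h𝓖
  refine MixedFrobeniusStructure.ext_of_fields (conn_eq_of_iso h𝓕 h𝓖) (higgs_eq_of_iso h𝓕 h𝓖)
    hunit (euler_eq_of_iso h𝓕 h𝓖 hunit) hfilt fun k x a ha b hb => ?_
  have hmem : ∀ v ∈ 𝓕.filt k x, v ∈ 𝓖.filt k x := fun v hv => hfilt ▸ hv
  exact (h𝓕.pairing k (((1 : ℂ) : OnePoint ℂ), x) a ha b hb).trans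
    (h𝓖.pairing k (((1 : ℂ) : OnePoint ℂ), x) a (hmem a ha) b (hmem b hb)).symm

end Uniqueness

end
end MixedFrobenius

/-! ### The proposition -/

theorem mainTheorem7
    {E : Type*} [NormedAddCommGroup E] [NormedSpace ℂ E] [FiniteDimensional ℂ E]
    {M : Type*} [TopologicalSpace M] [T2Space M] [SecondCountableTopology M]
    [ChartedSpace E M] [IsManifold 𝓘(ℂ, E) ω M]
    {F : Type*} [NormedAddCommGroup F] [NormedSpace ℂ F] [FiniteDimensional ℂ F]
    {H : OnePoint ℂ × M → Type*} [TopologicalSpace (TotalSpace F H)]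
    [∀ z, AddCommGroup (H z)] [∀ z, Module ℂ (H z)] [∀ z, TopologicalSpace (H z)]
    [∀ z, IsTopologicalAddGroup (H z)] [∀ z, ContinuousSMul ℂ (H z)]
    [FiberBundle F H] [VectorBundle ℂ F H]
    [ContMDiffVectorBundle ω F H (MixedFrobenius.modelP E)]
    (T : MixedFrobenius.MixedTrTLEPData E H) (hT : MixedFrobenius.IsMixedTrTLEP F T) :
    (∃! Φ : MixedFrobenius.FrobeniusTypeStructure 𝓘(ℂ, E) F (MixedFrobenius.AtZero E H),
      MixedFrobenius.IsAssociated F T.conn Φ) ∧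
    ∀ Φ : MixedFrobenius.FrobeniusTypeStructure 𝓘(ℂ, E) F (MixedFrobenius.AtZero E H),
      MixedFrobenius.IsAssociated F T.conn Φ →
      ∀ (d : ℂ) (ζ : Π x : M, MixedFrobenius.AtZero E H x),
        (∀ x, MixedFrobenius.HolAt 𝓘(ℂ, E) F ζ x) →
        (∀ x, Φ.conn ζ x = 0) →
        (∀ x, Function.Bijective
          fun a : TangentSpace 𝓘(ℂ, E) x => Φ.higgs x a (ζ x)) →
        (∀ x, Φ.endV x (ζ x) = (d / 2) • ζ x) →
        ∃! 𝓕 : MixedFrobenius.MixedFrobeniusStructure E M d,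
          (∀ x, -(Φ.higgs x (𝓕.unit x) (ζ x)) = ζ x) ∧
          MixedFrobenius.IsMixedTrTLEPIso E F 𝓕.toTrTLEP T (MixedFrobenius.periodMap Φ ζ) := by
  have hD := hT.isTrTLE
  refine ⟨⟨MixedFrobenius.residualStructure hD,
    MixedFrobenius.residualStructure_isAssociated hD,
    fun _ hΦ => MixedFrobenius.eq_residualStructure hD hΦ⟩, ?_⟩
  intro Φ hΦ d ζ hhol hflat hbij hhom
  obtain ⟨𝓕, hunit, hiso⟩ := MixedFrobenius.exists_mfs hT hΦ
    (MixedFrobenius.IsPrimitive.mk hhol hflat hbij hhom : MixedFrobenius.IsPrimitive Φ ζ d)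
  refine ⟨𝓕, ⟨hunit, hiso⟩, fun 𝓖 h𝓖 => MixedFrobenius.eq_of_iso h𝓖.2 hiso ?_⟩
  funext x
  -- The unit field is determined by `-𝒞_e ζ = ζ`, as `𝒞_• ζ` is injective.
  exact (hbij x).1 (neg_injective ((h𝓖.1 x).trans (hunit x).symm))
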